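/- \textbf{Setting.} Let $\varphi_1<\varphi_2<\varphi_3<\varphi_4<\varphi_1+2\pi$ with $\varphi_1=2\pi-\varphi_4$, and let $\Gamma_{E_1}=\{e^{i\varphi}:\varphi_1\le\varphi\le\varphi_2\}$, $\Gamma_{E_2}=\{e^{i\varphi}:\varphi_3\le\varphi\le\varphi_4\}$, $\Gamma_E=\Gamma_{E_1}\cup\Gamma_{E_2}$, $\Omega=\overline{\mathbb C}\setminus\Gamma_E$. Let $k>0$ be given by $$k^2=\frac{e^{i\varphi_4}-e^{i\varphi_1}}{e^{i\varphi_4}-e^{i\varphi_2}}:\frac{e^{i\varphi_3}-e^{i\varphi_1}}{e^{i\varphi_3}-e^{i\varphi_2}},$$ let $K=\int_0^1\frac{dx}{\sqrt{(1-x^2)(1-k^2x^2)}}$, let $K'$ be the same integral with $k$ replaced by $k'=\sqrt{1-k^2}$, let $q=e^{-\pi K'/K}$, let $\operatorname{sn}$ be the Jacobian elliptic function of modulus $k$, and let $$H(z)=2\sum_{j=0}^\infty(-1)^jq^{(j+1/2)^2}\sin\frac{(2j+1)\pi z}{2K}.$$ Put $\alpha=-\tan\frac{\varphi_1}2\cot\frac{\varphi_2}2$,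 $\Box=\{u\in\mathbb C:-K<\Re u<0,\ -K'<\Im u\le K'\}$, and for $u\in\Box$ $$\phi(u)=\frac{2\operatorname{sn}^2u\,\sin\frac{\varphi_1}2\,e^{i\varphi_2/2}+(\alpha-1)\sin\frac{\varphi_2}2\,e^{i\varphi_1/2}}{2\operatorname{sn}^2u\,\sin\frac{\varphi_1}2\,e^{-i\varphi_2/2}+(\alpha-1)\sin\frac{\varphi_2}2\,e^{-i\varphi_1/2}}\in\overline{\mathbb C}.$$ For $c_0\in\Omega$, the Green's function $g_\Omega(\cdot,c_0)$ is the function harmonic in $\Omega\setminus\{c_0\}$ that tends to $0$ at every point of $\partial\Omega$ and satisfies $g_\Omega(z,c_0)=-\log|z-c_0|+O(1)$ as $z\to c_0$ (if $c_0=\infty$: $g_\Omega(z,\infty)=\log|z|+O(1)$ as $z\to\infty$). The harmonic measure $\omega_j$ of $\Gamma_{E_j}$ is the harmonic function on $\Omega$ with boundary values $1$ on $\Gamma_{E_j}$ and $0$ on the other arc. The logarithmic capacity of $\Gamma_E$ is $\operatorname{cap}(\Gamma_E)=e^{-\rho}$, where $\rho=\lim_{z\to\infty}\left(g_\Omega(z,\infty)-\log|z|\right)$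 is the Robin constant. \textbf{Statement.} The map $\phi$ is a bijection of $\Box$ onto $\Omega$; there is exactly one $\zeta\in\Box$ with $$\operatorname{sn}^2\zeta=\frac{\sin\frac{\varphi_1+\varphi_2}2\,e^{i(\varphi_2-\varphi_1)/2}}{\sin\varphi_1};$$ the Green's functions and harmonic measures above exist, and the following hold. a) For all $\gamma,u\in\Box$ with $u\ne\gamma$, writing $c_0=\phi(\gamma)$ and $z=\phi(u)$, $$g_\Omega(z,c_0)=\log\left|\frac{H(u+\bar\gamma)}{H(u-\gamma)}\right|.$$ In particular, $\infty=\phi(\zeta)$. b) $\omega_2(\infty)=-\dfrac{\Re\zeta}{K}$ and $\omega_1(\infty)+\omega_2(\infty)=1$. c) The limit $\rho$ exists, and $\operatorname{cap}(\Gamma_E)=\left|\dfrac{H(2i\,\Im\zeta)}{H(2\zeta)}\right|$. -/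

import Mathlib

open Complex ComplexConjugate Filter Topology Set

noncomputable section

/-! ### Elliptic integrals, theta functions and the Jacobian elliptic function `sn` -/

/-- The complete elliptic integral of the first kind,
`K(k) = ∫₀¹ dx / √((1 - x²)(1 - k² x²))`. -/
def ellipticK (k : ℝ) : ℝ :=
  ∫ x in (0 : ℝ)..1, 1 / Real.sqrt ((1 - x ^ 2) * (1 - k ^ 2 * x ^ 2))

/-- `K' = K(k')`, with the complementary modulus `k' = √(1 - k²)`. -/
def ellipticK' (k : ℝ) : ℝ := ellipticK (Real.sqrt (1 - k ^ 2))

/-- The nome `q = exp(-π K'/K)`. -/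
def nome (k : ℝ) : ℝ := Real.exp (-Real.pi * ellipticK' k / ellipticK k)

/-- The theta function
`H(z) = 2 ∑_{j ≥ 0} (-1)^j q^{(j + 1/2)²} sin((2j + 1) π z / (2K))`. -/
def thetaH (k : ℝ) (z : ℂ) : ℂ :=
  2 * ∑' j : ℕ, (-1 : ℂ) ^ j * ((nome k ^ (((j : ℝ) + 1 / 2) ^ 2) : ℝ) : ℂ) *
    Complex.sin ((2 * (j : ℂ) + 1) * (Real.pi : ℂ) / (2 * (ellipticK k : ℂ)) * z)

/-- The theta function
`θ(z) = 1 + 2 ∑_{j ≥ 1} (-1)^j q^{j²} cos(j π z / K)` (the sum is shifted to start at `0`). -/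
def thetaT (k : ℝ) (z : ℂ) : ℂ :=
  1 + 2 * ∑' j : ℕ, (-1 : ℂ) ^ (j + 1) * ((nome k ^ ((j + 1) ^ 2) : ℝ) : ℂ) *
    Complex.cos (((j : ℂ) + 1) * (Real.pi : ℂ) / (ellipticK k : ℂ) * z)

/-- The Jacobian elliptic function of modulus `k`, as the quotient of theta functions
`sn(u; k) = k^{-1/2} H(u) / θ(u)`. Its poles, the zeros of `θ`, are the points congruent to `iK'`
modulo `2K` and `2iK'`. -/
def jacobiSn (k : ℝ) (u : ℂ) : ℂ :=
  ((Real.sqrt k : ℝ) : ℂ)⁻¹ * (thetaH k u / thetaT k u)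

/-! ### The two arcs and the conformal map onto their exterior -/

/-- The point `e^{i t}` of the unit circle. -/
def circlePt (t : ℝ) : ℂ := Complex.exp ((t : ℂ) * Complex.I)

/-- The double ratio `(z₁, z₂, z₃, z₄) = (z₄ - z₁)/(z₄ - z₂) : (z₃ - z₁)/(z₃ - z₂)`. -/
def doubleRatio (z₁ z₂ z₃ z₄ : ℂ) : ℂ :=
  ((z₄ - z₁) / (z₄ - z₂)) / ((z₃ - z₁) / (z₃ - z₂))

/-- The arc `{e^{i t} : s ≤ t ≤ t'}`, as a subset of the Riemann sphere `OnePoint ℂ`. -/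
def arc (s t : ℝ) : Set (OnePoint ℂ) := (fun x : ℝ => (circlePt x : OnePoint ℂ)) '' Icc s t

/-- The rectangle `-K < Re u < 0`, `-K' < Im u ≤ K'`. -/
def rect (k : ℝ) : Set ℂ :=
  {u | -ellipticK k < u.re ∧ u.re < 0 ∧ -ellipticK' k < u.im ∧ u.im ≤ ellipticK' k}

/-- `α = -tan(φ₁/2) cot(φ₂/2)`. -/
def alphaParam (φ₁ φ₂ : ℝ) : ℝ := -Real.tan (φ₁ / 2) * Real.cot (φ₂ / 2)

/-- The numerator of the conformal map. -/
def mapNum (k φ₁ φ₂ : ℝ) (u : ℂ) : ℂ :=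
  2 * jacobiSn k u ^ 2 * (Real.sin (φ₁ / 2) : ℂ) * circlePt (φ₂ / 2) +
    ((alphaParam φ₁ φ₂ - 1) * Real.sin (φ₂ / 2) : ℝ) * circlePt (φ₁ / 2)

/-- The denominator of the conformal map. -/
def mapDen (k φ₁ φ₂ : ℝ) (u : ℂ) : ℂ :=
  2 * jacobiSn k u ^ 2 * (Real.sin (φ₁ / 2) : ℂ) * circlePt (-(φ₂ / 2)) +
    ((alphaParam φ₁ φ₂ - 1) * Real.sin (φ₂ / 2) : ℝ) * circlePt (-(φ₁ / 2))

open Classical in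
/-- The map `φ` from the rectangle to the Riemann sphere. With `s = sn² u` it is the composition of
`w = α + (1 - α²) / (2 s - (1 - α))` and
`z = (w - i tan(φ₁/2)) / (w + i tan(φ₁/2))`, multiplied out. -/
def conformalMap (k φ₁ φ₂ : ℝ) (u : ℂ) : OnePoint ℂ :=
  if mapDen k φ₁ φ₂ u = 0 then OnePoint.infty
  else ((mapNum k φ₁ φ₂ u / mapDen k φ₁ φ₂ u : ℂ) : OnePoint ℂ)

/-! ### Potential theory on the Riemann sphere -/

open Classical in
/-- The chart at infinity: `w ↦ 1/w`, with `0 ↦ ∞`. -/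
def chartInfty (w : ℂ) : OnePoint ℂ :=
  if w = 0 then OnePoint.infty else ((w⁻¹ : ℂ) : OnePoint ℂ)

/-- `g` is harmonic at (that is, in a neighbourhood of) the point `p` of the Riemann sphere. -/
def SphereHarmonicAt (g : OnePoint ℂ → ℝ) (p : OnePoint ℂ) : Prop :=
  (∀ c : ℂ, p = (c : OnePoint ℂ) →
    InnerProductSpace.HarmonicAt (fun z : ℂ => g (z : OnePoint ℂ)) c) ∧
  (p = OnePoint.infty → InnerProductSpace.HarmonicAt (fun w : ℂ => g (chartInfty w)) 0)

/-- `g` has a normalized positive logarithmic pole at `p`: `g(z) = -log|z - p| + O(1)` as `z → p`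
if `p` is finite, and `g(z) = log|z| + O(1)` as `z → ∞` if `p = ∞`. -/
def HasLogPole (g : OnePoint ℂ → ℝ) (p : OnePoint ℂ) : Prop :=
  (∀ c : ℂ, p = (c : OnePoint ℂ) →
    (fun z : ℂ => g (z : OnePoint ℂ) + Real.log ‖z - c‖) =O[𝓝[≠] c] (fun _ => (1 : ℝ))) ∧
  (p = OnePoint.infty →
    (fun z : ℂ => g (z : OnePoint ℂ) - Real.log ‖z‖) =O[Bornology.cobounded ℂ]
      (fun _ => (1 : ℝ)))

/-- `g` is the Green's function of the domain `Ω` of the Riemann sphere with pole `c₀`: it is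
harmonic in `Ω ∖ {c₀}`, has a logarithmic pole at `c₀`, and tends to `0` at every boundary point.
Only the values of `g` on `Ω ∖ {c₀}` matter. -/
structure IsGreenFunction (Ω : Set (OnePoint ℂ)) (c₀ : OnePoint ℂ) (g : OnePoint ℂ → ℝ) :
    Prop where
  harmonic : ∀ p ∈ Ω, p ≠ c₀ → SphereHarmonicAt g p
  pole : HasLogPole g c₀
  boundary : ∀ ξ ∈ frontier Ω, Tendsto g (𝓝[Ω] ξ) (𝓝 0)

/-- `ω` is, as a function of the base point, the harmonic measure with respect to `Ω` of a
boundary part `A` that is relatively open and closed in the boundary of `Ω`: the harmonic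
function on `Ω` with boundary values `1` on `A` and `0` on the rest of the boundary. -/
structure IsHarmonicMeasure (Ω A : Set (OnePoint ℂ)) (ω : OnePoint ℂ → ℝ) : Prop where
  harmonic : ∀ p ∈ Ω, SphereHarmonicAt ω p
  boundary_one : ∀ ξ ∈ frontier Ω ∩ A, Tendsto ω (𝓝[Ω] ξ) (𝓝 1)
  boundary_zero : ∀ ξ ∈ frontier Ω \ A, Tendsto ω (𝓝[Ω] ξ) (𝓝 0)

/-- The compact plane set `E` (with connected complement) has logarithmic capacity `τ`:
`τ = e^{-ρ}`, where `ρ = lim_{z → ∞} (g(z, ∞) - log|z|)` is the Robin constant and `g(·, ∞)` the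
Green's function of the complement of `E` with pole at infinity. -/
def HasLogCapacity (E : Set (OnePoint ℂ)) (τ : ℝ) : Prop :=
  ∃ (g : OnePoint ℂ → ℝ) (ρ : ℝ), IsGreenFunction Eᶜ OnePoint.infty g ∧
    Tendsto (fun z : ℂ => g (z : OnePoint ℂ) - Real.log ‖z‖) (Bornology.cobounded ℂ) (𝓝 ρ) ∧
    τ = Real.exp (-ρ)

end

/-! Put t = K'/K and v = u/(2K). Then H and θ become the theta functions `th1` and `th4` of nome
exp(-πt), and the rectangle becomes half of a period rectangle of ℤ + itℤ, lying in the strip -1/2 <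
Re v < 0. Up to the factor 1/k, sn² is (`th1`/`th4`)², so the map φ is a Möbius transformation of an
even elliptic function of order two (`arcMap`, a case of `thetaMap`).

The carrying identity is `thetaMap_cross`: the determinant of the homogeneous coordinates of the
values at u and v is a constant times `th1`(u+v)`th1`(u-v). Since the zeros of `th1` are exactly the
lattice points (`th1_eq_zero_iff`), two values agree only if u ≡ ±v modulo the lattice. Surjectivity
onto the sphere is Liouville's theorem (`exists_th_comb_eq_zero`). Hence the strip is mapped onto
the complement of the images of its two boundary lines (`thetaMap_image_vstrip`).

On these lines (`th1`/`th4`)² is real or infinite, and the Möbius transformation sends the real line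
to the unit circle. The intermediate value theorem shows that the images are the two given arcs
(`arc_left_eq`, `arc_right_eq`). For the second arc the theta constants must be matched with k:
(`th2`(0)/`th3`(0))² = k for t = K'/K. This is Jacobi inversion (`thetaModulus_ratio`), obtained by
evaluating K and K' through the differential equation of the theta quotient and from the strict
monotonicity of K'/K in the modulus.

Potential theory on Ω thus becomes potential theory of it-periodic functions on the strip
(`stripLift`). The function log|`th1`(v+γ̄)/`th1`(v-γ)| is periodic, has a logarithmic pole at γ and
vanishes on both lines by reflection; the harmonic measures are affine functions of Re v. Uniqueness
is the maximum principle on the sphere. For the capacity, `thetaMap_cross` factors both numerator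
and denominator of z = φ(u) into values of `th1`; in g - log|z| the factors that vanish at ζ cancel,
and the limit can be read off (`tendsto_stripLift_sub_log`). -/

noncomputable section

/-! ### The four theta functions with nome `exp (-π t)` and period lattice `ℤ + i t ℤ` -/

/-- The third theta function. -/
def th3 (t : ℝ) (v : ℂ) : ℂ := jacobiTheta₂ v (t * I)

/-- The fourth theta function. -/
def th4 (t : ℝ) (v : ℂ) : ℂ := th3 t (v + 1 / 2)

/-- The second theta function. -/
def th2 (t : ℝ) (v : ℂ) : ℂ := cexp (-(Real.pi * t / 4) + Real.pi * I * v) * th3 t (v + t * I / 2)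

/-- The first theta function. -/
def th1 (t : ℝ) (v : ℂ) : ℂ := -th2 t (v + 1 / 2)

/-- The equivalence of `ℤ × ℤ` with two copies of itself, according to the parity of the sum. -/
def intProdParityEquiv : (ℤ × ℤ) ⊕ (ℤ × ℤ) ≃ ℤ × ℤ :=
  Equiv.ofBijective
    (Sum.elim (fun p => (p.1 + p.2, p.1 - p.2)) (fun p => (p.1 + p.2 + 1, p.1 - p.2))) <| by
    constructor
    · rintro (⟨a, b⟩ | ⟨a, b⟩) (⟨c, d⟩ | ⟨c, d⟩) h <;>
        simp only [Sum.elim_inl, Sum.elim_inr, Prod.mk.injEq, reduceCtorEq, Sum.inl.injEq,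
          Sum.inr.injEq] at h ⊢ <;> omega
    · rintro ⟨m, n⟩
      rcases Int.even_or_odd' (m + n) with ⟨a, ha | ha⟩
      · exact ⟨Sum.inl (a, m - a), by simp; omega⟩
      · exact ⟨Sum.inr (a, a - n), by simp; omega⟩

@[simp] lemma intProdParityEquiv_inl (p : ℤ × ℤ) :
    intProdParityEquiv (Sum.inl p) = (p.1 + p.2, p.1 - p.2) := rfl

@[simp] lemma intProdParityEquiv_inr (p : ℤ × ℤ) :
    intProdParityEquiv (Sum.inr p) = (p.1 + p.2 + 1, p.1 - p.2) := rfl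

lemma summable_norm_theta_term (z : ℂ) {τ : ℂ} (hτ : 0 < τ.im) :
    Summable fun n : ℤ => ‖jacobiTheta₂_term n z τ‖ :=
  ((summable_jacobiTheta₂_term_iff z τ).2 hτ).norm

/-- The product of two values of a theta function, in terms of the doubled period. -/
lemma th3_mul (t : ℝ) (ht : 0 < t) (x y : ℂ) :
    th3 t (x + y) * th3 t (x - y) =
      th3 (2 * t) (2 * x) * th3 (2 * t) (2 * y) + th2 (2 * t) (2 * x) * th2 (2 * t) (2 * y) := by
  have h1 : 0 < ((t : ℂ) * I).im := by simpa using ht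
  have h2 : 0 < (((2 * t : ℝ) : ℂ) * I).im := by simpa using ht
  have S := fun (z : ℂ) => summable_norm_theta_term z h1
  have S2 := fun (z : ℂ) => summable_norm_theta_term z h2
  have P := (summable_mul_of_summable_norm (S (x + y)) (S (x - y))).hasSum
  have P1 := (summable_mul_of_summable_norm (S2 (2 * x)) (S2 (2 * y))).hasSum
  have P2 := (summable_mul_of_summable_norm (S2 (2 * x + (2 * t : ℝ) * I / 2))
    (S2 (2 * y + (2 * t : ℝ) * I / 2))).hasSum
  rw [← tsum_mul_tsum_of_summable_norm (S _) (S _)] at P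
  rw [← tsum_mul_tsum_of_summable_norm (S2 _) (S2 _)] at P1 P2
  have P2' := P2.mul_left (cexp (-(Real.pi * (2 * t : ℝ) / 4) + Real.pi * I * (2 * x)) *
    cexp (-(Real.pi * (2 * t : ℝ) / 4) + Real.pi * I * (2 * y)))
  have Q := (intProdParityEquiv.hasSum_iff).2 P
  -- The two parity classes of (m, n) diagonalise the exponent: m² + n² is 2a² + 2b² for m = a + b,
  -- n = a - b, and 2(a + 1/2)² + 2(b + 1/2)² for m = a + b + 1, n = a - b. The first class gives
  -- the `th3` products of period 2t, the second the `th2` products.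
  have R : HasSum ((fun p : ℤ × ℤ => jacobiTheta₂_term p.1 (x + y) (t * I) *
      jacobiTheta₂_term p.2 (x - y) (t * I)) ∘ intProdParityEquiv)
      (th3 (2 * t) (2 * x) * th3 (2 * t) (2 * y) +
        th2 (2 * t) (2 * x) * th2 (2 * t) (2 * y)) := by
    have : th2 (2 * t) (2 * x) * th2 (2 * t) (2 * y) =
      (cexp (-(Real.pi * (2 * t : ℝ) / 4) + Real.pi * I * (2 * x)) *
        cexp (-(Real.pi * (2 * t : ℝ) / 4) + Real.pi * I * (2 * y))) *
      (jacobiTheta₂ (2 * x + (2 * t : ℝ) * I / 2) ((2 * t : ℝ) * I) *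
        jacobiTheta₂ (2 * y + (2 * t : ℝ) * I / 2) ((2 * t : ℝ) * I)) := by
      simp only [th2, th3]; ring
    rw [this]
    refine HasSum.sum ?_ ?_
    · refine P1.congr_fun ?_
      rintro ⟨a, b⟩
      simp only [Function.comp, intProdParityEquiv_inl,
        jacobiTheta₂_term, ← Complex.exp_add]
      congr 1; push_cast; ring
    · refine P2'.congr_fun ?_
      rintro ⟨a, b⟩
      simp only [Function.comp, intProdParityEquiv_inr,
        jacobiTheta₂_term, ← Complex.exp_add]
      congr 1; push_cast; ring_nf; simp only [I_sq]; ring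
  exact Q.unique R

/-! ### Symmetries and quasi-periodicity of the theta functions -/

lemma th3_neg (t : ℝ) (v : ℂ) : th3 t (-v) = th3 t v := jacobiTheta₂_neg_left _ _

lemma th3_add_one (t : ℝ) (v : ℂ) : th3 t (v + 1) = th3 t v := jacobiTheta₂_add_left _ _

lemma th3_add_period (t : ℝ) (v : ℂ) :
    th3 t (v + t * I) = cexp (Real.pi * t - 2 * Real.pi * I * v) * th3 t v := by
  rw [th3, jacobiTheta₂_add_left', th3]
  congr 2
  ring_nf; simp only [I_sq]; ring

lemma th3_add_half_period (t : ℝ) (v : ℂ) :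
    th3 t (v + t * I / 2) = cexp (Real.pi * t / 4 - Real.pi * I * v) * th2 t v := by
  rw [th2, ← mul_assoc, ← Complex.exp_add]
  ring_nf; simp

lemma th2_add_half_period (t : ℝ) (v : ℂ) :
    th2 t (v + t * I / 2) = cexp (Real.pi * t / 4 - Real.pi * I * v) * th3 t v := by
  rw [th2, show v + t * I / 2 + t * I / 2 = v + t * I by ring, th3_add_period, ← mul_assoc,
    ← Complex.exp_add]
  congr 2; ring_nf; simp only [I_sq]; ring

lemma th2_neg (t : ℝ) (v : ℂ) : th2 t (-v) = th2 t v := by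
  have h := th3_add_period t (v - t * I / 2)
  rw [th2, th2, show -v + t * I / 2 = -(v - t * I / 2) by ring, th3_neg,
    show v + t * I / 2 = v - t * I / 2 + t * I by ring, h, ← mul_assoc, ← Complex.exp_add]
  congr 2; ring_nf; simp only [I_sq]; ring

lemma th2_add_one (t : ℝ) (v : ℂ) : th2 t (v + 1) = -th2 t v := by
  rw [th2, th2, show v + 1 + t * I / 2 = (v + t * I / 2) + 1 by ring, th3_add_one,
    show -(Real.pi * t / 4) + Real.pi * I * (v + 1) =
      (-(Real.pi * t / 4) + Real.pi * I * v) + Real.pi * I by ring, Complex.exp_add, exp_pi_mul_I]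
  ring

lemma th3_add_half (t : ℝ) (v : ℂ) : th3 t (v + 1 / 2) = th4 t v := rfl

lemma th4_add_half (t : ℝ) (v : ℂ) : th4 t (v + 1 / 2) = th3 t v := by
  rw [th4, show v + 1 / 2 + 1 / 2 = v + 1 by ring, th3_add_one]

lemma th2_add_half (t : ℝ) (v : ℂ) : th2 t (v + 1 / 2) = -th1 t v := by rw [th1, neg_neg]

lemma th1_add_half (t : ℝ) (v : ℂ) : th1 t (v + 1 / 2) = th2 t v := by
  rw [th1, show v + 1 / 2 + 1 / 2 = v + 1 by ring, th2_add_one, neg_neg]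

lemma th1_neg (t : ℝ) (v : ℂ) : th1 t (-v) = -th1 t v := by
  rw [th1, th1, ← th2_neg, show -(-v + 1 / 2) = v - 1 / 2 by ring,
    show v + 1 / 2 = v - 1 / 2 + 1 by ring, th2_add_one, neg_neg]

lemma th4_neg (t : ℝ) (v : ℂ) : th4 t (-v) = th4 t v := by
  rw [th4, th4, ← th3_neg, show -(-v + 1 / 2) = v - 1 / 2 by ring,
    show v + 1 / 2 = v - 1 / 2 + 1 by ring, th3_add_one]

lemma th1_zero (t : ℝ) : th1 t 0 = 0 := by
  have h := th1_neg t 0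
  rw [neg_zero] at h
  exact self_eq_neg.1 h

lemma th1_add_one (t : ℝ) (v : ℂ) : th1 t (v + 1) = -th1 t v := by
  rw [th1, th1, show v + 1 + 1 / 2 = v + 1 / 2 + 1 by ring, th2_add_one]

lemma th4_add_one (t : ℝ) (v : ℂ) : th4 t (v + 1) = th4 t v := by
  rw [th4, th4, show v + 1 + 1 / 2 = v + 1 / 2 + 1 by ring, th3_add_one]

lemma th2_add_period (t : ℝ) (v : ℂ) :
    th2 t (v + t * I) = cexp (Real.pi * t - 2 * Real.pi * I * v) * th2 t v := by
  rw [show v + t * I = v + t * I / 2 + t * I / 2 by ring, th2_add_half_period,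
    th3_add_half_period, ← mul_assoc, ← Complex.exp_add]
  congr 2; ring_nf; simp only [I_sq]; ring

lemma th1_add_period (t : ℝ) (v : ℂ) :
    th1 t (v + t * I) = -cexp (Real.pi * t - 2 * Real.pi * I * v) * th1 t v := by
  rw [th1, th1, show v + t * I + 1 / 2 = v + 1 / 2 + t * I by ring, th2_add_period,
    show (Real.pi * t - 2 * Real.pi * I * (v + 1 / 2) : ℂ) =
      (Real.pi * t - 2 * Real.pi * I * v) - Real.pi * I by ring, Complex.exp_sub, exp_pi_mul_I]
  ring

lemma th4_add_period (t : ℝ) (v : ℂ) :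
    th4 t (v + t * I) = -cexp (Real.pi * t - 2 * Real.pi * I * v) * th4 t v := by
  rw [th4, th4, show v + t * I + 1 / 2 = v + 1 / 2 + t * I by ring, th3_add_period,
    show (Real.pi * t - 2 * Real.pi * I * (v + 1 / 2) : ℂ) =
      (Real.pi * t - 2 * Real.pi * I * v) - Real.pi * I by ring, Complex.exp_sub, exp_pi_mul_I]
  ring

lemma th4_add_half_period (t : ℝ) (v : ℂ) :
    th4 t (v + t * I / 2) = I * cexp (Real.pi * t / 4 - Real.pi * I * v) * th1 t v := by
  rw [th4, th1, show v + t * I / 2 + 1 / 2 = v + 1 / 2 + t * I / 2 by ring, th3_add_half_period,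
    show (Real.pi * t / 4 - Real.pi * I * (v + 1 / 2) : ℂ) =
      (Real.pi * t / 4 - Real.pi * I * v) + -Real.pi / 2 * I by ring, Complex.exp_add,
      exp_neg_pi_div_two_mul_I]
  ring

lemma th1_add_half_period (t : ℝ) (v : ℂ) :
    th1 t (v + t * I / 2) = I * cexp (Real.pi * t / 4 - Real.pi * I * v) * th4 t v := by
  rw [th4, th1, show v + t * I / 2 + 1 / 2 = v + 1 / 2 + t * I / 2 by ring, th2_add_half_period,
    show (Real.pi * t / 4 - Real.pi * I * (v + 1 / 2) : ℂ) =
      (Real.pi * t / 4 - Real.pi * I * v) + -Real.pi / 2 * I by ring, Complex.exp_add,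
      exp_neg_pi_div_two_mul_I]
  ring

lemma th3_conj (t : ℝ) (v : ℂ) : th3 t (conj v) = conj (th3 t v) := by
  rw [th3, th3, jacobiTheta₂_conj]
  simp

lemma th4_conj (t : ℝ) (v : ℂ) : th4 t (conj v) = conj (th4 t v) := by
  rw [th4, th4, ← th3_conj]; simp [map_ofNat]

lemma th2_conj (t : ℝ) (v : ℂ) : th2 t (conj v) = conj (th2 t v) := by
  conv_lhs => rw [← th2_neg]
  rw [th2, th2, map_mul, ← th3_conj, ← exp_conj, ← th3_neg]
  congr 2 <;> simp [map_ofNat]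
  ring

lemma th1_conj (t : ℝ) (v : ℂ) : th1 t (conj v) = conj (th1 t v) := by
  rw [th1, th1, map_neg, ← th2_conj]; simp [map_ofNat]

lemma differentiable_th3 {t : ℝ} (ht : 0 < t) : Differentiable ℂ (th3 t) := fun v =>
  differentiableAt_jacobiTheta₂_fst v (by simpa using ht)

lemma differentiable_th4 {t : ℝ} (ht : 0 < t) : Differentiable ℂ (th4 t) :=
  (differentiable_th3 ht).comp (differentiable_id.add_const _)

lemma differentiable_th2 {t : ℝ} (ht : 0 < t) : Differentiable ℂ (th2 t) := by
  have h : Differentiable ℂ fun v => th3 t (v + t * I / 2) :=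
    (differentiable_th3 ht).comp (differentiable_id.add_const _)
  have h' : Differentiable ℂ fun v : ℂ => cexp (-(Real.pi * t / 4) + Real.pi * I * v) := by fun_prop
  exact h'.mul h

lemma differentiable_th1 {t : ℝ} (ht : 0 < t) : Differentiable ℂ (th1 t) :=
  ((differentiable_th2 ht).comp (differentiable_id.add_const _)).neg

/-! ### Product formulas and quadratic relations -/

lemma th4_mul (t : ℝ) (ht : 0 < t) (x y : ℂ) :
    th4 t (x + y) * th4 t (x - y) =
      th3 (2 * t) (2 * x) * th3 (2 * t) (2 * y) - th2 (2 * t) (2 * x) * th2 (2 * t) (2 * y) := by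
  have h := th3_mul t ht (x + 1 / 2) y
  rw [show 2 * (x + 1 / 2) = 2 * x + 1 by ring, th3_add_one, th2_add_one,
    show x + 1 / 2 + y = x + y + 1 / 2 by ring, show x + 1 / 2 - y = x - y + 1 / 2 by ring] at h
  rw [th4, th4, h]; ring

/-- Shifting x by half the period it/2 in `th3_mul` turns both factors on the left into `th2`. On
the right it shifts 2x by half of the doubled period, which swaps `th2` and `th3`. The exponential
factors on the two sides agree and cancel. -/
lemma th2_mul (t : ℝ) (ht : 0 < t) (x y : ℂ) :
    th2 t (x + y) * th2 t (x - y) =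
      th2 (2 * t) (2 * x) * th3 (2 * t) (2 * y) + th3 (2 * t) (2 * x) * th2 (2 * t) (2 * y) := by
  have h := th3_mul t ht (x + t * I / 2) y
  rw [show 2 * (x + t * I / 2) = 2 * x + (2 * t : ℝ) * I / 2 by push_cast; ring,
    th3_add_half_period, th2_add_half_period,
    show x + t * I / 2 + y = x + y + t * I / 2 by ring,
    show x + t * I / 2 - y = x - y + t * I / 2 by ring, th3_add_half_period,
    th3_add_half_period] at h
  have e : cexp (Real.pi * t / 4 - Real.pi * I * (x + y)) *
      cexp (Real.pi * t / 4 - Real.pi * I * (x - y)) =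
      cexp (Real.pi * (2 * t : ℝ) / 4 - Real.pi * I * (2 * x)) := by
    rw [← Complex.exp_add]; congr 1; push_cast; ring
  have e0 := Complex.exp_ne_zero (Real.pi * (2 * t : ℝ) / 4 - Real.pi * I * (2 * x))
  apply mul_left_cancel₀ e0
  rw [← e] at h ⊢
  linear_combination h

lemma th1_mul (t : ℝ) (ht : 0 < t) (x y : ℂ) :
    th1 t (x + y) * th1 t (x - y) =
      th3 (2 * t) (2 * x) * th2 (2 * t) (2 * y) - th2 (2 * t) (2 * x) * th3 (2 * t) (2 * y) := by
  have h := th2_mul t ht (x + 1 / 2) y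
  rw [show 2 * (x + 1 / 2) = 2 * x + 1 by ring, th3_add_one, th2_add_one,
    show x + 1 / 2 + y = x + y + 1 / 2 by ring, show x + 1 / 2 - y = x - y + 1 / 2 by ring] at h
  rw [th1, th1, neg_mul_neg, h]; ring

/-- With y = 0 the squares of all four theta functions are linear combinations of the same two
functions, `th3` and `th2` of period 2t at 2x. Every quadratic relation below is an elimination of
these two. -/
lemma th1_sq {t : ℝ} (ht : 0 < t) (x : ℂ) : th1 t x ^ 2 =
    th3 (2 * t) (2 * x) * th2 (2 * t) 0 - th2 (2 * t) (2 * x) * th3 (2 * t) 0 := by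
  have h := th1_mul t ht x 0
  simp only [add_zero, sub_zero, mul_zero] at h
  rw [sq, h]

lemma th2_sq {t : ℝ} (ht : 0 < t) (x : ℂ) : th2 t x ^ 2 =
    th2 (2 * t) (2 * x) * th3 (2 * t) 0 + th3 (2 * t) (2 * x) * th2 (2 * t) 0 := by
  have h := th2_mul t ht x 0
  simp only [add_zero, sub_zero, mul_zero] at h
  rw [sq, h]

lemma th3_sq {t : ℝ} (ht : 0 < t) (x : ℂ) : th3 t x ^ 2 =
    th3 (2 * t) (2 * x) * th3 (2 * t) 0 + th2 (2 * t) (2 * x) * th2 (2 * t) 0 := by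
  have h := th3_mul t ht x 0
  simp only [add_zero, sub_zero, mul_zero] at h
  rw [sq, h]

lemma th4_sq {t : ℝ} (ht : 0 < t) (x : ℂ) : th4 t x ^ 2 =
    th3 (2 * t) (2 * x) * th3 (2 * t) 0 - th2 (2 * t) (2 * x) * th2 (2 * t) 0 := by
  have h := th4_mul t ht x 0
  simp only [add_zero, sub_zero, mul_zero] at h
  rw [sq, h]

/-- The addition formula for the quotient of the first and the fourth theta function. -/
lemma th1_mul_th1 {t : ℝ} (ht : 0 < t) (x y : ℂ) :
    th1 t (x + y) * th1 t (x - y) * th4 t 0 ^ 2 =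
      th1 t x ^ 2 * th4 t y ^ 2 - th4 t x ^ 2 * th1 t y ^ 2 := by
  rw [th1_mul t ht, th1_sq ht, th1_sq ht, th4_sq ht, th4_sq ht, th4_sq ht, mul_zero]; ring

/-- The addition formula for the quotient of the first and the second theta function. -/
lemma th1_mul_th1' {t : ℝ} (ht : 0 < t) (x y : ℂ) :
    th1 t (x + y) * th1 t (x - y) * th2 t 0 ^ 2 =
      th1 t x ^ 2 * th2 t y ^ 2 - th2 t x ^ 2 * th1 t y ^ 2 := by
  rw [th1_mul t ht, th1_sq ht, th1_sq ht, th2_sq ht, th2_sq ht, th2_sq ht, mul_zero]; ring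

/-- With a, b the values at 0 of `th3`, `th2` for period 2t, the squares of `th2`, `th3`, `th4` at 0
are 2ab, a² + b², a² - b². The relation makes `thetaModulus` and `thetaModulus'` complementary
moduli. -/
lemma th_quartic {t : ℝ} (ht : 0 < t) : th2 t 0 ^ 4 + th4 t 0 ^ 4 = th3 t 0 ^ 4 := by
  rw [show th2 t 0 ^ 4 = (th2 t 0 ^ 2) ^ 2 by ring, show th4 t 0 ^ 4 = (th4 t 0 ^ 2) ^ 2 by ring,
    show th3 t 0 ^ 4 = (th3 t 0 ^ 2) ^ 2 by ring, th2_sq ht, th3_sq ht, th4_sq ht, mul_zero]; ring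

lemma th_sq_add₁ {t : ℝ} (ht : 0 < t) (x : ℂ) :
    th3 t 0 ^ 2 * th1 t x ^ 2 + th4 t 0 ^ 2 * th2 t x ^ 2 = th2 t 0 ^ 2 * th4 t x ^ 2 := by
  rw [th1_sq ht, th2_sq ht, th2_sq ht, th3_sq ht, th4_sq ht, th4_sq ht, mul_zero]; ring

lemma th_sq_add₂ {t : ℝ} (ht : 0 < t) (x : ℂ) :
    th2 t 0 ^ 2 * th1 t x ^ 2 + th4 t 0 ^ 2 * th3 t x ^ 2 = th3 t 0 ^ 2 * th4 t x ^ 2 := by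
  rw [th1_sq ht, th2_sq ht, th3_sq ht, th3_sq ht, th4_sq ht, th4_sq ht, mul_zero]; ring

lemma th_sq_add₃ {t : ℝ} (ht : 0 < t) (x : ℂ) :
    th3 t 0 ^ 2 * th2 t x ^ 2 + th4 t 0 ^ 2 * th1 t x ^ 2 = th2 t 0 ^ 2 * th3 t x ^ 2 := by
  rw [th1_sq ht, th2_sq ht, th2_sq ht, th3_sq ht, th3_sq ht, th4_sq ht, mul_zero]; ring

/-! ### Real values -/

lemma th3_real (t x : ℝ) : (th3 t x).im = 0 := by
  rw [← Complex.conj_eq_iff_im, ← th3_conj, conj_ofReal]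

lemma th4_real (t x : ℝ) : (th4 t x).im = 0 := by
  rw [← Complex.conj_eq_iff_im, ← th4_conj, conj_ofReal]

lemma th2_real (t x : ℝ) : (th2 t x).im = 0 := by
  rw [← Complex.conj_eq_iff_im, ← th2_conj, conj_ofReal]

lemma th1_real (t x : ℝ) : (th1 t x).im = 0 := by
  rw [← Complex.conj_eq_iff_im, ← th1_conj, conj_ofReal]

lemma th3_imag (t y : ℝ) : (th3 t (y * I)).im = 0 := by
  rw [← Complex.conj_eq_iff_im, ← th3_conj, ← th3_neg]; simp

lemma th4_imag (t y : ℝ) : (th4 t (y * I)).im = 0 := by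
  rw [← Complex.conj_eq_iff_im, ← th4_conj, ← th4_neg]; simp

lemma th2_imag (t y : ℝ) : (th2 t (y * I)).im = 0 := by
  rw [← Complex.conj_eq_iff_im, ← th2_conj, ← th2_neg]; simp

lemma th1_imag (t y : ℝ) : (th1 t (y * I)).re = 0 := by
  have h : conj (th1 t (y * I)) = -th1 t (y * I) := by
    rw [← th1_conj, ← th1_neg]; simp
  have := congrArg Complex.re h
  simp at this
  linarith

/-- On the imaginary axis every term of the theta series is a positive real exponential. -/
lemma th3_imag_pos {t : ℝ} (ht : 0 < t) (y : ℝ) : 0 < (th3 t (y * I)).re := by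
  have h := hasSum_jacobiTheta₂_term (y * I) (τ := t * I) (by simpa using ht)
  have h2 := Complex.hasSum_re h
  have e : ∀ n : ℤ, (jacobiTheta₂_term n (y * I) (t * I)).re =
      Real.exp (-2 * Real.pi * n * y - Real.pi * n ^ 2 * t) := by
    intro n
    rw [jacobiTheta₂_term, show (2 * Real.pi * I * n * (y * I) + Real.pi * I * n ^ 2 * (t * I) : ℂ)
      = ((-2 * Real.pi * n * y - Real.pi * n ^ 2 * t : ℝ) : ℂ) by
        push_cast; ring_nf; simp only [I_sq]; ring, ← Complex.ofReal_exp, ofReal_re]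
  simp only [e] at h2
  exact h2.tsum_eq ▸ h2.summable.tsum_pos (fun n => (Real.exp_pos _).le) 0 (Real.exp_pos _)

lemma th3_zero_pos {t : ℝ} (ht : 0 < t) : 0 < (th3 t 0).re := by
  simpa using th3_imag_pos ht 0

lemma th2_imag_pos {t : ℝ} (ht : 0 < t) (y : ℝ) : 0 < (th2 t (y * I)).re := by
  have h := th3_imag_pos ht (y + t / 2)
  have e : th2 t (y * I) = (Real.exp (-(Real.pi * t / 4) - Real.pi * y) : ℝ) *
      th3 t ((y + t / 2 : ℝ) * I) := by
    rw [th2]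
    push_cast
    congr 2
    · ring_nf; simp only [I_sq]; ring
    · ring
  rw [e, re_ofReal_mul]
  positivity

lemma th2_zero_pos {t : ℝ} (ht : 0 < t) : 0 < (th2 t 0).re := by
  simpa using th2_imag_pos ht 0

lemma th3_zero_ne {t : ℝ} (ht : 0 < t) : th3 t 0 ≠ 0 := fun h => by
  simpa [h] using th3_zero_pos ht

lemma th2_zero_ne {t : ℝ} (ht : 0 < t) : th2 t 0 ≠ 0 := fun h => by
  simpa [h] using th2_zero_pos ht

/-! ### Trigonometric series -/

/-- The terms n and -n-1 of the bilateral series have the same Gaussian factor and combine to a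
sine. -/
lemma hasSum_th1 {t : ℝ} (ht : 0 < t) (v : ℂ) :
    HasSum (fun j : ℕ => 2 * ((-1 : ℂ) ^ j * (Real.exp (-Real.pi * t * ((j : ℝ) + 1 / 2) ^ 2) : ℝ) *
      Complex.sin ((2 * (j : ℂ) + 1) * (Real.pi * v)))) (th1 t v) := by
  have h := (hasSum_jacobiTheta₂_term (v + 1 / 2 + t * I / 2) (τ := t * I) (by simpa using ht))
  have h2 := (h.mul_left
    (-cexp (-(Real.pi * t / 4) + Real.pi * I * (v + 1 / 2)))).nat_add_neg_add_one
  have e : -cexp (-(Real.pi * t / 4) + Real.pi * I * (v + 1 / 2)) *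
      jacobiTheta₂ (v + 1 / 2 + t * I / 2) (t * I) = th1 t v := by
    rw [th1, th2, th3]; ring
  rw [e] at h2
  refine h2.congr_fun fun j => ?_
  have key : ∀ n : ℤ, -cexp (-(Real.pi * t / 4) + Real.pi * I * (v + 1 / 2)) *
      jacobiTheta₂_term n (v + 1 / 2 + t * I / 2) (t * I) =
      -I * (-1 : ℂ) ^ n * cexp (-Real.pi * t * (n + 1 / 2) ^ 2) *
        cexp ((2 * n + 1) * (Real.pi * v) * I) := by
    intro n
    have e1 : (-1 : ℂ) ^ n = cexp (n * (Real.pi * I)) := by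
      rw [← exp_pi_mul_I, ← Complex.exp_int_mul]
    have e2 : I = cexp (Real.pi / 2 * I) := Complex.exp_pi_div_two_mul_I.symm
    have e3 : cexp (-(Real.pi * t / 4) + Real.pi * I * (v + 1 / 2)) *
      jacobiTheta₂_term n (v + 1 / 2 + t * I / 2) (t * I) = cexp (Real.pi / 2 * I) * (-1 : ℂ) ^ n *
      cexp (-Real.pi * t * (n + 1 / 2) ^ 2) *
        cexp ((2 * n + 1) * (Real.pi * v) * I) := by
      rw [e1, jacobiTheta₂_term, ← Complex.exp_add, ← Complex.exp_add, ← Complex.exp_add,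
        ← Complex.exp_add]
      congr 1
      ring_nf; simp only [I_sq]; ring
    rw [neg_mul, e3, Complex.exp_pi_div_two_mul_I]; ring
  have s1 : ((-1 : ℂ)) ^ (-((j : ℤ) + 1)) = -(-1) ^ j := by
    rw [zpow_neg, zpow_add₀ (by norm_num), zpow_natCast]
    rcases neg_one_pow_eq_or ℂ j with h | h <;> simp [h]
  rw [key, key, s1, zpow_natCast, Complex.sin]
  push_cast
  rw [show (-Real.pi * t * (-((j : ℂ) + 1) + 1 / 2) ^ 2 : ℂ) = -Real.pi * t * (j + 1 / 2) ^ 2 by ring,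
    show (2 * -((j : ℂ) + 1) + 1) * (Real.pi * v) * I = -((2 * j + 1) * (Real.pi * v)) * I by ring]
  ring

lemma hasSum_th4 {t : ℝ} (ht : 0 < t) (v : ℂ) :
    HasSum (fun j : ℕ => 2 * ((-1 : ℂ) ^ (j + 1) *
      (Real.exp (-Real.pi * t * ((j : ℝ) + 1) ^ 2) : ℝ) *
      Complex.cos (((j : ℂ) + 1) * (2 * Real.pi * v)))) (th4 t v - 1) := by
  have h := (hasSum_jacobiTheta₂_term (v + 1 / 2) (τ := t * I) (by simpa using ht))
  have h2 := h.nat_add_neg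
  -- Pairing n with -n counts the term n = 0 twice. Dropping index 0 of the paired series removes
  -- both copies, which leaves `th4` - 1.
  have h3 := (hasSum_nat_add_iff' 1).2 h2
  have e0 : jacobiTheta₂_term 0 (v + 1 / 2) (t * I) = 1 := by simp [jacobiTheta₂_term]
  have e : jacobiTheta₂ (v + 1 / 2) (t * I) + jacobiTheta₂_term 0 (v + 1 / 2) (t * I) -
      ∑ i ∈ Finset.range 1, (jacobiTheta₂_term (i : ℕ) (v + 1 / 2) (t * I) +
        jacobiTheta₂_term (-(i : ℕ)) (v + 1 / 2) (t * I)) = th4 t v - 1 := by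
    simp only [Finset.range_one, Finset.sum_singleton, Nat.cast_zero, neg_zero, e0, th4, th3]
    ring
  rw [e] at h3
  refine h3.congr_fun fun j => ?_
  have key : ∀ n : ℤ, jacobiTheta₂_term n (v + 1 / 2) (t * I) =
      (-1 : ℂ) ^ n * cexp (-Real.pi * t * n ^ 2) * cexp (n * (2 * Real.pi * v) * I) := by
    intro n
    have e1 : (-1 : ℂ) ^ n = cexp (n * (Real.pi * I)) := by
      rw [← exp_pi_mul_I, ← Complex.exp_int_mul]
    rw [e1, jacobiTheta₂_term, ← Complex.exp_add, ← Complex.exp_add]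
    congr 1
    ring_nf; simp only [I_sq]; ring
  have s1 : ((-1 : ℂ)) ^ (-((j + 1 : ℕ) : ℤ)) = (-1) ^ (j + 1) := by
    rw [zpow_neg, zpow_natCast]
    rcases neg_one_pow_eq_or ℂ (j + 1) with h | h <;> simp [h]
  rw [key, key, s1, zpow_natCast, Complex.cos]
  push_cast
  rw [neg_sq, show -((j : ℂ) + 1) * (2 * Real.pi * v) * I = -((j + 1) * (2 * Real.pi * v)) * I by ring]
  ring

/-- Induction through sin(a + x) = sin(a - x) + 2 cos a sin x. Keeping |sin x| as a factor allows
each term of the series of `th1` to be compared with the first one. -/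
lemma norm_sin_le (j : ℕ) (x : ℂ) :
    ‖Complex.sin ((2 * (j : ℂ) + 1) * x)‖ ≤
      (2 * j + 1) * Real.exp (2 * j * |x.im|) * ‖Complex.sin x‖ := by
  induction j with
  | zero => simp
  | succ j ih =>
    have e : Complex.sin ((2 * ((j + 1 : ℕ) : ℂ) + 1) * x) =
        Complex.sin ((2 * (j : ℂ) + 1) * x) + 2 * Complex.cos ((2 * j + 2) * x) * Complex.sin x := by
      rw [show (2 * ((j + 1 : ℕ) : ℂ) + 1) * x = (2 * j + 2) * x + x by push_cast; ring,
        show (2 * (j : ℂ) + 1) * x = (2 * j + 2) * x - x by ring, Complex.sin_add, Complex.sin_sub]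
      ring
    have c : ‖2 * Complex.cos ((2 * (j : ℂ) + 2) * x)‖ ≤ 2 * Real.exp (2 * (j + 1) * |x.im|) := by
      rw [Complex.two_cos]
      refine (norm_add_le _ _).trans ?_
      rw [Complex.norm_exp, Complex.norm_exp]
      have h1 := neg_abs_le x.im
      have h2 := le_abs_self x.im
      have hj : (0 : ℝ) ≤ j := j.cast_nonneg
      refine (add_le_add (Real.exp_le_exp.2 ?_) (Real.exp_le_exp.2 ?_)).trans (two_mul _).symm.le <;>
        simp <;> nlinarith
    rw [e]
    refine (norm_add_le _ _).trans ?_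
    rw [norm_mul]
    have m : Real.exp (2 * j * |x.im|) ≤ Real.exp (2 * (j + 1) * |x.im|) := by
      gcongr; linarith
    have := norm_nonneg (Complex.sin x)
    calc _ ≤ (2 * j + 1) * Real.exp (2 * (j + 1) * |x.im|) * ‖Complex.sin x‖ +
          2 * Real.exp (2 * (j + 1) * |x.im|) * ‖Complex.sin x‖ := by
            refine add_le_add (ih.trans ?_) ?_ <;> gcongr
      _ = _ := by push_cast; ring

/-! ### Zeros -/

lemma th1_add_int (t : ℝ) (v : ℂ) (m : ℤ) : ‖th1 t (v + m)‖ = ‖th1 t v‖ := by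
  induction m using Int.induction_on with
  | zero => simp
  | succ i ih =>
    rw [show v + ((i + 1 : ℤ) : ℂ) = v + (i : ℤ) + 1 by push_cast; ring, th1_add_one, norm_neg, ih]
  | pred i ih =>
    rw [← ih, show v + ((-i : ℤ) : ℂ) = v + ((-i - 1 : ℤ) : ℂ) + 1 by push_cast; ring, th1_add_one,
      norm_neg]

lemma th1_add_int_mul_period (t : ℝ) (v : ℂ) (n : ℤ) :
    th1 t (v + n * (t * I)) = 0 ↔ th1 t v = 0 := by
  have step : ∀ w, th1 t (w + t * I) = 0 ↔ th1 t w = 0 := fun w => by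
    rw [th1_add_period]; simp
  induction n using Int.induction_on with
  | zero => simp
  | succ i ih =>
    rw [show v + ((i + 1 : ℤ) : ℂ) * (t * I) = v + (i : ℤ) * (t * I) + t * I by push_cast; ring,
      step]
    exact ih
  | pred i ih =>
    refine Iff.trans ?_ ih
    rw [show v + ((-i : ℤ) : ℂ) * (t * I) = v + ((-i - 1 : ℤ) : ℂ) * (t * I) + t * I by
      push_cast; ring, step]

lemma th1_add_lattice (t : ℝ) (v : ℂ) (m n : ℤ) :
    th1 t (v + m + n * (t * I)) = 0 ↔ th1 t v = 0 := by
  rw [th1_add_int_mul_period, ← norm_eq_zero, th1_add_int, norm_eq_zero]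

lemma th1_lattice (t : ℝ) (m n : ℤ) : th1 t (m + n * (t * I)) = 0 := by
  have := (th1_add_lattice t 0 m n).2 (th1_zero t)
  rwa [zero_add] at this

/-- For t ≥ 1 and |Im v| ≤ t/2 the first term of the sine series dominates: the tail is at most half
of it in modulus. So the sum can only vanish if the first term does. -/
lemma sin_eq_zero_of_th1_eq_zero {t : ℝ} (ht : 1 ≤ t) {v : ℂ} (hv : |v.im| ≤ t / 2)
    (h : th1 t v = 0) : Complex.sin (Real.pi * v) = 0 := by
  have h0 := hasSum_th1 (by linarith : 0 < t) v
  rw [h] at h0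
  set s := Complex.sin (Real.pi * v)
  set E := Real.exp (-Real.pi * t / 4) with hE
  have hEpos : 0 < E := Real.exp_pos _
  have h1 := (hasSum_nat_add_iff' 1).2 h0
  have e0 : Real.exp (-Real.pi * t * (((0 : ℕ) : ℝ) + 1 / 2) ^ 2) = E := by
    rw [hE]; congr 1; push_cast; ring
  rw [Finset.sum_range_one, e0] at h1
  simp only [pow_zero, one_mul, Nat.cast_zero, mul_zero, zero_add, zero_sub] at h1
  have hr : Real.exp (-Real.pi) ≤ 1 / 9 := by
    rw [Real.exp_neg, one_div]
    refine inv_anti₀ (by norm_num) ?_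
    have h3 : Real.exp 3 ≤ Real.exp Real.pi := Real.exp_le_exp.2 Real.pi_gt_three.le
    have h4 : Real.exp 3 = Real.exp 1 ^ 3 := by rw [← Real.exp_nat_mul]; norm_num
    have h5 := Real.exp_one_gt_d9
    have h6 : (2.7 : ℝ) ^ 3 ≤ Real.exp 1 ^ 3 := by gcongr; linarith
    norm_num at h6
    linarith
  -- The majorant of the tail: the ratio 1/3 is 3 · (1/9), from 2i + 1 ≤ 3^i and exp(-π) ≤ 1/9. Its
  -- sum is half of the first term 2E‖s‖.
  have hg : HasSum (fun j : ℕ => 2 * E * ‖s‖ * (1 / 3 : ℝ) ^ (j + 1)) (E * ‖s‖) := by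
    have := ((hasSum_geometric_of_lt_one (r := (1 / 3 : ℝ)) (by norm_num) (by norm_num)).mul_left
      (2 * E * ‖s‖ * (1 / 3)))
    have e2 : 2 * E * ‖s‖ * (1 / 3) * (1 - 1 / 3)⁻¹ = E * ‖s‖ := by norm_num; ring
    rw [e2] at this
    exact this.congr_fun fun j => by rw [pow_succ]; ring
  have hb := tsum_of_norm_bounded hg (f := fun j : ℕ => 2 * ((-1 : ℂ) ^ (j + 1) *
    (Real.exp (-Real.pi * t * (((j + 1 : ℕ) : ℝ) + 1 / 2) ^ 2) : ℝ) *
      Complex.sin ((2 * ((j + 1 : ℕ) : ℂ) + 1) * (Real.pi * v)))) fun j => by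
    have hs := norm_sin_le (j + 1) (Real.pi * v)
    have him : |((Real.pi : ℂ) * v).im| ≤ Real.pi * (t / 2) := by
      rw [im_ofReal_mul, abs_mul, abs_of_pos Real.pi_pos]
      gcongr
    rw [norm_mul, norm_mul, norm_mul, norm_pow, norm_neg, norm_one, one_pow, one_mul,
      Complex.norm_real, Real.norm_of_nonneg (Real.exp_pos _).le, Complex.norm_ofNat]
    set i : ℕ := j + 1 with hi
    have hi1 : (1 : ℝ) ≤ i := by rw [hi]; push_cast; linarith [j.cast_nonneg (α := ℝ)]
    -- The exponent is at most -πt(i + 1/2)² + πti = -πti² - πt/4, and ti² ≥ i since t, i ≥ 1.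
    have b1 : Real.exp (-Real.pi * t * ((i : ℝ) + 1 / 2) ^ 2) *
        Real.exp (2 * i * |((Real.pi : ℂ) * v).im|) ≤ E * (1 / 9) ^ i := by
      calc _ ≤ E * Real.exp (-Real.pi) ^ i := by
            rw [← Real.exp_nat_mul, hE, ← Real.exp_add, ← Real.exp_add]
            apply Real.exp_le_exp.2
            have : 2 * (i : ℝ) * |((Real.pi : ℂ) * v).im| ≤ 2 * i * (Real.pi * (t / 2)) := by gcongr
            have hp := Real.pi_pos
            have : Real.pi * i * 1 ≤ Real.pi * i * (t * i) := by
              gcongr; nlinarith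
            nlinarith
        _ ≤ _ := by gcongr
    have b2 : (2 * (i : ℝ) + 1) ≤ 3 ^ i := by
      have := one_add_mul_le_pow (a := (2 : ℝ)) (by norm_num) i
      norm_num at this; linarith
    calc _ ≤ 2 * (Real.exp (-Real.pi * t * ((i : ℝ) + 1 / 2) ^ 2) * ((2 * i + 1) *
          Real.exp (2 * i * |((Real.pi : ℂ) * v).im|) * ‖s‖)) := by gcongr
      _ = 2 * ((2 * i + 1) * ‖s‖ * (Real.exp (-Real.pi * t * ((i : ℝ) + 1 / 2) ^ 2) *
          Real.exp (2 * i * |((Real.pi : ℂ) * v).im|))) := by ring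
      _ ≤ 2 * (3 ^ i * ‖s‖ * (E * (1 / 9) ^ i)) := by gcongr
      _ = _ := by
        rw [show (1 / 9 : ℝ) = 1 / 3 * (1 / 3) by norm_num, mul_pow]
        have : (3 : ℝ) ^ i * (1 / 3) ^ i = 1 := by rw [← mul_pow]; norm_num
        linear_combination 2 * ‖s‖ * E * (1 / 3) ^ i * this
  rw [h1.tsum_eq, norm_neg, norm_mul, norm_mul, Complex.norm_real, Real.norm_of_nonneg hEpos.le,
    Complex.norm_ofNat] at hb
  have : E * ‖s‖ ≤ 0 := by linarith
  have hs0 : ‖s‖ ≤ 0 := by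
    by_contra hc
    push Not at hc
    nlinarith [mul_pos hEpos hc]
  exact norm_le_zero_iff.1 hs0

lemma exists_lattice_of_th1_eq_zero_of_one_le {t : ℝ} (ht : 1 ≤ t) {v : ℂ} (h : th1 t v = 0) :
    ∃ m n : ℤ, v = m + n * (t * I) := by
  have ht0 : 0 < t := by linarith
  set n := round (v.im / t)
  have h1 : th1 t (v + (-n : ℤ) * (t * I)) = 0 := (th1_add_int_mul_period t v (-n)).2 h
  have h2 : |(v + (-n : ℤ) * (t * I)).im| ≤ t / 2 := by
    have := abs_sub_round (v.im / t)
    have e : (v + (-n : ℤ) * (t * I)).im = (v.im / t - n) * t := by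
      simp; field_simp; ring
    rw [e, abs_mul, abs_of_pos ht0]
    nlinarith
  obtain ⟨m, hm⟩ := Complex.sin_eq_zero_iff.1 (sin_eq_zero_of_th1_eq_zero ht h2 h1)
  refine ⟨m, n, ?_⟩
  have hp : (Real.pi : ℂ) ≠ 0 := by exact_mod_cast Real.pi_ne_zero
  have : v + (-n : ℤ) * (t * I) = m := by
    apply mul_left_cancel₀ hp; rw [hm]; ring
  rw [← this]; push_cast; ring

/-- `th1_mul` at v - 1/4 and 1/4 is the duplication formula that expresses `th1`(v)`th1`(v - 1/2) as
-`th1`(2v)`th4`(0), the right side with period 2t. Knowledge of the zeros for the period 2t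
therefore descends to t. -/
lemma exists_lattice_of_th1_eq_zero_of_double {t : ℝ} (ht : 0 < t)
    (H : ∀ v, th1 (2 * t) v = 0 → ∃ m n : ℤ, v = m + n * ((2 * t : ℝ) * I))
    {v : ℂ} (h : th1 t v = 0) : ∃ m n : ℤ, v = m + n * (t * I) := by
  have h2 := th1_mul t ht (v - 1 / 4) (1 / 4)
  have z0 : th2 (2 * t) (2 * (1 / 4)) = 0 := by
    rw [show (2 * (1 / 4) : ℂ) = 0 + 1 / 2 by norm_num, th2_add_half, th1_zero, neg_zero]
  have e1 : th2 (2 * t) (2 * (v - 1 / 4)) = th1 (2 * t) (2 * v) := by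
    rw [← th1_add_half]; congr 1; ring
  rw [show v - 1 / 4 + 1 / 4 = v by ring, h, zero_mul, z0, mul_zero, zero_sub, e1,
    show (2 * (1 / 4) : ℂ) = 0 + 1 / 2 by norm_num, th3_add_half] at h2
  -- A zero of `th4` at 0 would, by the half-period shift, be a zero of `th1` at height t, which is
  -- not a multiple of 2t.
  have h4 : th4 (2 * t) 0 ≠ 0 := by
    intro h4
    have := th1_add_half_period (2 * t) 0
    rw [h4, mul_zero] at this
    obtain ⟨m, n, hmn⟩ := H _ this
    have := congrArg Complex.im hmn
    simp at this
    have h5 : t * (2 * n - 1) = 0 := by linarith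
    have h6 : (2 * n - 1 : ℝ) = 0 := by
      rcases mul_eq_zero.1 h5 with h | h
      · exact absurd h ht.ne'
      · exact h
    have h7 : (2 * n - 1 : ℤ) = 0 := by exact_mod_cast h6
    omega
  have h1 : th1 (2 * t) (2 * v) = 0 := by
    rcases mul_eq_zero.1 (neg_eq_zero.1 h2.symm) with h | h
    · exact h
    · exact absurd h h4
  obtain ⟨m, n, hmn⟩ := H _ h1
  have hv : v = m / 2 + n * (t * I) := by
    push_cast at hmn
    linear_combination hmn / 2
  rcases Int.even_or_odd' m with ⟨a, rfl | rfl⟩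
  · exact ⟨a, n, by rw [hv]; push_cast; ring⟩
  -- An odd m would put v at 1/2 modulo the lattice, where `th1` reduces to `th2`(0) > 0.
  · exfalso
    have e : v = (1 / 2 : ℂ) + a + n * (t * I) := by rw [hv]; push_cast; ring
    rw [e, th1_add_lattice, show (1 / 2 : ℂ) = 0 + 1 / 2 by ring, th1_add_half] at h
    exact th2_zero_ne ht h

/-- The zeros of the first theta function are the points of the period lattice. -/
lemma th1_eq_zero_iff {t : ℝ} (ht : 0 < t) {v : ℂ} :
    th1 t v = 0 ↔ ∃ m n : ℤ, v = m + n * (t * I) := by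
  refine ⟨fun h => ?_, fun ⟨m, n, h⟩ => h ▸ th1_lattice t m n⟩
  -- Doubling the period N times reaches the range t ≥ 1, where the dominance argument applies.
  have key : ∀ N : ℕ, ∀ t : ℝ, 0 < t → 1 ≤ 2 ^ N * t → ∀ v, th1 t v = 0 →
      ∃ m n : ℤ, v = m + n * (t * I) := by
    intro N
    induction N with
    | zero => exact fun t _ h1 v hv => exists_lattice_of_th1_eq_zero_of_one_le (by simpa using h1) hv
    | succ N ih =>
      intro t ht h1 v hv
      refine exists_lattice_of_th1_eq_zero_of_double ht (ih (2 * t) (by linarith) ?_) hv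
      rw [pow_succ] at h1; linarith
  obtain ⟨N, hN⟩ := pow_unbounded_of_one_lt (1 / t) (one_lt_two : (1 : ℝ) < 2)
  exact key N t ht (by rw [div_lt_iff₀ ht] at hN; exact hN.le) v h

lemma th4_eq_zero_iff {t : ℝ} (v : ℂ) : th4 t v = 0 ↔ th1 t (v + t * I / 2) = 0 := by
  rw [th1_add_half_period]; simp

lemma exists_int_re_of_th1_eq_zero {t : ℝ} (ht : 0 < t) {v : ℂ} (h : th1 t v = 0) :
    ∃ m : ℤ, v.re = m := by
  obtain ⟨m, n, rfl⟩ := (th1_eq_zero_iff ht).1 h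
  exact ⟨m, by simp⟩

lemma exists_int_im_of_th1_eq_zero {t : ℝ} (ht : 0 < t) {v : ℂ} (h : th1 t v = 0) :
    ∃ n : ℤ, v.im = n * t := by
  obtain ⟨m, n, rfl⟩ := (th1_eq_zero_iff ht).1 h
  exact ⟨n, by simp⟩

lemma th4_ne_zero_of_re {t : ℝ} (ht : 0 < t) {v : ℂ} (h1 : -1 < v.re) (h2 : v.re < 0) :
    th4 t v ≠ 0 := fun h => by
  obtain ⟨m, hm⟩ := exists_int_re_of_th1_eq_zero ht ((th4_eq_zero_iff v).1 h)
  have e : (v + t * I / 2).re = v.re := by simp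
  rw [e] at hm
  rw [hm] at h1 h2
  have h1' : (-1 : ℤ) < m := by exact_mod_cast h1
  have h2' : m < (0 : ℤ) := by exact_mod_cast h2
  omega

lemma th4_ne_zero_of_im {t : ℝ} (ht : 0 < t) {v : ℂ} (h : |v.im| < t / 2) : th4 t v ≠ 0 := fun h0 => by
  obtain ⟨n, hn⟩ := exists_int_im_of_th1_eq_zero ht ((th4_eq_zero_iff v).1 h0)
  have e : (v + t * I / 2).im = v.im + t / 2 := by simp
  rw [e] at hn
  rw [abs_lt] at h
  have h1 : (0 : ℝ) < n := by
    by_contra hc; push Not at hc; nlinarith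
  have h2 : (n : ℝ) < 1 := by
    by_contra hc; push Not at hc; nlinarith
  have h1' : (0 : ℤ) < n := by exact_mod_cast h1
  have h2' : n < (1 : ℤ) := by exact_mod_cast h2
  omega

lemma th4_ofReal_ne {t : ℝ} (ht : 0 < t) (x : ℝ) : th4 t x ≠ 0 :=
  th4_ne_zero_of_im ht (by simpa using half_pos ht)

lemma th4_zero_ne {t : ℝ} (ht : 0 < t) : th4 t 0 ≠ 0 := by simpa using th4_ofReal_ne ht 0

lemma int_eq_zero_of_abs_lt {m : ℤ} (h : |(m : ℝ)| < 1) : m = 0 := by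
  have : |m| < 1 := by exact_mod_cast h
  exact Int.abs_lt_one_iff.1 this

/-! ### Wronskians of theta functions -/

/-- An auxiliary theta function for the doubled period. -/
def thAux (t : ℝ) (x : ℂ) : ℂ :=
  cexp (-(Real.pi * t / 8) + Real.pi * I * x) * th3 (2 * t) (2 * x + t * I / 2)

/-- `th3_mul` with both arguments shifted by it/4: the sum moves by it/2, which produces `th2`, and
the difference does not move. The right side is bilinear in x and y, so differentiation in y at 0
gives the Wronskian. -/
lemma th2_mul_th3 {t : ℝ} (ht : 0 < t) (x y : ℂ) :
    th2 t (x + y) * th3 t (x - y) = thAux t x * thAux t y + thAux t (-x) * thAux t (-y) := by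
  have h := th3_mul t ht (x + t * I / 4) (y + t * I / 4)
  have key : ∀ z : ℂ, th2 (2 * t) (2 * (z + t * I / 4)) =
      cexp (-2 * Real.pi * I * z) * th3 (2 * t) (2 * -z + t * I / 2) := fun z => by
    have := th2_add_half_period (2 * t) (2 * z - t * I / 2)
    rw [← th3_neg, show 2 * z - t * I / 2 + (2 * t : ℝ) * I / 2 = 2 * (z + t * I / 4) by
      push_cast; ring, show -(2 * z - t * I / 2) = 2 * -z + t * I / 2 by ring] at this
    rw [this]
    congr 2; push_cast; ring_nf; simp only [I_sq]; ring
  rw [key, key, show x + t * I / 4 + (y + t * I / 4) = x + y + t * I / 2 by ring,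
    show x + t * I / 4 - (y + t * I / 4) = x - y by ring,
    show 2 * (x + t * I / 4) = 2 * x + t * I / 2 by ring,
    show 2 * (y + t * I / 4) = 2 * y + t * I / 2 by ring] at h
  have e1 : cexp (-(Real.pi * t / 4) + Real.pi * I * (x + y)) =
      cexp (-(Real.pi * t / 8) + Real.pi * I * x) * cexp (-(Real.pi * t / 8) + Real.pi * I * y) := by
    rw [← Complex.exp_add]; congr 1; ring
  have e2 : ∀ z : ℂ, cexp (-(Real.pi * t / 8) + Real.pi * I * -z) =
      cexp (-(Real.pi * t / 8) + Real.pi * I * z) * cexp (-2 * Real.pi * I * z) := fun z => by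
    rw [← Complex.exp_add]; congr 1; ring
  rw [th2, mul_assoc, h, e1, thAux, thAux, thAux, thAux, e2, e2]
  ring

lemma thAux_add_half (t : ℝ) (x : ℂ) : thAux t (x + 1 / 2) = I * thAux t x := by
  rw [thAux, thAux, show 2 * (x + 1 / 2) + t * I / 2 = 2 * x + t * I / 2 + 1 by ring, th3_add_one,
    show -(Real.pi * t / 8) + Real.pi * I * (x + 1 / 2) =
      (-(Real.pi * t / 8) + Real.pi * I * x) + Real.pi / 2 * I by ring, Complex.exp_add,
    Complex.exp_pi_div_two_mul_I]
  ring

lemma th1_mul_th4 {t : ℝ} (ht : 0 < t) (x y : ℂ) :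
    th1 t (x + y) * th4 t (x - y) =
      -I * (thAux t x * thAux t y - thAux t (-x) * thAux t (-y)) := by
  have h := th2_mul_th3 ht (x + 1 / 2) y
  have e : thAux t (-(x + 1 / 2)) = -I * thAux t (-x) := by
    have := thAux_add_half t (-(x + 1 / 2))
    rw [show -(x + 1 / 2) + 1 / 2 = -x by ring] at this
    rw [this, ← mul_assoc, neg_mul, I_mul_I, neg_neg, one_mul]
  rw [thAux_add_half, e] at h
  rw [th1, th4, show x + y + 1 / 2 = x + 1 / 2 + y by ring,
    show x - y + 1 / 2 = x + 1 / 2 - y by ring, neg_mul, h]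
  ring

lemma differentiable_thAux {t : ℝ} (ht : 0 < t) : Differentiable ℂ (thAux t) := by
  have h : Differentiable ℂ fun x : ℂ => th3 (2 * t) (2 * x + t * I / 2) :=
    (differentiable_th3 (by linarith)).comp (by fun_prop)
  have h' : Differentiable ℂ fun x : ℂ => cexp (-(Real.pi * t / 8) + Real.pi * I * x) := by fun_prop
  exact h'.mul h

lemma hasDerivAt_mul_comp_add_sub {f g : ℂ → ℂ} (hf : Differentiable ℂ f) (hg : Differentiable ℂ g)
    (x : ℂ) : HasDerivAt (fun y => f (x + y) * g (x - y)) (deriv f x * g x - f x * deriv g x) 0 := by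
  have h1 : HasDerivAt (fun y => f (x + y)) (deriv f x) 0 := by
    refine HasDerivAt.comp_const_add x 0 ?_
    simpa using (hf x).hasDerivAt
  have h2 : HasDerivAt (fun y => g (x - y)) (-deriv g x) 0 := by
    refine HasDerivAt.comp_const_sub x 0 ?_
    simpa using (hg x).hasDerivAt
  have h3 := h1.mul h2
  simp only [add_zero, sub_zero] at h3
  rw [show deriv f x * g x - f x * deriv g x = deriv f x * g x + f x * -deriv g x by ring]
  exact h3

lemma hasDerivAt_comp_neg_zero {f : ℂ → ℂ} (hf : Differentiable ℂ f) :
    HasDerivAt (fun y => f (-y)) (-deriv f 0) 0 := by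
  have : HasDerivAt f (deriv f 0) (-0) := by simpa using (hf 0).hasDerivAt
  have h := this.comp 0 (hasDerivAt_neg 0)
  rw [mul_neg_one] at h
  exact h

/-- f'g - fg' at x is the y-derivative at 0 of f(x+y)g(x-y). By `th1_mul_th4` this derivative is a
multiple of `thAux` x + `thAux` (-x), and by `th2_mul_th3` at y = 0 so is `th2`·`th3`. -/
lemma exists_wronskian_th1_th4 {t : ℝ} (ht : 0 < t) : ∃ C : ℂ, ∀ x,
    deriv (th1 t) x * th4 t x - th1 t x * deriv (th4 t) x = C * (th2 t x * th3 t x) := by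
  refine ⟨-I * deriv (thAux t) 0 / thAux t 0, fun x => ?_⟩
  have h0 : thAux t 0 ≠ 0 := fun h => by
    have := th2_mul_th3 ht 0 0
    simp [h, th2_zero_ne ht, th3_zero_ne ht] at this
  have h1 := hasDerivAt_mul_comp_add_sub (differentiable_th1 ht) (differentiable_th4 ht) x
  have hA := (differentiable_thAux ht 0).hasDerivAt
  have hA' := hasDerivAt_comp_neg_zero (differentiable_thAux ht)
  have h2 := ((hA.const_mul (thAux t x)).sub (hA'.const_mul (thAux t (-x)))).const_mul (-I)
  have h3 := h1.unique (h2.congr_of_eventuallyEq (Eventually.of_forall fun y => th1_mul_th4 ht x y))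
  have h4 := th2_mul_th3 ht x 0
  rw [add_zero, sub_zero, neg_zero] at h4
  rw [h3, h4]
  field_simp
  ring

/-- `th2_mul` with both arguments shifted by 1/4: the sum moves by 1/2 and the difference stays. -/
lemma th1_mul_th2 {t : ℝ} (ht : 0 < t) (x y : ℂ) : th1 t (x + y) * th2 t (x - y) =
    th1 (2 * t) (2 * x) * th4 (2 * t) (2 * y) + th4 (2 * t) (2 * x) * th1 (2 * t) (2 * y) := by
  have h := th2_mul t ht (x + 1 / 4) (y + 1 / 4)
  rw [show 2 * (x + 1 / 4) = 2 * x + 1 / 2 by ring, show 2 * (y + 1 / 4) = 2 * y + 1 / 2 by ring,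
    th2_add_half, th2_add_half, th3_add_half, th3_add_half,
    show x + 1 / 4 + (y + 1 / 4) = x + y + 1 / 2 by ring,
    show x + 1 / 4 - (y + 1 / 4) = x - y by ring, th2_add_half] at h
  linear_combination -h

lemma th3_mul_th4 {t : ℝ} (ht : 0 < t) (x : ℂ) : th3 t x * th4 t x =
    th4 (2 * t) (2 * x) * th4 (2 * t) 0 := by
  have h := th3_mul t ht (x + 1 / 4) (1 / 4)
  rw [show 2 * (x + 1 / 4) = 2 * x + 1 / 2 by ring, show (2 * (1 / 4) : ℂ) = 0 + 1 / 2 by ring,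
    th2_add_half, th2_add_half, th3_add_half, th3_add_half,
    show x + 1 / 4 + 1 / 4 = x + 1 / 2 by ring,
    show x + 1 / 4 - 1 / 4 = x by ring, th3_add_half, th1_zero] at h
  linear_combination h

lemma exists_wronskian_th1_th2 {t : ℝ} (ht : 0 < t) : ∃ C : ℂ, ∀ x,
    deriv (th1 t) x * th2 t x - th1 t x * deriv (th2 t) x = C * (th3 t x * th4 t x) := by
  have ht2 : 0 < 2 * t := by linarith
  refine ⟨2 * deriv (th1 (2 * t)) 0 / th4 (2 * t) 0, fun x => ?_⟩
  have h0 := th4_zero_ne ht2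
  have h1 := hasDerivAt_mul_comp_add_sub (differentiable_th1 ht) (differentiable_th2 ht) x
  have hlin : HasDerivAt (fun y : ℂ => 2 * y) 2 0 := by simpa using (hasDerivAt_id (0 : ℂ)).const_mul 2
  have hd : ∀ f : ℂ → ℂ, Differentiable ℂ f →
      HasDerivAt (fun y : ℂ => f (2 * y)) (deriv f 0 * 2) 0 := fun f hf => by
    have : HasDerivAt f (deriv f 0) (2 * 0) := by simpa using (hf 0).hasDerivAt
    exact this.comp 0 hlin
  -- `th4` is even, so only the term with the derivative of `th1` survives, and its coefficient
  -- `th4`(2x) of period 2t is `th3`·`th4` up to a constant.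
  have h4 : deriv (th4 (2 * t)) 0 = 0 := by
    have hA := (differentiable_th4 ht2 0).hasDerivAt
    have hA' := hasDerivAt_comp_neg_zero (differentiable_th4 ht2)
    simp only [th4_neg] at hA'
    exact self_eq_neg.1 (hA.unique hA')
  have h2 := ((hd _ (differentiable_th4 ht2)).const_mul (th1 (2 * t) (2 * x))).add
    ((hd _ (differentiable_th1 ht2)).const_mul (th4 (2 * t) (2 * x)))
  have h3 := h1.unique (h2.congr_of_eventuallyEq (Eventually.of_forall fun y => th1_mul_th2 ht x y))
  rw [h3, th3_mul_th4 ht, h4]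
  field_simp
  ring

lemma wronskian_th1_th4 {t : ℝ} (ht : 0 < t) (x : ℂ) :
    deriv (th1 t) x * th4 t x - th1 t x * deriv (th4 t) x =
      deriv (th1 t) 0 * th4 t 0 / (th2 t 0 * th3 t 0) * (th2 t x * th3 t x) := by
  obtain ⟨C, hC⟩ := exists_wronskian_th1_th4 ht
  have h0 := hC 0
  rw [th1_zero, zero_mul, sub_zero] at h0
  have := th2_zero_ne ht
  have := th3_zero_ne ht
  rw [hC, h0]
  field_simp

lemma wronskian_th1_th2 {t : ℝ} (ht : 0 < t) (x : ℂ) :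
    deriv (th1 t) x * th2 t x - th1 t x * deriv (th2 t) x =
      deriv (th1 t) 0 * th2 t 0 / (th3 t 0 * th4 t 0) * (th3 t x * th4 t x) := by
  obtain ⟨C, hC⟩ := exists_wronskian_th1_th2 ht
  have h0 := hC 0
  rw [th1_zero, zero_mul, sub_zero] at h0
  have := th4_zero_ne ht
  have := th3_zero_ne ht
  rw [hC, h0]
  field_simp

/-! ### Complete elliptic integrals -/

/-- The substitution x = R(y): by the differential equation the integrand times |R'| is the constant
|c|. Injectivity and the end values force R to increase, so the sign of R' is not needed. -/
lemma ellipticK_eq_of_deriv {R R' : ℝ → ℝ} {l c m : ℝ} (hl : 0 < l) (hm0 : 0 ≤ m) (hm1 : m < 1)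
    (hR : ContinuousOn R (Icc 0 l)) (hinj : InjOn R (Icc 0 l)) (h0 : R 0 = 0) (h1 : R l = 1)
    (hd : ∀ x ∈ Ioo 0 l, HasDerivAt R (R' x) x)
    (hode : ∀ x ∈ Ioo 0 l, R' x ^ 2 = c ^ 2 * ((1 - R x ^ 2) * (1 - m ^ 2 * R x ^ 2))) :
    ellipticK m = |c| * l := by
  have hmono : StrictMonoOn R (Icc 0 l) :=
    hR.strictMonoOn_of_injOn_Icc hl.le (by rw [h0, h1]; exact zero_le_one) hinj
  have himg : R '' Ioo 0 l = Ioo 0 1 := by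
    apply Subset.antisymm
    · rintro _ ⟨x, hx, rfl⟩
      refine ⟨?_, ?_⟩
      · rw [← h0]; exact hmono (left_mem_Icc.2 hl.le) (Ioo_subset_Icc_self hx) hx.1
      · rw [← h1]; exact hmono (Ioo_subset_Icc_self hx) (right_mem_Icc.2 hl.le) hx.2
    · have := intermediate_value_Ioo hl.le hR
      rwa [h0, h1] at this
  have hcv := MeasureTheory.integral_image_eq_integral_abs_deriv_smul (s := Ioo 0 l) (f := R)
    (f' := R') measurableSet_Ioo (fun x hx => (hd x hx).hasDerivWithinAt)
    (hinj.mono Ioo_subset_Icc_self)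
    (fun x => 1 / Real.sqrt ((1 - x ^ 2) * (1 - m ^ 2 * x ^ 2)))
  rw [ellipticK, intervalIntegral.integral_of_le zero_le_one,
    MeasureTheory.integral_Ioc_eq_integral_Ioo, ← himg, hcv]
  have hc : ∀ x ∈ Ioo 0 l, |R' x| • (1 / Real.sqrt ((1 - R x ^ 2) * (1 - m ^ 2 * R x ^ 2))) = |c| := by
    intro x hx
    have hx' : R x ∈ Ioo (0 : ℝ) 1 := himg ▸ mem_image_of_mem R hx
    have p1 : 0 < 1 - R x ^ 2 := by nlinarith [hx'.1, hx'.2]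
    have p2 : 0 < 1 - m ^ 2 * R x ^ 2 := by nlinarith [hx'.1, hx'.2]
    have p := mul_pos p1 p2
    have : |R' x| = |c| * Real.sqrt ((1 - R x ^ 2) * (1 - m ^ 2 * R x ^ 2)) := by
      rw [← Real.sqrt_sq_eq_abs, hode x hx, Real.sqrt_mul (sq_nonneg c), Real.sqrt_sq_eq_abs]
    rw [this, smul_eq_mul]
    rw [mul_assoc, mul_one_div_cancel (Real.sqrt_pos.2 p).ne', mul_one]
  rw [MeasureTheory.setIntegral_congr_fun measurableSet_Ioo hc]
  simp [hl.le, mul_comm]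

/-- The integrand is dominated by a multiple of (1 - x)^(-1/2), because 1 - x² ≥ 1 - x and 1 - m²x²
≥ 1 - m². -/
lemma intervalIntegrable_ellipticK {m : ℝ} (hm0 : 0 ≤ m) (hm1 : m < 1) :
    IntervalIntegrable (fun x : ℝ => 1 / Real.sqrt ((1 - x ^ 2) * (1 - m ^ 2 * x ^ 2)))
      MeasureTheory.volume 0 1 := by
  have hpos : 0 < 1 - m ^ 2 := by nlinarith
  have h1 : IntervalIntegrable (fun x : ℝ => (Real.sqrt (1 - m ^ 2))⁻¹ * (1 - x) ^ (-(1 / 2) : ℝ))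
      MeasureTheory.volume 0 1 := by
    refine IntervalIntegrable.const_mul ?_ _
    have := (intervalIntegral.intervalIntegrable_rpow' (a := 0) (b := 1) (r := -(1 / 2))
      (by norm_num)).comp_sub_left 1
    simpa using this.symm
  refine h1.mono_fun ?_ ?_
  · refine Measurable.aestronglyMeasurable ?_
    fun_prop
  · refine (MeasureTheory.ae_restrict_iff' measurableSet_uIoc).2 ?_
    have hne : ∀ᵐ x : ℝ, x ≠ 1 := by simp [MeasureTheory.ae_iff]
    filter_upwards [hne] with x hx1 hx
    rw [uIoc_of_le zero_le_one] at hx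
    have hx2 : x < 1 := lt_of_le_of_ne hx.2 hx1
    have hx3 : 0 < 1 - x := by linarith
    rw [Real.rpow_neg hx3.le, ← Real.sqrt_eq_rpow, ← mul_inv, ← Real.sqrt_mul hpos.le,
      Real.norm_of_nonneg (by positivity), Real.norm_of_nonneg (by positivity), one_div]
    refine inv_anti₀ (Real.sqrt_pos.2 (by positivity)) (Real.sqrt_le_sqrt ?_)
    have a1 : 1 - m ^ 2 ≤ 1 - m ^ 2 * x ^ 2 := by nlinarith [hx.1, sq_nonneg m, mul_nonneg (sq_nonneg m) (by nlinarith [hx.1] : (0:ℝ) ≤ 1 - x ^ 2)]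
    have a2 : 1 - x ≤ 1 - x ^ 2 := by nlinarith [hx.1]
    rw [mul_comm]
    exact mul_le_mul a2 a1 hpos.le (by nlinarith [hx.1])

lemma ellipticK_pos {m : ℝ} (hm0 : 0 ≤ m) (hm1 : m < 1) : 0 < ellipticK m := by
  refine intervalIntegral.intervalIntegral_pos_of_pos_on (intervalIntegrable_ellipticK hm0 hm1)
    (fun x hx => ?_) zero_lt_one
  have p1 : 0 < 1 - x ^ 2 := by nlinarith [hx.1, hx.2]
  have p2 : 0 < 1 - m ^ 2 * x ^ 2 := by nlinarith [hx.1, hx.2]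
  positivity

lemma ellipticK_strictMonoOn : StrictMonoOn ellipticK (Ico 0 1) := by
  intro m hm n hn hmn
  have hd : 0 < ∫ x in (0 : ℝ)..1, (1 / Real.sqrt ((1 - x ^ 2) * (1 - n ^ 2 * x ^ 2)) -
      1 / Real.sqrt ((1 - x ^ 2) * (1 - m ^ 2 * x ^ 2))) := by
    refine intervalIntegral.intervalIntegral_pos_of_pos_on
      ((intervalIntegrable_ellipticK hn.1 hn.2).sub (intervalIntegrable_ellipticK hm.1 hm.2))
      (fun x hx => ?_) zero_lt_one
    have p1 : 0 < 1 - x ^ 2 := by nlinarith [hx.1, hx.2]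
    have hx2 : 0 < x ^ 2 := by have := hx.1; positivity
    have hx21 : x ^ 2 < 1 := by linarith
    have hmn2 : m ^ 2 < n ^ 2 := by nlinarith [hm.1]
    have hn2 : n ^ 2 < 1 := by nlinarith [hn.1, hn.2]
    have p2 : 0 < 1 - n ^ 2 * x ^ 2 := by nlinarith [sq_nonneg n]
    rw [sub_pos]
    refine one_div_lt_one_div_of_lt (Real.sqrt_pos.2 (mul_pos p1 p2))
      (Real.sqrt_lt_sqrt (mul_pos p1 p2).le ?_)
    have : m ^ 2 * x ^ 2 < n ^ 2 * x ^ 2 := by nlinarith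
    nlinarith
  rw [intervalIntegral.integral_sub (intervalIntegrable_ellipticK hn.1 hn.2)
    (intervalIntegrable_ellipticK hm.1 hm.2)] at hd
  rw [ellipticK, ellipticK]
  linarith

/-- The modulus is determined by the quotient of the two complete elliptic integrals. -/
lemma modulus_eq_of_ratio_eq {m n : ℝ} (hm : m ∈ Ioo (0 : ℝ) 1) (hn : n ∈ Ioo (0 : ℝ) 1)
    (h : ellipticK' m / ellipticK m = ellipticK' n / ellipticK n) : m = n := by
  -- K increases with the modulus and K' decreases, so K'/K is strictly decreasing.
  have key : ∀ {m n : ℝ}, m ∈ Ioo (0 : ℝ) 1 → n ∈ Ioo (0 : ℝ) 1 → m < n →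
      ellipticK' n / ellipticK n < ellipticK' m / ellipticK m := by
    intro m n hm hn hmn
    have h1 := ellipticK_strictMonoOn ⟨hm.1.le, hm.2⟩ ⟨hn.1.le, hn.2⟩ hmn
    have hmn2 : m ^ 2 < n ^ 2 := by nlinarith [hm.1]
    have hn2 : n ^ 2 < 1 := by nlinarith [hn.1, hn.2]
    have hm2 : 0 < m ^ 2 := by have := hm.1; positivity
    have s1 : Real.sqrt (1 - n ^ 2) < Real.sqrt (1 - m ^ 2) :=
      Real.sqrt_lt_sqrt (by linarith) (by linarith)
    have s2 : Real.sqrt (1 - m ^ 2) < 1 := by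
      rw [Real.sqrt_lt' one_pos]; linarith
    have h2 := ellipticK_strictMonoOn ⟨Real.sqrt_nonneg _, s1.trans s2⟩ ⟨Real.sqrt_nonneg _, s2⟩ s1
    exact div_lt_div₀ h2 h1.le (ellipticK_pos (Real.sqrt_nonneg _) s2).le
      (ellipticK_pos hm.1.le hm.2)
  rcases lt_trichotomy m n with h' | h' | h'
  · exact absurd h (key hm hn h').ne'
  · exact h'
  · exact absurd h (key hn hm h').ne

/-! ### Moduli from theta constants and Jacobi inversion -/

/-- The elliptic modulus that belongs to the theta functions of period `i t`. -/
def thetaModulus (t : ℝ) : ℝ := ((th2 t 0).re / (th3 t 0).re) ^ 2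

/-- The modulus complementary to `thetaModulus`. -/
def thetaModulus' (t : ℝ) : ℝ := ((th4 t 0).re / (th3 t 0).re) ^ 2

lemma ofReal_re_eq {z : ℂ} (h : z.im = 0) : ((z.re : ℝ) : ℂ) = z :=
  Complex.ext (by simp) (by simp [h])

lemma th2_zero_re (t : ℝ) : (((th2 t 0).re : ℝ) : ℂ) = th2 t 0 :=
  ofReal_re_eq (by simpa using th2_real t 0)

lemma th3_zero_re (t : ℝ) : (((th3 t 0).re : ℝ) : ℂ) = th3 t 0 :=
  ofReal_re_eq (by simpa using th3_real t 0)

lemma th4_zero_re (t : ℝ) : (((th4 t 0).re : ℝ) : ℂ) = th4 t 0 :=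
  ofReal_re_eq (by simpa using th4_real t 0)

lemma ofReal_thetaModulus (t : ℝ) : (thetaModulus t : ℂ) = (th2 t 0 / th3 t 0) ^ 2 := by
  rw [thetaModulus]; push_cast; rw [th2_zero_re, th3_zero_re]

lemma ofReal_thetaModulus' (t : ℝ) : (thetaModulus' t : ℂ) = (th4 t 0 / th3 t 0) ^ 2 := by
  rw [thetaModulus']; push_cast; rw [th4_zero_re, th3_zero_re]

lemma th4_zero_re_ne {t : ℝ} (ht : 0 < t) : (th4 t 0).re ≠ 0 := fun h =>
  th4_zero_ne ht (by rw [← th4_zero_re, h, ofReal_zero])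

lemma thetaModulus_pos {t : ℝ} (ht : 0 < t) : 0 < thetaModulus t := by
  have := th2_zero_pos ht
  have := th3_zero_pos ht
  rw [thetaModulus]; positivity

lemma thetaModulus'_pos {t : ℝ} (ht : 0 < t) : 0 < thetaModulus' t := by
  have := th4_zero_re_ne ht
  have := th3_zero_pos ht
  rw [thetaModulus']; positivity

lemma thetaModulus_sq_add {t : ℝ} (ht : 0 < t) : thetaModulus t ^ 2 + thetaModulus' t ^ 2 = 1 := by
  have h3 := th3_zero_ne ht
  have h := th_quartic ht
  have : ((thetaModulus t ^ 2 + thetaModulus' t ^ 2 : ℝ) : ℂ) = 1 := by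
    push_cast
    rw [ofReal_thetaModulus, ofReal_thetaModulus']
    field_simp
    linear_combination h
  exact_mod_cast this

lemma thetaModulus_mem {t : ℝ} (ht : 0 < t) : thetaModulus t ∈ Ioo (0 : ℝ) 1 := by
  have h1 := thetaModulus_pos ht
  have h2 := thetaModulus'_pos ht
  have h3 := thetaModulus_sq_add ht
  exact ⟨h1, by nlinarith⟩

lemma thetaModulus'_mem {t : ℝ} (ht : 0 < t) : thetaModulus' t ∈ Ioo (0 : ℝ) 1 := by
  have h1 := thetaModulus_pos ht
  have h2 := thetaModulus'_pos ht
  have h3 := thetaModulus_sq_add ht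
  exact ⟨h2, by nlinarith⟩

lemma sqrt_one_sub_thetaModulus {t : ℝ} (ht : 0 < t) :
    Real.sqrt (1 - thetaModulus t ^ 2) = thetaModulus' t := by
  rw [← thetaModulus_sq_add ht, add_sub_cancel_left, Real.sqrt_sq (thetaModulus'_pos ht).le]

lemma deriv_th1_zero_im {t : ℝ} (ht : 0 < t) : (deriv (th1 t) 0).im = 0 := by
  have h : HasDerivAt (fun v => -I * th1 t v) (-I * deriv (th1 t) 0) ((0 : ℝ) : ℂ) := by
    simpa using ((differentiable_th1 ht 0).hasDerivAt).const_mul (-I)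
  have h2 := h.real_of_complex
  have h3 : (fun x : ℝ => (-I * th1 t x).re) = fun _ => 0 := by
    funext x; simp [th1_real]
  rw [h3] at h2
  have := h2.unique (hasDerivAt_const _ _)
  simpa using this

/-- The constant in the differential equation of the quotient of theta functions. -/
def thetaSpeed (t : ℝ) : ℝ := (deriv (th1 t) 0).re * (th3 t 0).re / ((th2 t 0).re * (th4 t 0).re)

lemma ofReal_thetaSpeed {t : ℝ} (ht : 0 < t) :
    (thetaSpeed t : ℂ) = deriv (th1 t) 0 * th3 t 0 / (th2 t 0 * th4 t 0) := by
  rw [thetaSpeed]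
  push_cast
  rw [th2_zero_re, th3_zero_re, th4_zero_re, ofReal_re_eq (deriv_th1_zero_im ht)]

/-- The real function R = (`th3`(0)/`th2`(0)) `th1`/`th4` goes from 0 to 1 on [0, 1/2]. Its
derivative is given by the Wronskian, and `th_sq_add₁`, `th_sq_add₂` turn 1 - R² and 1 - k²R² into
squares, so it solves the differential equation of sn with speed `thetaSpeed`. Injectivity follows
from `th1_mul_th1` and the zeros of `th1`. -/
lemma ellipticK_thetaModulus {t : ℝ} (ht : 0 < t) :
    ellipticK (thetaModulus t) = |thetaSpeed t| * (1 / 2) := by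
  have n2 := th2_zero_ne ht
  have n3 := th3_zero_ne ht
  have n4 := th4_zero_ne ht
  set f : ℂ → ℂ := fun v => th3 t 0 / th2 t 0 * (th1 t v / th4 t v) with hf
  set f' : ℂ → ℂ := fun v => th3 t 0 / th2 t 0 *
    ((deriv (th1 t) v * th4 t v - th1 t v * deriv (th4 t) v) / th4 t v ^ 2) with hf'
  have hfr : ∀ x : ℝ, (f x).im = 0 := fun x => by
    have h1 := ofReal_re_eq (th1_real t x)
    have h4 := ofReal_re_eq (th4_real t x)
    have : f x = (((th3 t 0).re / (th2 t 0).re * ((th1 t x).re / (th4 t x).re) : ℝ) : ℂ) := by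
      push_cast; rw [th3_zero_re, th2_zero_re, h1, h4]
    rw [this, ofReal_im]
  have hd : ∀ x : ℝ, HasDerivAt f (f' x) x := fun x =>
    (((differentiable_th1 ht x).hasDerivAt).div ((differentiable_th4 ht x).hasDerivAt)
      (th4_ofReal_ne ht x)).const_mul _
  have hdr : ∀ x : ℝ, HasDerivAt (fun x : ℝ => (f x).re) (f' x).re x := fun x =>
    (hd x).real_of_complex
  have hf'r : ∀ x : ℝ, (f' x).im = 0 := fun x => by
    have h := ((hd x).const_mul (-I)).real_of_complex
    have h3 : (fun x : ℝ => (-I * f x).re) = fun _ => 0 := by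
      funext x; simp [hfr]
    rw [h3] at h
    have := h.unique (hasDerivAt_const _ _)
    simpa using this
  refine ellipticK_eq_of_deriv (R := fun x : ℝ => (f x).re) (R' := fun x => (f' x).re) one_half_pos
    (thetaModulus_mem ht).1.le (thetaModulus_mem ht).2
    (fun x _ => (hdr x).continuousAt.continuousWithinAt) ?_ ?_ ?_ (fun x _ => hdr x) ?_
  · intro x hx y hy hxy
    have hxy' : f x = f y := Complex.ext hxy (by rw [hfr, hfr])
    simp only [hf] at hxy'
    have nx := th4_ofReal_ne ht x
    have ny := th4_ofReal_ne ht y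
    have h1 : th1 t x * th4 t y = th4 t x * th1 t y := by
      field_simp at hxy'
      linear_combination hxy'
    have h2 := th1_mul_th1 ht x y
    have h3 : th1 t (x + y) * th1 t (x - y) = 0 := by
      have : th1 t (x + y) * th1 t (x - y) * th4 t 0 ^ 2 = 0 := by
        rw [h2]; linear_combination (th1 t x * th4 t y + th4 t x * th1 t y) * h1
      exact (mul_eq_zero.1 this).resolve_right (pow_ne_zero _ n4)
    rcases mul_eq_zero.1 h3 with h | h
    · obtain ⟨m, hm⟩ := exists_int_re_of_th1_eq_zero ht h
      simp at hm
      have hm0 : (0 : ℝ) ≤ m := by linarith [hx.1, hy.1]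
      have hm1 : (m : ℝ) ≤ 1 := by linarith [hx.2, hy.2]
      have hm0' : 0 ≤ m := by exact_mod_cast hm0
      have hm1' : m ≤ 1 := by exact_mod_cast hm1
      interval_cases m
      · norm_num at hm; linarith [hx.1, hy.1]
      · norm_num at hm; linarith [hx.2, hy.2]
    · obtain ⟨m, hm⟩ := exists_int_re_of_th1_eq_zero ht h
      simp at hm
      have : m = 0 := int_eq_zero_of_abs_lt (by
        rw [← hm, abs_lt]; constructor <;> linarith [hx.1, hy.1, hx.2, hy.2])
      rw [this] at hm; norm_num at hm; linarith
  · simp [hf, th1_zero]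
  · have e : f ((1 / 2 : ℝ) : ℂ) = 1 := by
      simp only [hf]
      have e1 := th1_add_half t 0
      have e4 := th4_add_half t 0
      rw [zero_add] at e1 e4
      push_cast
      rw [e1, e4]
      field_simp
    rw [e, one_re]
  · intro x _
    have nx := th4_ofReal_ne ht x
    have r1 := ofReal_re_eq (hfr x)
    have r2 := ofReal_re_eq (hf'r x)
    apply Complex.ofReal_injective
    push_cast
    rw [r1, r2, ofReal_thetaModulus, ofReal_thetaSpeed ht]
    simp only [hf, hf']
    rw [wronskian_th1_th4 ht]
    have i1 : 1 - (th3 t 0 / th2 t 0 * (th1 t x / th4 t x)) ^ 2 =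
        th4 t 0 ^ 2 * th2 t x ^ 2 / (th2 t 0 ^ 2 * th4 t x ^ 2) := by
      field_simp
      linear_combination -th_sq_add₁ ht (x : ℂ)
    have i2 : 1 - ((th2 t 0 / th3 t 0) ^ 2) ^ 2 * (th3 t 0 / th2 t 0 * (th1 t x / th4 t x)) ^ 2 =
        th4 t 0 ^ 2 * th3 t x ^ 2 / (th3 t 0 ^ 2 * th4 t x ^ 2) := by
      field_simp
      linear_combination -th_sq_add₂ ht (x : ℂ)
    rw [i1, i2]
    field_simp

/-- The same argument along the imaginary axis, with `th1`/`th2` in place of `th1`/`th4` on a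
segment of length t/2. There `th2` is positive, and the modulus in the differential equation is the
complementary one. -/
lemma ellipticK'_thetaModulus {t : ℝ} (ht : 0 < t) :
    ellipticK' (thetaModulus t) = |thetaSpeed t| * (t / 2) := by
  have n2 := th2_zero_ne ht
  have n3 := th3_zero_ne ht
  have n4 := th4_zero_ne ht
  rw [ellipticK', sqrt_one_sub_thetaModulus ht]
  have n2y : ∀ y : ℝ, th2 t (I * y) ≠ 0 := fun y h => by
    have := th2_imag_pos ht y
    rw [mul_comm (y : ℂ), h] at this
    simp at this
  set f : ℂ → ℂ := fun v => -I * (th3 t 0 / th4 t 0) * (th1 t (I * v) / th2 t (I * v)) with hf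
  set f' : ℂ → ℂ := fun v => -I * (th3 t 0 / th4 t 0) *
    ((deriv (th1 t) (I * v) * th2 t (I * v) - th1 t (I * v) * deriv (th2 t) (I * v)) /
      th2 t (I * v) ^ 2 * I) with hf'
  have hfr : ∀ x : ℝ, (f x).im = 0 := fun x => by
    have h1 : -I * th1 t (I * x) = (((-I * th1 t (I * x)).re : ℝ) : ℂ) := (ofReal_re_eq (by
      have := th1_imag t x
      rw [mul_comm (x : ℂ)] at this
      simp [this])).symm
    have h2 : th2 t (I * x) = (((th2 t (I * x)).re : ℝ) : ℂ) := (ofReal_re_eq (by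
      have := th2_imag t x
      rwa [mul_comm (x : ℂ)] at this)).symm
    have : f x = (((th3 t 0).re / (th4 t 0).re *
        ((-I * th1 t (I * x)).re / (th2 t (I * x)).re) : ℝ) : ℂ) := by
      push_cast; rw [th3_zero_re, th4_zero_re, ← h1, ← h2]
      simp only [hf]; ring
    rw [this, ofReal_im]
  have hI : ∀ v : ℂ, HasDerivAt (fun v : ℂ => I * v) I v := fun v => by
    simpa using (hasDerivAt_id v).const_mul I
  have hd : ∀ x : ℝ, HasDerivAt f (f' x) x := fun x => by
    have h := ((differentiable_th1 ht (I * x)).hasDerivAt).div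
      ((differentiable_th2 ht (I * x)).hasDerivAt) (n2y x)
    exact (h.comp (x : ℂ) (hI x)).const_mul _
  have hdr : ∀ x : ℝ, HasDerivAt (fun x : ℝ => (f x).re) (f' x).re x := fun x =>
    (hd x).real_of_complex
  have hf'r : ∀ x : ℝ, (f' x).im = 0 := fun x => by
    have h := ((hd x).const_mul (-I)).real_of_complex
    have h3 : (fun x : ℝ => (-I * f x).re) = fun _ => 0 := by
      funext x; simp [hfr]
    rw [h3] at h
    have := h.unique (hasDerivAt_const _ _)
    simpa using this
  refine ellipticK_eq_of_deriv (R := fun x : ℝ => (f x).re) (R' := fun x => (f' x).re) (half_pos ht)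
    (thetaModulus'_mem ht).1.le (thetaModulus'_mem ht).2
    (fun x _ => (hdr x).continuousAt.continuousWithinAt) ?_ ?_ ?_ (fun x _ => hdr x) ?_
  · intro x hx y hy hxy
    have hxy' : f x = f y := Complex.ext hxy (by rw [hfr, hfr])
    simp only [hf] at hxy'
    have nx := n2y x
    have ny := n2y y
    have hI0 := I_ne_zero
    have h1 : th1 t (I * x) * th2 t (I * y) = th2 t (I * x) * th1 t (I * y) := by
      field_simp at hxy'
      linear_combination -hxy'
    have h2 := th1_mul_th1' ht (I * x) (I * y)
    have h3 : th1 t (I * x + I * y) * th1 t (I * x - I * y) = 0 := by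
      have : th1 t (I * x + I * y) * th1 t (I * x - I * y) * th2 t 0 ^ 2 = 0 := by
        rw [h2]
        linear_combination (th1 t (I * x) * th2 t (I * y) + th2 t (I * x) * th1 t (I * y)) * h1
      exact (mul_eq_zero.1 this).resolve_right (pow_ne_zero _ n2)
    rcases mul_eq_zero.1 h3 with h | h
    · obtain ⟨m, hm⟩ := exists_int_im_of_th1_eq_zero ht h
      simp at hm
      have hm0 : (0 : ℝ) ≤ m := by
        by_contra hc; push Not at hc; nlinarith [hx.1, hy.1]
      have hm1 : (m : ℝ) ≤ 1 := by
        by_contra hc; push Not at hc; nlinarith [hx.2, hy.2]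
      have hm0' : 0 ≤ m := by exact_mod_cast hm0
      have hm1' : m ≤ 1 := by exact_mod_cast hm1
      interval_cases m
      · norm_num at hm; linarith [hx.1, hy.1]
      · norm_num at hm; linarith [hx.2, hy.2]
    · obtain ⟨m, hm⟩ := exists_int_im_of_th1_eq_zero ht h
      simp at hm
      have hm0 : (-1 : ℝ) < m := by
        by_contra hc; push Not at hc; nlinarith [hx.1, hx.2, hy.1, hy.2]
      have hm1 : (m : ℝ) < 1 := by
        by_contra hc; push Not at hc; nlinarith [hx.1, hx.2, hy.1, hy.2]
      have : m = 0 := int_eq_zero_of_abs_lt (abs_lt.2 ⟨hm0, hm1⟩)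
      rw [this] at hm; norm_num at hm; linarith
  · simp [hf, th1_zero]
  · have e : f ((t / 2 : ℝ) : ℂ) = 1 := by
      simp only [hf]
      have e1 := th1_add_half_period t 0
      have e2 := th2_add_half_period t 0
      rw [zero_add] at e1 e2
      rw [show I * ((t / 2 : ℝ) : ℂ) = t * I / 2 by push_cast; ring, e1, e2]
      have := Complex.exp_ne_zero (Real.pi * t / 4 - Real.pi * I * 0)
      field_simp
      simp
    rw [e, one_re]
  · intro x _
    have nx := n2y x
    have r1 := ofReal_re_eq (hfr x)
    have r2 := ofReal_re_eq (hf'r x)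
    apply Complex.ofReal_injective
    push_cast
    rw [r1, r2, ofReal_thetaModulus', ofReal_thetaSpeed ht]
    simp only [hf, hf']
    rw [wronskian_th1_th2 ht]
    have i1 : 1 - (-I * (th3 t 0 / th4 t 0) * (th1 t (I * x) / th2 t (I * x))) ^ 2 =
        th2 t 0 ^ 2 * th4 t (I * x) ^ 2 / (th4 t 0 ^ 2 * th2 t (I * x) ^ 2) := by
      rw [mul_pow, mul_pow, neg_sq, I_sq]
      field_simp
      linear_combination th_sq_add₁ ht (I * x : ℂ)
    have i2 : 1 - ((th4 t 0 / th3 t 0) ^ 2) ^ 2 *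
        (-I * (th3 t 0 / th4 t 0) * (th1 t (I * x) / th2 t (I * x))) ^ 2 =
        th2 t 0 ^ 2 * th3 t (I * x) ^ 2 / (th3 t 0 ^ 2 * th2 t (I * x) ^ 2) := by
      rw [mul_pow (-I * _), mul_pow (-I), neg_sq, I_sq]
      field_simp
      linear_combination th_sq_add₃ ht (I * x : ℂ)
    rw [i1, i2]
    field_simp
    simp

lemma thetaSpeed_ne_zero {t : ℝ} (ht : 0 < t) : thetaSpeed t ≠ 0 := fun h => by
  have h1 := ellipticK_pos (thetaModulus_mem ht).1.le (thetaModulus_mem ht).2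
  rw [ellipticK_thetaModulus ht, h] at h1
  simp at h1

lemma deriv_th1_zero_ne {t : ℝ} (ht : 0 < t) : deriv (th1 t) 0 ≠ 0 := fun h => by
  apply thetaSpeed_ne_zero ht
  have := ofReal_thetaSpeed ht
  rw [h, zero_mul, zero_div] at this
  exact_mod_cast this

/-- Jacobi inversion: the theta functions whose period is the quotient of the complete elliptic
integrals of modulus `k` belong to the modulus `k`. -/
lemma thetaModulus_ratio {k : ℝ} (hk : k ∈ Ioo (0 : ℝ) 1) :
    0 < ellipticK' k / ellipticK k ∧ thetaModulus (ellipticK' k / ellipticK k) = k := by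
  have h1 := ellipticK_pos hk.1.le hk.2
  have h2 : 0 < ellipticK' k := by
    refine ellipticK_pos (Real.sqrt_nonneg _) ?_
    rw [Real.sqrt_lt' one_pos]; nlinarith [hk.1]
  have ht := div_pos h2 h1
  -- For t = K'/K, the modulus `thetaModulus` t has the same quotient t, since the speed cancels.
  -- Strict monotonicity of the quotient identifies the moduli.
  refine ⟨ht, modulus_eq_of_ratio_eq (thetaModulus_mem ht) hk ?_⟩
  rw [ellipticK_thetaModulus ht, ellipticK'_thetaModulus ht]
  have := abs_pos.2 (thetaSpeed_ne_zero ht)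
  field_simp

/-! ### Charts of the Riemann sphere -/

open Classical in
/-- The point of the Riemann sphere with homogeneous coordinates `[a : b]`. -/
def toSphere (a b : ℂ) : OnePoint ℂ := if b = 0 then OnePoint.infty else ((a / b : ℂ) : OnePoint ℂ)

lemma toSphere_zero (a : ℂ) : toSphere a 0 = OnePoint.infty := if_pos rfl

lemma toSphere_of_ne {a b : ℂ} (hb : b ≠ 0) : toSphere a b = ((a / b : ℂ) : OnePoint ℂ) := if_neg hb

lemma chartInfty_zero : chartInfty 0 = OnePoint.infty := if_pos rfl

lemma chartInfty_of_ne {w : ℂ} (hw : w ≠ 0) : chartInfty w = ((w⁻¹ : ℂ) : OnePoint ℂ) := if_neg hw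

lemma toSphere_eq_chartInfty {a b : ℂ} (ha : a ≠ 0) : toSphere a b = chartInfty (b / a) := by
  by_cases hb : b = 0
  · rw [hb, toSphere_zero, zero_div, chartInfty_zero]
  · rw [toSphere_of_ne hb, chartInfty_of_ne (div_ne_zero hb ha), inv_div]

lemma toSphere_eq_iff {a b a' b' : ℂ} (h : a ≠ 0 ∨ b ≠ 0) (h' : a' ≠ 0 ∨ b' ≠ 0) :
    toSphere a b = toSphere a' b' ↔ a * b' = a' * b := by
  by_cases hb : b = 0
  · have ha : a ≠ 0 := h.resolve_right (not_not.2 hb)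
    by_cases hb' : b' = 0
    · simp [hb, hb', toSphere_zero]
    · rw [hb, toSphere_zero, toSphere_of_ne hb']
      simp [ha, hb', OnePoint.infty_ne_coe]
  · by_cases hb' : b' = 0
    · have ha' : a' ≠ 0 := h'.resolve_right (not_not.2 hb')
      rw [hb', toSphere_zero, toSphere_of_ne hb]
      simp [ha', hb, OnePoint.coe_ne_infty]
    · rw [toSphere_of_ne hb, toSphere_of_ne hb', OnePoint.coe_eq_coe, div_eq_div_iff hb hb']

lemma exists_toSphere_eq (P : OnePoint ℂ) : ∃ a b : ℂ, (a ≠ 0 ∨ b ≠ 0) ∧ toSphere a b = P := by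
  induction P using OnePoint.rec with
  | infty => exact ⟨1, 0, Or.inl one_ne_zero, toSphere_zero 1⟩
  | coe c => exact ⟨c, 1, Or.inr one_ne_zero, by rw [toSphere_of_ne one_ne_zero, div_one]⟩

/-- A chart of the Riemann sphere around the given point. -/
def sphereChart (P : OnePoint ℂ) : ℂ → OnePoint ℂ := P.elim chartInfty fun _ z => (z : OnePoint ℂ)

/-- The coordinate of the given point in the chart `sphereChart`. -/
def chartCenter (P : OnePoint ℂ) : ℂ := P.elim 0 fun c => c

lemma sphereChart_center (P : OnePoint ℂ) : sphereChart P (chartCenter P) = P := by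
  induction P using OnePoint.rec with
  | infty => exact chartInfty_zero
  | coe c => rfl

/-- Transfers limits and local extrema on the sphere to the plane. At ∞, inversion carries the
punctured neighbourhoods of 0 to the complements of bounded sets. -/
lemma map_sphereChart_nhds (P : OnePoint ℂ) :
    map (sphereChart P) (𝓝 (chartCenter P)) = 𝓝 P := by
  induction P using OnePoint.rec with
  | infty =>
    change map chartInfty (𝓝 0) = _
    rw [OnePoint.nhds_infty_eq, ← nhdsNE_sup_pure, Filter.map_sup, Filter.map_pure, chartInfty_zero,
      coclosedCompact_eq_cocompact, ← Metric.cobounded_eq_cocompact, ← inv_nhdsNE_zero,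
      ← Filter.map_inv, Filter.map_map]
    congr 1
    refine Filter.map_congr ?_
    filter_upwards [self_mem_nhdsWithin] with w hw
    exact chartInfty_of_ne hw
  | coe c => exact (OnePoint.nhds_coe_eq c).symm

lemma sphereHarmonicAt_iff {g : OnePoint ℂ → ℝ} {P : OnePoint ℂ} : SphereHarmonicAt g P ↔
    InnerProductSpace.HarmonicAt (g ∘ sphereChart P) (chartCenter P) := by
  induction P using OnePoint.rec with
  | infty => exact ⟨fun h => h.2 rfl, fun h => ⟨fun c hc => absurd hc (OnePoint.infty_ne_coe c),
      fun _ => h⟩⟩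
  | coe c => exact ⟨fun h => h.1 c rfl, fun h => ⟨fun c' hc => by
      rw [← OnePoint.coe_injective hc]; exact h, fun hc => absurd hc (OnePoint.coe_ne_infty c)⟩⟩

lemma hasLogPole_iff {g : OnePoint ℂ → ℝ} {P : OnePoint ℂ} : HasLogPole g P ↔
    (fun w => g (sphereChart P w) + Real.log ‖w - chartCenter P‖) =O[𝓝[≠] chartCenter P]
      fun _ => (1 : ℝ) := by
  induction P using OnePoint.rec with
  | infty =>
    have e : ((fun z : ℂ => g (z : OnePoint ℂ) - Real.log ‖z‖) =O[Bornology.cobounded ℂ]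
        fun _ => (1 : ℝ)) ↔ (fun w => g (chartInfty w) + Real.log ‖w - 0‖) =O[𝓝[≠] (0 : ℂ)]
        fun _ => (1 : ℝ) := by
      rw [← inv_nhdsNE_zero, ← Filter.map_inv, Asymptotics.isBigO_map]
      refine Asymptotics.isBigO_congr ?_ EventuallyEq.rfl
      filter_upwards [self_mem_nhdsWithin] with w hw
      simp [chartInfty_of_ne hw]
    exact ⟨fun h => e.1 (h.2 rfl), fun h => ⟨fun c hc => absurd hc (OnePoint.infty_ne_coe c),
      fun _ => e.2 h⟩⟩
  | coe c => exact ⟨fun h => h.1 c rfl, fun h => ⟨fun c' hc => by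
      rw [← OnePoint.coe_injective hc]; exact h, fun hc => absurd hc (OnePoint.coe_ne_infty c)⟩⟩

lemma ContinuousAt.toSphere {X : Type*} [TopologicalSpace X] {f g : X → ℂ} {x : X}
    (hf : ContinuousAt f x) (hg : ContinuousAt g x) (h : f x ≠ 0 ∨ g x ≠ 0) :
    ContinuousAt (fun x => toSphere (f x) (g x)) x := by
  by_cases hb : g x = 0
  · have ha : f x ≠ 0 := h.resolve_right (not_not.2 hb)
    have e : (fun x => _root_.toSphere (f x) (g x)) =ᶠ[𝓝 x] fun x => chartInfty (g x / f x) := by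
      filter_upwards [hf.eventually_ne ha] with y hy
      exact toSphere_eq_chartInfty hy
    refine ContinuousAt.congr ?_ e.symm
    have h1 : Tendsto (fun x => g x / f x) (𝓝 x) (𝓝 0) := by
      have := hg.div hf ha
      rwa [ContinuousAt, Pi.div_apply, hb, zero_div] at this
    have h2 : Tendsto chartInfty (𝓝 0) (𝓝 OnePoint.infty) :=
      (map_sphereChart_nhds OnePoint.infty).le
    have := h2.comp h1
    rwa [ContinuousAt, hb, zero_div, chartInfty_zero]
  · have e : (fun x => _root_.toSphere (f x) (g x)) =ᶠ[𝓝 x]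
        fun x => ((g x)⁻¹ * f x : ℂ) := by
      filter_upwards [hg.eventually_ne hb] with y hy
      rw [toSphere_of_ne hy, div_eq_inv_mul]
    refine ContinuousAt.congr ?_ e.symm
    exact OnePoint.continuous_coe.continuousAt.comp ((hg.inv₀ hb).mul hf)

/-! ### The conformal map in terms of theta functions -/

/-- A Möbius transformation of the squared quotient of the first and the fourth theta function. -/
def thetaMap (t : ℝ) (p s p' s' : ℂ) (v : ℂ) : OnePoint ℂ :=
  toSphere (p * th1 t v ^ 2 + s * th4 t v ^ 2) (p' * th1 t v ^ 2 + s' * th4 t v ^ 2)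

section thetaMap

variable {t : ℝ} {p s p' s' : ℂ}

/-- The zeros of `th1` have heights in tℤ, those of `th4` in t(ℤ + 1/2). Hence the homogeneous
coordinates of `thetaMap` never vanish together. -/
lemma th1_ne_zero_or_th4_ne_zero (ht : 0 < t) (v : ℂ) : th1 t v ≠ 0 ∨ th4 t v ≠ 0 := by
  by_contra! h
  obtain ⟨m, hm⟩ := exists_int_im_of_th1_eq_zero ht h.1
  obtain ⟨n, hn⟩ := exists_int_im_of_th1_eq_zero ht ((th4_eq_zero_iff v).1 h.2)
  have e : (v + t * I / 2).im = v.im + t / 2 := by simp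
  rw [e, hm] at hn
  have h1 : t * (2 * (n - m) - 1) = 0 := by linarith
  have h2 : (2 * (n - m) - 1 : ℝ) = 0 := (mul_eq_zero.1 h1).resolve_left ht.ne'
  have h3 : (2 * (n - m) - 1 : ℤ) = 0 := by exact_mod_cast h2
  omega

lemma linear_comb_ne_zero (hD : p * s' - p' * s ≠ 0) {x y : ℂ} (h : x ≠ 0 ∨ y ≠ 0) :
    p * x + s * y ≠ 0 ∨ p' * x + s' * y ≠ 0 := by
  by_contra! hc
  have h1 : (p * s' - p' * s) * x = 0 := by linear_combination s' * hc.1 - s * hc.2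
  have h2 : (p * s' - p' * s) * y = 0 := by linear_combination -p' * hc.1 + p * hc.2
  rcases h with h | h
  · exact h ((mul_eq_zero.1 h1).resolve_left hD)
  · exact h ((mul_eq_zero.1 h2).resolve_left hD)

lemma thetaMap_coord_ne (ht : 0 < t) (hD : p * s' - p' * s ≠ 0) (v : ℂ) :
    p * th1 t v ^ 2 + s * th4 t v ^ 2 ≠ 0 ∨ p' * th1 t v ^ 2 + s' * th4 t v ^ 2 ≠ 0 :=
  linear_comb_ne_zero hD ((th1_ne_zero_or_th4_ne_zero ht v).imp (pow_ne_zero 2) (pow_ne_zero 2))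

/-- Multiplicativity of the determinant combined with the addition formula `th1_mul_th1`. This is
the source of injectivity, of local invertibility and of the asymptotics at ∞. -/
lemma thetaMap_cross (ht : 0 < t) (p s p' s' u v : ℂ) :
    (p * th1 t u ^ 2 + s * th4 t u ^ 2) * (p' * th1 t v ^ 2 + s' * th4 t v ^ 2) -
      (p * th1 t v ^ 2 + s * th4 t v ^ 2) * (p' * th1 t u ^ 2 + s' * th4 t u ^ 2) =
    (p * s' - p' * s) * th4 t 0 ^ 2 * (th1 t (u + v) * th1 t (u - v)) := by
  linear_combination -(p * s' - p' * s) * th1_mul_th1 ht u v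

lemma thetaMap_eq_iff (ht : 0 < t) (hD : p * s' - p' * s ≠ 0) {u v : ℂ} :
    thetaMap t p s p' s' u = thetaMap t p s p' s' v ↔ th1 t (u + v) * th1 t (u - v) = 0 := by
  rw [thetaMap, thetaMap, toSphere_eq_iff (thetaMap_coord_ne ht hD u) (thetaMap_coord_ne ht hD v),
    ← sub_eq_zero, thetaMap_cross ht, mul_eq_zero, or_iff_right]
  exact mul_ne_zero hD (pow_ne_zero 2 (th4_zero_ne ht))

lemma thetaMap_neg (v : ℂ) : thetaMap t p s p' s' (-v) = thetaMap t p s p' s' v := by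
  simp only [thetaMap, th1_neg, th4_neg, neg_sq]

lemma thetaMap_add_one (v : ℂ) : thetaMap t p s p' s' (v + 1) = thetaMap t p s p' s' v := by
  simp only [thetaMap, th1_add_one, th4_add_one, neg_sq]

lemma thetaMap_add_period (ht : 0 < t) (hD : p * s' - p' * s ≠ 0) (v : ℂ) :
    thetaMap t p s p' s' (v + t * I) = thetaMap t p s p' s' v := by
  rw [thetaMap_eq_iff ht hD, show v + t * I - v = ((0 : ℤ) : ℂ) + ((1 : ℤ) : ℂ) * (t * I) by
    push_cast; ring, th1_lattice, mul_zero]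

lemma thetaMap_add_int (v : ℂ) (m : ℤ) :
    thetaMap t p s p' s' (v + m) = thetaMap t p s p' s' v := by
  have : Function.Periodic (thetaMap t p s p' s') 1 := thetaMap_add_one
  simpa using this.int_mul m v

lemma thetaMap_add_int_mul_period (ht : 0 < t) (hD : p * s' - p' * s ≠ 0) (v : ℂ) (n : ℤ) :
    thetaMap t p s p' s' (v + n * (t * I)) = thetaMap t p s p' s' v := by
  have : Function.Periodic (thetaMap t p s p' s') (t * I) := thetaMap_add_period ht hD
  exact this.int_mul n v

lemma continuous_thetaMap (ht : 0 < t) (hD : p * s' - p' * s ≠ 0) :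
    Continuous (thetaMap t p s p' s') := by
  have h1 := (differentiable_th1 ht).continuous
  have h4 := (differentiable_th4 ht).continuous
  refine continuous_iff_continuousAt.2 fun v => ContinuousAt.toSphere ?_ ?_ (thetaMap_coord_ne ht hD v)
  · fun_prop
  · fun_prop

/-- The points of a period rectangle of the lattice `ℤ + i t ℤ`. -/
lemma exists_reduce (ht : 0 < t) (v : ℂ) : ∃ m n : ℤ,
    (v + m + n * (t * I)).re ∈ Ioc (-(1 / 2) : ℝ) (1 / 2) ∧
    (v + m + n * (t * I)).im ∈ Ioc (-(t / 2)) (t / 2) := by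
  obtain ⟨m, hm, -⟩ := existsUnique_add_zsmul_mem_Ioc one_pos v.re (-(1 / 2))
  obtain ⟨n, hn, -⟩ := existsUnique_add_zsmul_mem_Ioc ht v.im (-(t / 2))
  refine ⟨m, n, ?_, ?_⟩
  · have e : (v + m + n * (t * I)).re = v.re + m := by simp
    rw [e]
    simp only [zsmul_eq_mul, mul_one] at hm
    exact ⟨hm.1, by linarith [hm.2]⟩
  · have e : (v + m + n * (t * I)).im = v.im + n * t := by simp
    rw [e]
    simp only [zsmul_eq_mul] at hn
    exact ⟨hn.1, by linarith [hn.2]⟩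

/-- Otherwise `th1`² divided by the combination would be entire and doubly periodic, hence constant
by Liouville. But it is 0 at 0 and nonzero at 1/2, where `th1` equals `th2`(0). -/
lemma exists_th_comb_eq_zero (ht : 0 < t) (a b : ℂ) :
    ∃ v, a * th1 t v ^ 2 + b * th4 t v ^ 2 = 0 := by
  by_contra! hG
  set F : ℂ → ℂ := fun v => th1 t v ^ 2 / (a * th1 t v ^ 2 + b * th4 t v ^ 2) with hF
  have h1 := differentiable_th1 ht
  have h4 := differentiable_th4 ht
  have hd : Differentiable ℂ F := by
    refine Differentiable.div ?_ ?_ hG <;> fun_prop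
  have p1 : Function.Periodic F 1 := fun v => by
    simp only [hF, th1_add_one, th4_add_one, neg_sq]
  have p2 : Function.Periodic F (t * I) := fun v => by
    simp only [hF, th1_add_period, th4_add_period]
    have := Complex.exp_ne_zero (Real.pi * t - 2 * Real.pi * I * v)
    rw [neg_mul, neg_mul, neg_sq, neg_sq, mul_pow, mul_pow, mul_left_comm a, mul_left_comm b, ← mul_add,
      mul_div_mul_left _ _ (pow_ne_zero 2 this)]
  have hK : IsCompact (Icc (-(1 / 2) : ℝ) (1 / 2) ×ℂ Icc (-(t / 2)) (t / 2)) :=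
    isCompact_Icc.reProdIm isCompact_Icc
  have hb : Bornology.IsBounded (range F) := by
    refine (hK.image hd.continuous).isBounded.subset ?_
    rintro _ ⟨v, rfl⟩
    obtain ⟨m, n, hre, him⟩ := exists_reduce ht v
    refine ⟨v + m + n * (t * I), ⟨Ioc_subset_Icc_self hre, Ioc_subset_Icc_self him⟩, ?_⟩
    rw [p2.int_mul n]
    simpa using p1.int_mul m v
  have e := hd.apply_eq_apply_of_bounded hb 0 (1 / 2)
  have e1 := th1_add_half t 0
  rw [zero_add] at e1
  simp only [hF, th1_zero, e1] at e
  have hne := hG (1 / 2)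
  rw [e1] at hne
  rw [eq_comm, div_eq_iff hne] at e
  simp [th2_zero_ne ht] at e

lemma thetaMap_surjective (ht : 0 < t) (hD : p * s' - p' * s ≠ 0) (P : OnePoint ℂ) :
    ∃ v, thetaMap t p s p' s' v = P := by
  obtain ⟨x, y, hxy, rfl⟩ := exists_toSphere_eq P
  obtain ⟨v, hv⟩ := exists_th_comb_eq_zero ht (p * y - p' * x) (s * y - s' * x)
  refine ⟨v, (toSphere_eq_iff (thetaMap_coord_ne ht hD v) hxy).2 ?_⟩
  linear_combination hv

/-- Every value is attained in the closed half of the period rectangle. -/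
lemma thetaMap_exists_rect (ht : 0 < t) (hD : p * s' - p' * s ≠ 0) (P : OnePoint ℂ) :
    ∃ v : ℂ, v.re ∈ Icc (-(1 / 2) : ℝ) 0 ∧ v.im ∈ Ioc (-(t / 2)) (t / 2) ∧
      thetaMap t p s p' s' v = P := by
  obtain ⟨v, hv⟩ := thetaMap_surjective ht hD P
  obtain ⟨m, n, hre, him⟩ := exists_reduce ht v
  have hv' : thetaMap t p s p' s' (v + m + n * (t * I)) = P := by
    rw [thetaMap_add_int_mul_period ht hD, thetaMap_add_int, hv]
  set w := v + m + n * (t * I)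
  rcases le_or_gt w.re 0 with h0 | h0
  · exact ⟨w, ⟨hre.1.le, h0⟩, him, hv'⟩
  · rcases him.2.lt_or_eq with h1 | h1
    · refine ⟨-w, ⟨?_, ?_⟩, ⟨?_, ?_⟩, by rw [thetaMap_neg, hv']⟩ <;> simp <;>
        linarith [hre.1, hre.2, him.1]
    -- Here -w has imaginary part -t/2, which the half-open range excludes; one period moves it back
    -- to t/2.
    · refine ⟨-w + t * I, ⟨?_, ?_⟩, ⟨?_, ?_⟩, ?_⟩
      · simp; linarith [hre.2]
      · simp; linarith
      · simp; linarith
      · simp; linarith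
      · rw [thetaMap_add_period ht hD, thetaMap_neg, hv']

/-- A local inverse of the conformal map in a chart of the sphere. -/
lemma exists_local_inverse (ht : 0 < t) (hD : p * s' - p' * s ≠ 0) {v : ℂ}
    (hv : th1 t (2 * v) ≠ 0) : ∃ ψ : ℂ → ℂ,
      AnalyticAt ℂ ψ (chartCenter (thetaMap t p s p' s' v)) ∧
      ψ (chartCenter (thetaMap t p s p' s' v)) = v ∧
      deriv ψ (chartCenter (thetaMap t p s p' s' v)) ≠ 0 ∧
      ∀ᶠ w in 𝓝 (chartCenter (thetaMap t p s p' s' v)),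
        thetaMap t p s p' s' (ψ w) = sphereChart (thetaMap t p s p' s' v) w := by
  have h1 := differentiable_th1 ht
  have h4 := differentiable_th4 ht
  set N : ℂ → ℂ := fun u => p * th1 t u ^ 2 + s * th4 t u ^ 2 with hN
  set M : ℂ → ℂ := fun u => p' * th1 t u ^ 2 + s' * th4 t u ^ 2 with hM
  have dN : Differentiable ℂ N := by fun_prop
  have dM : Differentiable ℂ M := by fun_prop
  -- Differentiating `thetaMap_cross` in u at u = v leaves a nonzero constant times
  -- `th1`(2v)`th1`'(0), because `th1` vanishes at 0.
  have hW : deriv N v * M v - N v * deriv M v ≠ 0 := by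
    have a1 := ((dN v).hasDerivAt.mul_const (M v)).sub ((dM v).hasDerivAt.const_mul (N v))
    have b1 : HasDerivAt (fun u => th1 t (u + v)) (deriv (th1 t) (v + v)) v :=
      HasDerivAt.comp_add_const v v (h1 (v + v)).hasDerivAt
    have b2 : HasDerivAt (fun u => th1 t (u - v)) (deriv (th1 t) 0) v := by
      refine HasDerivAt.comp_sub_const v v ?_
      rw [sub_self]; exact (h1 0).hasDerivAt
    have a2 := (b1.mul b2).const_mul ((p * s' - p' * s) * th4 t 0 ^ 2)
    have a3 := a1.unique (a2.congr_of_eventuallyEq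
      (Eventually.of_forall fun u => thetaMap_cross ht p s p' s' u v))
    rw [a3, sub_self, th1_zero, mul_zero, zero_add, ← two_mul]
    exact mul_ne_zero (mul_ne_zero hD (pow_ne_zero 2 (th4_zero_ne ht)))
      (mul_ne_zero hv (deriv_th1_zero_ne ht))
  -- The inverse function theorem, stated for the map read in whichever chart is centred at the
  -- image point: M/N at a pole, N/M elsewhere.
  have main : ∀ f : ℂ → ℂ, AnalyticAt ℂ f v → deriv f v ≠ 0 →
      f v = chartCenter (thetaMap t p s p' s' v) →
      (∀ᶠ u in 𝓝 v, thetaMap t p s p' s' u = sphereChart (thetaMap t p s p' s' v) (f u)) →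
      ∃ ψ : ℂ → ℂ,
      AnalyticAt ℂ ψ (chartCenter (thetaMap t p s p' s' v)) ∧
      ψ (chartCenter (thetaMap t p s p' s' v)) = v ∧
      deriv ψ (chartCenter (thetaMap t p s p' s' v)) ≠ 0 ∧
      ∀ᶠ w in 𝓝 (chartCenter (thetaMap t p s p' s' v)),
        thetaMap t p s p' s' (ψ w) = sphereChart (thetaMap t p s p' s' v) w := by
    intro f hf hf' hc hev
    have hs := hf.hasStrictDerivAt
    have hψ := hf.analyticAt_localInverse hf'
    have hd := (hs.to_localInverse hf').hasDerivAt
    have hr := HasStrictDerivAt.eventually_right_inverse hs hf'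
    have hl : hs.localInverse f _ v hf' (f v) = v :=
      (HasStrictDerivAt.eventually_left_inverse hs hf').self_of_nhds
    rw [← hc]
    refine ⟨hs.localInverse f _ v hf', hψ, hl, ?_, ?_⟩
    · rw [hd.deriv]; exact inv_ne_zero hf'
    · have ht' : Tendsto (hs.localInverse f _ v hf') (𝓝 (f v)) (𝓝 v) := by
        have := hψ.continuousAt.tendsto
        rwa [hl] at this
      filter_upwards [hr, ht'.eventually hev] with w hw1 hw2
      rw [hw2, hw1]
  by_cases hMv : M v = 0
  · have hNv : N v ≠ 0 := (thetaMap_coord_ne ht hD v).resolve_right (not_not.2 hMv)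
    have e0 : thetaMap t p s p' s' v = OnePoint.infty := by
      change toSphere (N v) (M v) = _
      rw [hMv, toSphere_zero]
    refine main (fun u => M u / N u) ((dM.analyticAt v).div (dN.analyticAt v) hNv) ?_ ?_ ?_
    · rw [(show HasDerivAt (fun u => M u / N u) _ v from
        (dM v).hasDerivAt.div (dN v).hasDerivAt hNv).deriv]
      refine div_ne_zero (fun h => hW ?_) (pow_ne_zero 2 hNv)
      linear_combination -h
    · rw [e0, hMv, zero_div]; rfl
    · rw [e0]
      filter_upwards [(dN v).continuousAt.eventually_ne hNv] with u hu
      exact toSphere_eq_chartInfty hu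
  · have e0 : thetaMap t p s p' s' v = ((N v / M v : ℂ) : OnePoint ℂ) := toSphere_of_ne hMv
    refine main (fun u => N u / M u) ((dN.analyticAt v).div (dM.analyticAt v) hMv) ?_ ?_ ?_
    · rw [(show HasDerivAt (fun u => N u / M u) _ v from
        (dN v).hasDerivAt.div (dM v).hasDerivAt hMv).deriv]
      exact div_ne_zero hW (pow_ne_zero 2 hMv)
    · rw [e0]; rfl
    · rw [e0]
      filter_upwards [(dM v).continuousAt.eventually_ne hMv] with u hu
      exact toSphere_of_ne hu

end thetaMap

/-! ### Functions on the exterior of the arcs, lifted from a strip -/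

/-- The strip `-1/2 < Re v < 0`. -/
def vstrip : Set ℂ := {v | -(1 / 2) < v.re ∧ v.re < 0}

/-- The boundary of the strip `-1/2 < Re v < 0`. -/
def vstripBoundary : Set ℂ := {v | v.re = 0 ∨ v.re = -(1 / 2)}

lemma isOpen_vstrip : IsOpen vstrip :=
  (isOpen_lt continuous_const continuous_re).inter (isOpen_lt continuous_re continuous_const)

section

variable {t : ℝ} {p s p' s' : ℂ}

lemma th1_ne_zero_of_re (ht : 0 < t) {v : ℂ} (n : ℤ) (h1 : (n : ℝ) < v.re) (h2 : v.re < n + 1) :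
    th1 t v ≠ 0 := fun h => by
  obtain ⟨m, hm⟩ := exists_int_re_of_th1_eq_zero ht h
  rw [hm] at h1 h2
  have h1' : n < m := by exact_mod_cast h1
  have h2' : m < n + 1 := by exact_mod_cast h2
  omega

lemma th1_add_ne_zero (ht : 0 < t) {v w : ℂ} (hv : v ∈ vstrip) (hw : w ∈ vstrip) :
    th1 t (v + w) ≠ 0 := by
  refine th1_ne_zero_of_re ht (-1) ?_ ?_ <;> push_cast <;> rw [add_re] <;>
    linarith [hv.1, hv.2, hw.1, hw.2]

lemma th1_two_mul_ne_zero (ht : 0 < t) {v : ℂ} (hv : v ∈ vstrip) : th1 t (2 * v) ≠ 0 :=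
  two_mul v ▸ th1_add_ne_zero ht hv hv

lemma exists_int_of_th1_sub_eq_zero (ht : 0 < t) {v w : ℂ} (hv : v ∈ vstrip) (hw : w ∈ vstrip)
    (h : th1 t (v - w) = 0) : ∃ n : ℤ, v = w + n * (t * I) := by
  obtain ⟨m, n, hmn⟩ := (th1_eq_zero_iff ht).1 h
  have hre : v.re - w.re = m := by simpa using congrArg Complex.re hmn
  have hm : m = 0 := int_eq_zero_of_abs_lt (by
    rw [← hre, abs_lt]; constructor <;> linarith [hv.1, hv.2, hw.1, hw.2])
  refine ⟨n, ?_⟩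
  rw [hm] at hmn
  rw [← sub_add_cancel v w, hmn]; push_cast; ring

lemma exists_int_of_thetaMap_eq (ht : 0 < t) (hD : p * s' - p' * s ≠ 0) {v w : ℂ}
    (hv : v ∈ vstrip) (hw : w ∈ vstrip) (h : thetaMap t p s p' s' v = thetaMap t p s p' s' w) :
    ∃ n : ℤ, v = w + n * (t * I) :=
  exists_int_of_th1_sub_eq_zero ht hv hw
    ((mul_eq_zero.1 ((thetaMap_eq_iff ht hD).1 h)).resolve_left (th1_add_ne_zero ht hv hw))

lemma eq_of_eq_add_int_mul_period (ht : 0 < t) {v w : ℂ} {n : ℤ} (h : v = w + n * (t * I))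
    (hv : v.im ∈ Ioc (-(t / 2)) (t / 2)) (hw : w.im ∈ Ioc (-(t / 2)) (t / 2)) : v = w := by
  have him : v.im = w.im + n * t := by simpa using congrArg Complex.im h
  have h1 : (n : ℝ) < 1 := by
    by_contra hc; push Not at hc; nlinarith [hv.1, hv.2, hw.1, hw.2]
  have h2 : (-1 : ℝ) < n := by
    by_contra hc; push Not at hc; nlinarith [hv.1, hv.2, hw.1, hw.2]
  have h0 : n = 0 := int_eq_zero_of_abs_lt (abs_lt.2 ⟨h2, h1⟩)
  rw [h, h0]; simp

/-- A value in the strip is not taken on the boundary lines, since the sum and the difference of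
such points have non-integral real part. Conversely, every value of the sphere occurs in the closed
strip. -/
lemma thetaMap_image_vstrip (ht : 0 < t) (hD : p * s' - p' * s ≠ 0) :
    thetaMap t p s p' s' '' vstrip = (thetaMap t p s p' s' '' vstripBoundary)ᶜ := by
  apply Subset.antisymm
  · rintro _ ⟨v, hv, rfl⟩ ⟨w, hw, hwv⟩
    have h := mul_eq_zero.1 ((thetaMap_eq_iff ht hD).1 hwv)
    revert h
    rw [imp_false, not_or]
    rcases hw with hw | hw
    · constructor
      · refine th1_ne_zero_of_re ht (-1) ?_ ?_ <;> push_cast <;> rw [add_re] <;>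
          linarith [hv.1, hv.2]
      · refine th1_ne_zero_of_re ht 0 ?_ ?_ <;> push_cast <;> rw [sub_re] <;>
          linarith [hv.1, hv.2]
    · constructor
      · refine th1_ne_zero_of_re ht (-1) ?_ ?_ <;> push_cast <;> rw [add_re] <;>
          linarith [hv.1, hv.2]
      · refine th1_ne_zero_of_re ht (-1) ?_ ?_ <;> push_cast <;> rw [sub_re] <;>
          linarith [hv.1, hv.2]
  · intro P hP
    obtain ⟨v, hre, him, rfl⟩ := thetaMap_exists_rect ht hD P
    refine ⟨v, ⟨lt_of_le_of_ne hre.1 fun h => hP ⟨v, Or.inr h.symm, rfl⟩,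
      lt_of_le_of_ne hre.2 fun h => hP ⟨v, Or.inl h, rfl⟩⟩, rfl⟩

lemma thetaMap_image_rect (ht : 0 < t) (hD : p * s' - p' * s ≠ 0) :
    BijOn (thetaMap t p s p' s') (vstrip ∩ {v | v.im ∈ Ioc (-(t / 2)) (t / 2)})
      (thetaMap t p s p' s' '' vstrip) := by
  refine ⟨fun v hv => ⟨v, hv.1, rfl⟩, fun v hv w hw h => ?_, fun P hP => ?_⟩
  · obtain ⟨n, hn⟩ := exists_int_of_thetaMap_eq ht hD hv.1 hw.1 h
    exact eq_of_eq_add_int_mul_period ht hn hv.2 hw.2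
  · rw [thetaMap_image_vstrip ht hD] at hP
    obtain ⟨v, hre, him, rfl⟩ := thetaMap_exists_rect ht hD P
    exact ⟨v, ⟨⟨lt_of_le_of_ne hre.1 fun h => hP ⟨v, Or.inr h.symm, rfl⟩,
      lt_of_le_of_ne hre.2 fun h => hP ⟨v, Or.inl h, rfl⟩⟩, him⟩, rfl⟩

variable (t p s p' s') in
/-- The function on the image of the strip that corresponds to a periodic function on the strip. -/
def stripLift (L : ℂ → ℝ) (P : OnePoint ℂ) : ℝ :=
  L (Function.invFunOn (thetaMap t p s p' s') vstrip P)

lemma stripLift_apply (ht : 0 < t) (hD : p * s' - p' * s ≠ 0) {L : ℂ → ℝ}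
    (hL : Function.Periodic L (t * I)) {v : ℂ} (hv : v ∈ vstrip) :
    stripLift t p s p' s' L (thetaMap t p s p' s' v) = L v := by
  have h : ∃ w ∈ vstrip, thetaMap t p s p' s' w = thetaMap t p s p' s' v := ⟨v, hv, rfl⟩
  obtain ⟨n, hn⟩ := exists_int_of_thetaMap_eq ht hD (Function.invFunOn_mem h) hv
    (Function.invFunOn_eq h)
  rw [stripLift, hn]
  exact hL.int_mul n v

lemma exists_local_lift (ht : 0 < t) (hD : p * s' - p' * s ≠ 0) {v : ℂ} (hv : v ∈ vstrip) :
    ∃ ψ : ℂ → ℂ, AnalyticAt ℂ ψ (chartCenter (thetaMap t p s p' s' v)) ∧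
      ψ (chartCenter (thetaMap t p s p' s' v)) = v ∧
      deriv ψ (chartCenter (thetaMap t p s p' s' v)) ≠ 0 ∧
      ∀ L : ℂ → ℝ, Function.Periodic L (t * I) →
        stripLift t p s p' s' L ∘ sphereChart (thetaMap t p s p' s' v)
          =ᶠ[𝓝 (chartCenter (thetaMap t p s p' s' v))] L ∘ ψ := by
  obtain ⟨ψ, h1, h2, h3, h4⟩ := exists_local_inverse (p := p) (s := s) (p' := p') (s' := s') ht hD
    (th1_two_mul_ne_zero ht hv)
  refine ⟨ψ, h1, h2, h3, fun L hL => ?_⟩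
  have h5 : ∀ᶠ w in 𝓝 (chartCenter (thetaMap t p s p' s' v)), ψ w ∈ vstrip :=
    h1.continuousAt.eventually_mem (by rw [h2]; exact isOpen_vstrip.mem_nhds hv)
  filter_upwards [h4, h5] with w hw hw'
  rw [Function.comp, ← hw, stripLift_apply ht hD hL hw', Function.comp]

lemma sphereHarmonicAt_stripLift (ht : 0 < t) (hD : p * s' - p' * s ≠ 0) {L : ℂ → ℝ}
    (hL : Function.Periodic L (t * I)) {v : ℂ} (hv : v ∈ vstrip)
    (h : ∀ (ψ : ℂ → ℂ) (z : ℂ), AnalyticAt ℂ ψ z → ψ z = v →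
      InnerProductSpace.HarmonicAt (L ∘ ψ) z) :
    SphereHarmonicAt (stripLift t p s p' s' L) (thetaMap t p s p' s' v) := by
  obtain ⟨ψ, h1, h2, -, h4⟩ := exists_local_lift (p := p) (s := s) (p' := p') (s' := s') ht hD hv
  rw [sphereHarmonicAt_iff, InnerProductSpace.harmonicAt_congr_nhds (h4 L hL)]
  exact h ψ _ h1 h2

/-- A compactness argument replaces any boundary regularity of the inverse map. Along an ultrafilter
converging to ξ the preimages in the bounded fundamental rectangle converge to some w. By continuity
w maps to ξ, and since ξ is not in the image of the strip, w lies on a boundary line. -/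
lemma tendsto_stripLift (ht : 0 < t) (hD : p * s' - p' * s ≠ 0) {L : ℂ → ℝ}
    (hL : Function.Periodic L (t * I)) {ξ : OnePoint ℂ} {l : ℝ}
    (hξ : ξ ∉ thetaMap t p s p' s' '' vstrip)
    (h : ∀ w ∈ vstripBoundary, thetaMap t p s p' s' w = ξ → Tendsto L (𝓝[vstrip] w) (𝓝 l)) :
    Tendsto (stripLift t p s p' s' L) (𝓝[thetaMap t p s p' s' '' vstrip] ξ) (𝓝 l) := by
  set Φ := thetaMap t p s p' s' with hΦ
  set R := vstrip ∩ {v | v.im ∈ Ioc (-(t / 2)) (t / 2)}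
  set ρ := Function.invFunOn Φ R
  have hbij : BijOn Φ R (Φ '' vstrip) := thetaMap_image_rect ht hD
  have hρ : ∀ P ∈ Φ '' vstrip, ρ P ∈ R ∧ Φ (ρ P) = P := fun P hP =>
    ⟨Function.invFunOn_mem (hbij.surjOn hP), Function.invFunOn_eq (hbij.surjOn hP)⟩
  rw [tendsto_iff_ultrafilter]
  intro 𝒰 h𝒰
  have hΩ : ∀ᶠ P in (𝒰 : Filter (OnePoint ℂ)), P ∈ Φ '' vstrip := h𝒰 self_mem_nhdsWithin
  have h𝒰ξ : (𝒰 : Filter (OnePoint ℂ)) ≤ 𝓝 ξ := h𝒰.trans nhdsWithin_le_nhds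
  have hK : IsCompact (Icc (-(1 / 2) : ℝ) 0 ×ℂ Icc (-(t / 2)) (t / 2)) :=
    isCompact_Icc.reProdIm isCompact_Icc
  have hmem : Icc (-(1 / 2) : ℝ) 0 ×ℂ Icc (-(t / 2)) (t / 2) ∈ (𝒰.map ρ : Filter ℂ) := by
    rw [Ultrafilter.coe_map, Filter.mem_map]
    filter_upwards [hΩ] with P hP
    obtain ⟨⟨h1, h2⟩, -⟩ := hρ P hP
    exact ⟨⟨h1.1.le, h1.2.le⟩, Ioc_subset_Icc_self h2⟩
  obtain ⟨w, hwK, hw⟩ := isCompact_iff_ultrafilter_le_nhds.1 hK (𝒰.map ρ)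
    (le_principal_iff.2 hmem)
  have hw' : Tendsto ρ 𝒰 (𝓝 w) := hw
  have hlim : Tendsto (fun P => P) (𝒰 : Filter (OnePoint ℂ)) (𝓝 (Φ w)) := by
    refine (((continuous_thetaMap ht hD).tendsto w).comp hw').congr' ?_
    filter_upwards [hΩ] with P hP
    exact (hρ P hP).2
  have hwξ : Φ w = ξ := tendsto_nhds_unique hlim h𝒰ξ
  have hwb : w ∈ vstripBoundary := by
    by_contra hc
    rw [vstripBoundary, Set.mem_ofPred_eq, not_or] at hc
    exact hξ ⟨w, ⟨lt_of_le_of_ne hwK.1.1 (Ne.symm hc.2), lt_of_le_of_ne hwK.1.2 hc.1⟩, hwξ⟩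
  have hw'' : Tendsto ρ 𝒰 (𝓝[vstrip] w) := tendsto_nhdsWithin_iff.2
    ⟨hw', by filter_upwards [hΩ] with P hP using (hρ P hP).1.1⟩
  refine ((h w hwb hwξ).comp hw'').congr' ?_
  filter_upwards [hΩ] with P hP
  conv_rhs => rw [← (hρ P hP).2, stripLift_apply ht hD hL (hρ P hP).1.1]
  rfl

end

/-! ### The maximum principle on the Riemann sphere -/

/-- Locally f = Re F with F analytic, and the maximum modulus principle applies to exp F, whose
modulus is exp f. -/
lemma eventually_eq_of_isLocalMax_harmonic {f : ℂ → ℝ} {z : ℂ}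
    (hf : InnerProductSpace.HarmonicAt f z) (hm : IsLocalMax f z) : ∀ᶠ w in 𝓝 z, f w = f z := by
  obtain ⟨R, hR, hball⟩ := Metric.eventually_nhds_iff_ball.1 hf.eventually
  obtain ⟨F, hF, hre⟩ :=
    InnerProductSpace.HarmonicOnNhd.exists_analyticOnNhd_ball_re_eq (f := f) (z := z) (R := R)
      fun x hx => hball x hx
  have hb : ∀ᶠ w in 𝓝 z, w ∈ Metric.ball z R := Metric.ball_mem_nhds z hR
  have hz : z ∈ Metric.ball z R := Metric.mem_ball_self hR
  have hd : ∀ᶠ w in 𝓝 z, DifferentiableAt ℂ (fun w => cexp (F w)) w := by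
    filter_upwards [hb] with w hw
    exact (hF w hw).differentiableAt.cexp
  have hn : ∀ w ∈ Metric.ball z R, ‖cexp (F w)‖ = Real.exp (f w) := fun w hw => by
    rw [Complex.norm_exp, ← hre hw]
  have hmax : IsLocalMax (norm ∘ fun w => cexp (F w)) z := by
    filter_upwards [hm, hb] with w hw hwb
    simp only [Function.comp]
    rw [hn w hwb, hn z hz]
    exact Real.exp_le_exp.2 hw
  filter_upwards [Complex.eventually_eq_of_isLocalMax_norm hd hmax, hb] with w hw hwb
  apply Real.exp_injective
  rw [← hn w hwb, ← hn z hz, hw]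

lemma SphereHarmonicAt.continuousAt {g : OnePoint ℂ → ℝ} {P : OnePoint ℂ}
    (h : SphereHarmonicAt g P) : ContinuousAt g P := by
  have h1 := (sphereHarmonicAt_iff.1 h).1.continuousAt
  rw [ContinuousAt, ← map_sphereChart_nhds P, tendsto_map'_iff]
  rwa [ContinuousAt, Function.comp, sphereChart_center] at h1

lemma SphereHarmonicAt.eventually_eq_of_isLocalMax {g : OnePoint ℂ → ℝ} {P : OnePoint ℂ}
    (h : SphereHarmonicAt g P) (hm : IsLocalMax g P) : ∀ᶠ Q in 𝓝 P, g Q = g P := by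
  rw [IsLocalMax, IsMaxFilter, ← map_sphereChart_nhds P, eventually_map] at hm
  rw [← map_sphereChart_nhds P, eventually_map]
  have := eventually_eq_of_isLocalMax_harmonic (sphereHarmonicAt_iff.1 h)
    (by filter_upwards [hm] with w hw; simpa [sphereChart_center] using hw)
  filter_upwards [this] with w hw
  simpa [sphereChart_center] using hw

lemma SphereHarmonicAt.sub {f g : OnePoint ℂ → ℝ} {P : OnePoint ℂ}
    (hf : SphereHarmonicAt f P) (hg : SphereHarmonicAt g P) :
    SphereHarmonicAt (fun Q => f Q - g Q) P := by
  rw [sphereHarmonicAt_iff] at *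
  exact hf.sub hg

lemma SphereHarmonicAt.const_mul {g : OnePoint ℂ → ℝ} {P : OnePoint ℂ} (c : ℝ)
    (hg : SphereHarmonicAt g P) : SphereHarmonicAt (fun Q => c * g Q) P := by
  rw [sphereHarmonicAt_iff] at *
  exact hg.const_smul

/-- If f were positive somewhere, the boundary condition would make its positive superlevel sets
closed in the sphere, hence compact, so a maximum would be attained. The set where it is attained is
then clopen in the sphere, hence the whole sphere, against U ≠ `univ`. Only the sphere has to be
connected, not U. -/
lemma sphere_maximum_principle {U : Set (OnePoint ℂ)} (hU : IsOpen U) (hU' : U ≠ univ)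
    {f : OnePoint ℂ → ℝ} (hf : ∀ P ∈ U, SphereHarmonicAt f P)
    (hb : ∀ ξ ∈ frontier U, ∀ ε > 0, ∀ᶠ P in 𝓝[U] ξ, f P < ε) : ∀ P ∈ U, f P ≤ 0 := by
  by_contra! hc
  obtain ⟨P₀, hP₀, hpos⟩ := hc
  have hclosed : ∀ m > 0, IsClosed {P | P ∈ U ∧ m ≤ f P} := by
    intro m hm
    rw [← isOpen_compl_iff, isOpen_iff_mem_nhds]
    intro P hP
    change ∀ᶠ Q in 𝓝 P, Q ∉ {P | P ∈ U ∧ m ≤ f P}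
    by_cases hPU : P ∈ U
    · have hlt : f P < m := by
        by_contra hc; exact hP ⟨hPU, not_lt.1 hc⟩
      filter_upwards [(hf P hPU).continuousAt.eventually_lt_const hlt] with Q hQ h
      exact absurd h.2 (not_le.2 hQ)
    · by_cases hPc : P ∈ closure U
      · have := hb P ⟨hPc, by rwa [hU.interior_eq]⟩ m hm
        rw [eventually_nhdsWithin_iff] at this
        filter_upwards [this] with Q hQ h
        exact absurd h.2 (not_le.2 (hQ h.1))
      · filter_upwards [isClosed_closure.isOpen_compl.mem_nhds hPc] with Q hQ h
        exact hQ (subset_closure h.1)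
  have hK := (hclosed (f P₀) hpos).isCompact
  obtain ⟨P₁, hP₁, hmax⟩ := hK.exists_isMaxOn ⟨P₀, hP₀, le_rfl⟩
    fun P hP => (hf P hP.1).continuousAt.continuousWithinAt
  have hmax' : ∀ P ∈ U, f P ≤ f P₁ := fun P hP => by
    rcases le_or_gt (f P₀) (f P) with h | h
    · exact hmax ⟨hP, h⟩
    · exact h.le.trans hP₁.2
  have hopen : IsOpen {P | P ∈ U ∧ f P₁ ≤ f P} := by
    rw [isOpen_iff_mem_nhds]
    rintro P ⟨hP, hPe⟩
    have hUn : ∀ᶠ Q in 𝓝 P, Q ∈ U := hU.mem_nhds hP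
    have hloc : IsLocalMax f P := by
      filter_upwards [hUn] with Q hQ
      exact (hmax' Q hQ).trans hPe
    filter_upwards [(hf P hP).eventually_eq_of_isLocalMax hloc, hUn] with Q hQ hQU
    exact ⟨hQU, hQ ▸ hPe⟩
  have huniv := IsClopen.eq_univ ⟨hclosed (f P₁) (hpos.trans_le hP₁.2), hopen⟩ ⟨P₁, hP₁.1, le_rfl⟩
  exact hU' (eq_univ_of_forall fun P => (huniv ▸ mem_univ P : P ∈ {P | P ∈ U ∧ f P₁ ≤ f P}).1)

lemma mem_frontier_of_mem_frontier_diff {X : Type*} [TopologicalSpace X] [T1Space X] {Ω : Set X}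
    (hΩ : IsOpen Ω) {c ξ : X} (h : ξ ∈ frontier (Ω \ {c})) : ξ = c ∨ ξ ∈ frontier Ω := by
  by_cases hc : ξ = c
  · exact Or.inl hc
  · refine Or.inr ⟨closure_mono sdiff_subset h.1, fun hi => h.2 ?_⟩
    rw [(hΩ.sdiff isClosed_singleton).interior_eq]
    exact ⟨interior_subset hi, hc⟩

lemma eventually_nhdsNE_sphere {P : OnePoint ℂ} {q : OnePoint ℂ → Prop}
    (h : ∀ᶠ w in 𝓝[≠] chartCenter P, q (sphereChart P w)) : ∀ᶠ Q in 𝓝[≠] P, q Q := by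
  rw [eventually_nhdsWithin_iff] at h ⊢
  rw [← map_sphereChart_nhds P, eventually_map]
  filter_upwards [h] with w hw hne
  refine hw fun hwc => hne ?_
  rw [mem_singleton_iff.1 hwc, sphereChart_center]
  rfl

/-- At the pole only boundedness of the difference is known. With the factor 1 + ε the comparison
function behaves like ε log|w - c| and tends to -∞ there, so the maximum principle applies on Ω
without the pole; then ε → 0. -/
lemma IsGreenFunction.le {Ω : Set (OnePoint ℂ)} (hΩ : IsOpen Ω) (hΩ' : Ω ≠ univ)
    {c : OnePoint ℂ} {g₁ g₂ : OnePoint ℂ → ℝ} (h₁ : IsGreenFunction Ω c g₁)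
    (h₂ : IsGreenFunction Ω c g₂) {P : OnePoint ℂ} (hP : P ∈ Ω) (hPc : P ≠ c) : g₁ P ≤ g₂ P := by
  have key : ∀ ε > 0, g₁ P - (1 + ε) * g₂ P ≤ 0 := by
    intro ε hε
    refine sphere_maximum_principle (U := Ω \ {c}) (f := fun Q => g₁ Q - (1 + ε) * g₂ Q)
      (hΩ.sdiff isClosed_singleton) (fun h => hΩ' ?_) (fun Q hQ => ?_) (fun ξ hξ δ hδ => ?_) P
      ⟨hP, hPc⟩
    · exact univ_subset_iff.1 (h ▸ sdiff_subset)
    · exact (h₁.harmonic Q hQ.1 hQ.2).sub ((h₂.harmonic Q hQ.1 hQ.2).const_mul _)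
    · rcases mem_frontier_of_mem_frontier_diff hΩ hξ with rfl | hξ
      · have e : ∀ᶠ Q in 𝓝[≠] ξ, g₁ Q - (1 + ε) * g₂ Q < δ := by
          refine eventually_nhdsNE_sphere ?_
          obtain ⟨C₁, hC₁⟩ := (hasLogPole_iff.1 h₁.pole).bound
          obtain ⟨C₂, hC₂⟩ := (hasLogPole_iff.1 h₂.pole).bound
          have hlog : Tendsto (fun w => ε * Real.log ‖w - chartCenter ξ‖)
              (𝓝[≠] chartCenter ξ) atBot := by
            refine Tendsto.const_mul_atBot hε ?_
            refine Real.tendsto_log_nhdsGT_zero.comp ?_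
            exact tendsto_norm_sub_self_nhdsNE _
          filter_upwards [hC₁, hC₂, hlog.eventually_lt_atBot (δ - C₁ - (1 + ε) * C₂)] with w a b d
          rw [norm_one, mul_one, Real.norm_eq_abs, abs_le] at a b
          nlinarith
        exact e.filter_mono (nhdsWithin_mono _ fun Q hQ => hQ.2)
      · have := (h₁.boundary ξ hξ).sub ((h₂.boundary ξ hξ).const_mul (1 + ε))
        rw [mul_zero, sub_zero] at this
        exact (this.eventually_lt_const hδ).filter_mono (nhdsWithin_mono _ sdiff_subset)
  have hlim : Tendsto (fun ε : ℝ => g₁ P - (1 + ε) * g₂ P) (𝓝[>] 0)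
      (𝓝 (g₁ P - (1 + 0) * g₂ P)) := by
    refine Tendsto.mono_left (Continuous.tendsto ?_ 0) nhdsWithin_le_nhds
    fun_prop
  have := le_of_tendsto hlim (by filter_upwards [self_mem_nhdsWithin] with ε hε using key ε hε)
  linarith

/-- Green's functions are unique. -/
lemma IsGreenFunction.unique {Ω : Set (OnePoint ℂ)} (hΩ : IsOpen Ω) (hΩ' : Ω ≠ univ)
    {c : OnePoint ℂ} {g₁ g₂ : OnePoint ℂ → ℝ} (h₁ : IsGreenFunction Ω c g₁)
    (h₂ : IsGreenFunction Ω c g₂) {P : OnePoint ℂ} (hP : P ∈ Ω) (hPc : P ≠ c) : g₁ P = g₂ P :=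
  le_antisymm (h₁.le hΩ hΩ' h₂ hP hPc) (h₂.le hΩ hΩ' h₁ hP hPc)

lemma IsHarmonicMeasure.le {Ω A : Set (OnePoint ℂ)} (hΩ : IsOpen Ω) (hΩ' : Ω ≠ univ)
    {g₁ g₂ : OnePoint ℂ → ℝ} (h₁ : IsHarmonicMeasure Ω A g₁)
    (h₂ : IsHarmonicMeasure Ω A g₂) {P : OnePoint ℂ} (hP : P ∈ Ω) : g₁ P ≤ g₂ P := by
  have := sphere_maximum_principle (U := Ω) (f := fun Q => g₁ Q - g₂ Q) hΩ hΩ'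
    (fun Q hQ => (h₁.harmonic Q hQ).sub (h₂.harmonic Q hQ)) (fun ξ hξ δ hδ => by
      have h : Tendsto (fun Q => g₁ Q - g₂ Q) (𝓝[Ω] ξ) (𝓝 0) := by
        by_cases hA : ξ ∈ A
        · simpa using (h₁.boundary_one ξ ⟨hξ, hA⟩).sub (h₂.boundary_one ξ ⟨hξ, hA⟩)
        · simpa using (h₁.boundary_zero ξ ⟨hξ, hA⟩).sub (h₂.boundary_zero ξ ⟨hξ, hA⟩)
      exact h.eventually_lt_const hδ) P hP
  linarith

/-- Harmonic measures are unique. -/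
lemma IsHarmonicMeasure.unique {Ω A : Set (OnePoint ℂ)} (hΩ : IsOpen Ω) (hΩ' : Ω ≠ univ)
    {g₁ g₂ : OnePoint ℂ → ℝ} (h₁ : IsHarmonicMeasure Ω A g₁)
    (h₂ : IsHarmonicMeasure Ω A g₂) {P : OnePoint ℂ} (hP : P ∈ Ω) : g₁ P = g₂ P :=
  le_antisymm (h₁.le hΩ hΩ' h₂ hP) (h₂.le hΩ hΩ' h₁ hP)

/-! ### Green's function and harmonic measure in terms of theta functions -/

/-- Green's function in the coordinate of the strip. -/
def stripGreen (t : ℝ) (γ v : ℂ) : ℝ := Real.log ‖th1 t (v + conj γ) / th1 t (v - γ)‖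

section

variable {t : ℝ} {p s p' s' : ℂ}

/-- The multipliers of numerator and denominator differ by exp(-2πi(γ + γ̄)), which has modulus 1.
-/
lemma stripGreen_periodic (t : ℝ) (γ : ℂ) : Function.Periodic (stripGreen t γ) (t * I) := by
  intro v
  have e1 : cexp (Real.pi * t - 2 * Real.pi * I * (v + conj γ)) =
      cexp (Real.pi * t - 2 * Real.pi * I * (v - γ)) * cexp ((-2 * Real.pi * (2 * γ.re) : ℝ) * I) := by
    rw [← Complex.exp_add]
    have := Complex.add_conj γ
    congr 1
    push_cast at this ⊢
    linear_combination (-2 * Real.pi * I : ℂ) * this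
  rw [stripGreen, stripGreen, show v + t * I + conj γ = v + conj γ + t * I by ring,
    show v + t * I - γ = v - γ + t * I by ring, th1_add_period, th1_add_period, e1]
  simp only [norm_mul, norm_div, norm_neg, Complex.norm_exp_ofReal_mul_I, mul_one]
  have := norm_ne_zero_iff.2 (Complex.exp_ne_zero (Real.pi * t - 2 * Real.pi * I * (v - γ)))
  rw [mul_div_mul_left _ _ this]

lemma conj_mem_vstrip {v : ℂ} (hv : v ∈ vstrip) : conj v ∈ vstrip := by
  simpa [vstrip] using hv

lemma th1_boundary_ne_zero (ht : 0 < t) {γ w : ℂ} (hγ : γ ∈ vstrip) (hw : w ∈ vstripBoundary) :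
    th1 t (w + conj γ) ≠ 0 ∧ th1 t (w - γ) ≠ 0 := by
  obtain ⟨h1, h2⟩ := hγ
  rcases hw with hw | hw
  · constructor
    · refine th1_ne_zero_of_re ht (-1) ?_ ?_ <;> push_cast <;> rw [add_re, conj_re] <;> linarith
    · refine th1_ne_zero_of_re ht 0 ?_ ?_ <;> push_cast <;> rw [sub_re] <;> linarith
  · constructor
    · refine th1_ne_zero_of_re ht (-1) ?_ ?_ <;> push_cast <;> rw [add_re, conj_re] <;> linarith
    · refine th1_ne_zero_of_re ht (-1) ?_ ?_ <;> push_cast <;> rw [sub_re] <;> linarith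

/-- Reflection in the boundary line: w + γ̄ equals -conj(w - γ) on Re w = 0, and differs from it by
the period 1 on Re w = -1/2. The modulus of `th1` is invariant under all these operations. -/
lemma stripGreen_boundary {γ w : ℂ} (hw : w ∈ vstripBoundary) : stripGreen t γ w = 0 := by
  have h : ‖th1 t (w + conj γ)‖ = ‖th1 t (w - γ)‖ := by
    have e : ‖th1 t (-conj (w - γ))‖ = ‖th1 t (w - γ)‖ := by
      rw [th1_neg, norm_neg, th1_conj, RCLike.norm_conj]
    rw [← e]
    rcases hw with hw | hw
    · congr 2
      apply Complex.ext <;> simp [hw, add_comm]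
    · have e2 : -conj (w - γ) = w + conj γ + 1 := by
        apply Complex.ext
        · simp [hw]; ring
        · simp [add_comm]
      rw [e2, th1_add_one, norm_neg]
  rw [stripGreen, norm_div, h]
  by_cases h0 : ‖th1 t (w - γ)‖ = 0
  · simp [h0]
  · rw [div_self h0, Real.log_one]

lemma continuousAt_stripGreen (ht : 0 < t) {γ w : ℂ} (h1 : th1 t (w + conj γ) ≠ 0)
    (h2 : th1 t (w - γ) ≠ 0) : ContinuousAt (stripGreen t γ) w := by
  have c := (differentiable_th1 ht).continuous
  refine ContinuousAt.log ?_ (norm_ne_zero_iff.2 (div_ne_zero h1 h2))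
  refine ContinuousAt.norm (ContinuousAt.div ?_ ?_ h2) <;> fun_prop

lemma frontier_notMem {X : Type*} [TopologicalSpace X] {Ω : Set X} (h : IsOpen Ω) {ξ : X}
    (hξ : ξ ∈ frontier Ω) : ξ ∉ Ω := fun hc => hξ.2 (by rwa [h.interior_eq])

lemma isGreenFunction_stripLift (ht : 0 < t) (hD : p * s' - p' * s ≠ 0)
    (hopen : IsOpen (thetaMap t p s p' s' '' vstrip)) {γ : ℂ} (hγ : γ ∈ vstrip) :
    IsGreenFunction (thetaMap t p s p' s' '' vstrip) (thetaMap t p s p' s' γ)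
      (stripLift t p s p' s' (stripGreen t γ)) := by
  have dth := differentiable_th1 ht
  refine ⟨?_, ?_, ?_⟩
  · rintro _ ⟨v, hv, rfl⟩ hne
    refine sphereHarmonicAt_stripLift ht hD (stripGreen_periodic t γ) hv fun ψ z hψ hz => ?_
    have n1 : th1 t (v + conj γ) ≠ 0 := th1_add_ne_zero ht hv (conj_mem_vstrip hγ)
    have n2 : th1 t (v - γ) ≠ 0 := fun h => hne ((thetaMap_eq_iff ht hD).2 (by rw [h, mul_zero]))
    have a1 : AnalyticAt ℂ (fun w => th1 t (ψ w + conj γ)) z :=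
      (dth.analyticAt _).comp (hψ.add analyticAt_const)
    have a2 : AnalyticAt ℂ (fun w => th1 t (ψ w - γ)) z :=
      (dth.analyticAt _).comp (hψ.sub analyticAt_const)
    exact (a1.div a2 (by rwa [hz])).harmonicAt_log_norm
      (by simp only [Pi.div_apply, hz]; exact div_ne_zero n1 n2)
  · rw [hasLogPole_iff]
    obtain ⟨ψ, h1, h2, h3, h4⟩ := exists_local_lift (p := p) (s := s) (p' := p') (s' := s') ht hD hγ
    set c := chartCenter (thetaMap t p s p' s' γ)
    -- The denominator has a simple zero at the centre c of the chart. Its slope tends to a nonzero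
    -- number, so the lifted function plus log‖w - c‖ even converges.
    have hd : HasDerivAt (fun w => th1 t (ψ w - γ)) (deriv (th1 t) 0 * deriv ψ c) c := by
      have b : HasDerivAt (th1 t) (deriv (th1 t) 0) (ψ c - γ) := by
        rw [h2, sub_self]; exact (dth 0).hasDerivAt
      exact HasDerivAt.comp (h₂ := th1 t) (h := fun w => ψ w - γ) c b
        (h1.differentiableAt.hasDerivAt.sub_const γ)
    have hne : deriv (th1 t) 0 * deriv ψ c ≠ 0 := mul_ne_zero (deriv_th1_zero_ne ht) h3
    have hs := hasDerivAt_iff_tendsto_slope.1 hd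
    have hn : ContinuousAt (fun w => th1 t (ψ w + conj γ)) c :=
      dth.continuous.continuousAt.comp (h1.continuousAt.add continuousAt_const)
    have hn0 : th1 t (ψ c + conj γ) ≠ 0 := by
      rw [h2]; exact th1_add_ne_zero ht hγ (conj_mem_vstrip hγ)
    have l1 : Tendsto (fun w => Real.log ‖th1 t (ψ w + conj γ)‖) (𝓝[≠] c)
        (𝓝 (Real.log ‖th1 t (ψ c + conj γ)‖)) :=
      (hn.norm.log (norm_ne_zero_iff.2 hn0)).mono_left nhdsWithin_le_nhds
    have l2 : Tendsto (fun w => Real.log ‖slope (fun w => th1 t (ψ w - γ)) c w‖) (𝓝[≠] c)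
        (𝓝 (Real.log ‖deriv (th1 t) 0 * deriv ψ c‖)) :=
      (hs.norm).log (norm_ne_zero_iff.2 hne)
    refine ((l1.sub l2).congr' ?_).isBigO_one ℝ
    have hL := (h4 _ (stripGreen_periodic t γ)).filter_mono (nhdsWithin_le_nhds (s := {c}ᶜ))
    have hn' := (hn.eventually_ne hn0).filter_mono (nhdsWithin_le_nhds (s := {c}ᶜ))
    filter_upwards [hL, hn', hs.eventually_ne hne, self_mem_nhdsWithin] with w hw1 hw2 hw3 hw4
    have hwc : w - c ≠ 0 := sub_ne_zero.2 hw4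
    have hsl : slope (fun w => th1 t (ψ w - γ)) c w = th1 t (ψ w - γ) / (w - c) := by
      rw [slope_def_field, h2, sub_self, th1_zero, sub_zero]
    have hth : th1 t (ψ w - γ) ≠ 0 := fun h => hw3 (by rw [hsl, h, zero_div])
    rw [Function.comp, Function.comp] at hw1
    rw [hw1, stripGreen, hsl, norm_div, norm_div,
      Real.log_div (norm_ne_zero_iff.2 hw2) (norm_ne_zero_iff.2 hth),
      Real.log_div (norm_ne_zero_iff.2 hth) (norm_ne_zero_iff.2 hwc)]
    ring
  · intro ξ hξ
    refine tendsto_stripLift ht hD (stripGreen_periodic t γ) (frontier_notMem hopen hξ)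
      fun w hw _ => ?_
    obtain ⟨n1, n2⟩ := th1_boundary_ne_zero ht hγ hw
    have := (continuousAt_stripGreen ht n1 n2).tendsto
    rw [stripGreen_boundary hw] at this
    exact this.mono_left nhdsWithin_le_nhds

lemma thetaMap_re_zero_ne (ht : 0 < t) (hD : p * s' - p' * s ≠ 0) {v w : ℂ} (hv : v.re = 0)
    (hw : w.re = -(1 / 2)) : thetaMap t p s p' s' v ≠ thetaMap t p s p' s' w := fun h => by
  rcases mul_eq_zero.1 ((thetaMap_eq_iff ht hD).1 h) with h | h
  · refine th1_ne_zero_of_re ht (-1) ?_ ?_ h <;> push_cast <;> rw [add_re] <;> linarith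
  · refine th1_ne_zero_of_re ht 0 ?_ ?_ h <;> push_cast <;> rw [sub_re] <;> linarith

lemma periodic_re (t a b : ℝ) : Function.Periodic (fun v : ℂ => a + b * v.re) (t * I) := fun v => by
  simp

lemma sphereHarmonicAt_stripLift_re (ht : 0 < t) (hD : p * s' - p' * s ≠ 0) (a b : ℝ) {v : ℂ}
    (hv : v ∈ vstrip) :
    SphereHarmonicAt (stripLift t p s p' s' fun v => a + b * v.re) (thetaMap t p s p' s' v) := by
  refine sphereHarmonicAt_stripLift ht hD (periodic_re t a b) hv fun ψ z hψ _ => ?_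
  have := ((analyticAt_const (v := (a : ℂ))).add
    ((analyticAt_const (v := (b : ℂ))).mul hψ)).harmonicAt_re
  refine (InnerProductSpace.harmonicAt_congr_nhds (Eventually.of_forall fun w => ?_)).1 this
  simp

lemma tendsto_stripLift_re (ht : 0 < t) (hD : p * s' - p' * s ≠ 0) (a b : ℝ) {ξ : OnePoint ℂ} {x : ℝ}
    (hξ : ξ ∉ thetaMap t p s p' s' '' vstrip)
    (h : ∀ w ∈ vstripBoundary, thetaMap t p s p' s' w = ξ → w.re = x) :
    Tendsto (stripLift t p s p' s' fun v => a + b * v.re) (𝓝[thetaMap t p s p' s' '' vstrip] ξ)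
      (𝓝 (a + b * x)) := by
  refine tendsto_stripLift ht hD (periodic_re t a b) hξ fun w hw hwξ => ?_
  rw [← h w hw hwξ]
  exact (Continuous.tendsto (by fun_prop) w).mono_left nhdsWithin_le_nhds

lemma frontier_cases (ht : 0 < t) (hD : p * s' - p' * s ≠ 0) {ξ : OnePoint ℂ}
    (hξ : ξ ∉ thetaMap t p s p' s' '' vstrip) :
    ξ ∈ thetaMap t p s p' s' '' {v | v.re = 0} ∨
      ξ ∈ thetaMap t p s p' s' '' {v | v.re = -(1 / 2)} := by
  rw [thetaMap_image_vstrip ht hD, Set.notMem_compl_iff] at hξ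
  obtain ⟨w, hw | hw, rfl⟩ := hξ
  · exact Or.inl ⟨w, hw, rfl⟩
  · exact Or.inr ⟨w, hw, rfl⟩

lemma re_eq_of_mem_left (ht : 0 < t) (hD : p * s' - p' * s ≠ 0) {ξ : OnePoint ℂ}
    (hξ : ξ ∈ thetaMap t p s p' s' '' {v | v.re = 0}) :
    ∀ w ∈ vstripBoundary, thetaMap t p s p' s' w = ξ → w.re = 0 := by
  rintro w (hw | hw) rfl
  · exact hw
  · obtain ⟨v, hv, hvw⟩ := hξ
    exact absurd hvw (thetaMap_re_zero_ne ht hD hv hw)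

lemma re_eq_of_mem_right (ht : 0 < t) (hD : p * s' - p' * s ≠ 0) {ξ : OnePoint ℂ}
    (hξ : ξ ∈ thetaMap t p s p' s' '' {v | v.re = -(1 / 2)}) :
    ∀ w ∈ vstripBoundary, thetaMap t p s p' s' w = ξ → w.re = -(1 / 2) := by
  rintro w (hw | hw) rfl
  · obtain ⟨v, hv, hvw⟩ := hξ
    exact absurd hvw.symm (thetaMap_re_zero_ne ht hD hw hv)
  · exact hw

/-- Affine functions of Re v are harmonic, it-periodic and constant on each boundary line; this one
takes the values 1 on Re v = 0 and 0 on Re v = -1/2. -/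
lemma isHarmonicMeasure_left (ht : 0 < t) (hD : p * s' - p' * s ≠ 0)
    (hopen : IsOpen (thetaMap t p s p' s' '' vstrip)) :
    IsHarmonicMeasure (thetaMap t p s p' s' '' vstrip) (thetaMap t p s p' s' '' {v | v.re = 0})
      (stripLift t p s p' s' fun v => 1 + 2 * v.re) := by
  refine ⟨?_, fun ξ hξ => ?_, fun ξ hξ => ?_⟩
  · rintro _ ⟨v, hv, rfl⟩
    exact sphereHarmonicAt_stripLift_re ht hD 1 2 hv
  · have h0 := frontier_notMem hopen hξ.1
    simpa using tendsto_stripLift_re ht hD 1 2 h0 (re_eq_of_mem_left ht hD hξ.2)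
  · have h0 := frontier_notMem hopen hξ.1
    simpa using tendsto_stripLift_re ht hD 1 2 h0
      (re_eq_of_mem_right ht hD ((frontier_cases ht hD h0).resolve_left hξ.2))

lemma isHarmonicMeasure_right (ht : 0 < t) (hD : p * s' - p' * s ≠ 0)
    (hopen : IsOpen (thetaMap t p s p' s' '' vstrip)) :
    IsHarmonicMeasure (thetaMap t p s p' s' '' vstrip)
      (thetaMap t p s p' s' '' {v | v.re = -(1 / 2)})
      (stripLift t p s p' s' fun v => 0 + -2 * v.re) := by
  refine ⟨?_, fun ξ hξ => ?_, fun ξ hξ => ?_⟩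
  · rintro _ ⟨v, hv, rfl⟩
    exact sphereHarmonicAt_stripLift_re ht hD 0 (-2) hv
  · have h0 := frontier_notMem hopen hξ.1
    simpa using tendsto_stripLift_re ht hD 0 (-2) h0 (re_eq_of_mem_right ht hD hξ.2)
  · have h0 := frontier_notMem hopen hξ.1
    simpa using tendsto_stripLift_re ht hD 0 (-2) h0
      (re_eq_of_mem_left ht hD ((frontier_cases ht hD h0).resolve_right hξ.2))

/-- The behaviour of Green's function at infinity, for a map with conjugate coefficients. -/
lemma tendsto_stripLift_sub_log (ht : 0 < t) (hD : p * conj s - conj p * s ≠ 0) {ζ : ℂ}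
    (hζ : ζ ∈ vstrip) (hinf : thetaMap t p s (conj p) (conj s) ζ = OnePoint.infty) :
    th1 t (ζ - conj ζ) ≠ 0 ∧
    Tendsto (fun z : ℂ => stripLift t p s (conj p) (conj s) (stripGreen t ζ) z - Real.log ‖z‖)
      (Bornology.cobounded ℂ) (𝓝 (Real.log (‖th1 t (2 * ζ)‖ / ‖th1 t (ζ - conj ζ)‖))) := by
  have dth := differentiable_th1 ht
  set N : ℂ → ℂ := fun u => p * th1 t u ^ 2 + s * th4 t u ^ 2 with hN
  set M : ℂ → ℂ := fun u => conj p * th1 t u ^ 2 + conj s * th4 t u ^ 2 with hM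
  -- Since the theta functions are real, conjugation interchanges numerator and denominator. The
  -- pole ζ of the map thus gives the zero `conj` ζ.
  have hNM : ∀ u, N (conj u) = conj (M u) := fun u => by
    simp only [hN, hM, th1_conj, th4_conj, map_add, map_mul, map_pow, conj_conj]
  have hMN : ∀ u, M (conj u) = conj (N u) := fun u => by
    simp only [hN, hM, th1_conj, th4_conj, map_add, map_mul, map_pow]
  have hMζ : M ζ = 0 := by
    by_contra h
    rw [thetaMap, toSphere_of_ne h] at hinf
    exact OnePoint.coe_ne_infty _ hinf
  have hNζ : N ζ ≠ 0 := (thetaMap_coord_ne ht hD ζ).resolve_right (not_not.2 hMζ)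
  have hNζ' : N (conj ζ) = 0 := by rw [hNM, hMζ, map_zero]
  set D := (p * conj s - conj p * s) * th4 t 0 ^ 2 with hDdef
  have hD0 : D ≠ 0 := mul_ne_zero hD (pow_ne_zero 2 (th4_zero_ne ht))
  -- Because M vanishes at ζ and N at `conj` ζ, `thetaMap_cross` against these points isolates M and
  -- N and factors each one into two values of `th1`.
  have c1 : ∀ u, ‖N ζ‖ * ‖M u‖ = ‖D‖ * (‖th1 t (u + ζ)‖ * ‖th1 t (u - ζ)‖) := fun u => by
    have := thetaMap_cross ht p s (conj p) (conj s) u ζ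
    change N u * M ζ - N ζ * M u = _ at this
    rw [hMζ, mul_zero, zero_sub] at this
    rw [← norm_mul, ← norm_neg, this, norm_mul, norm_mul (th1 t _)]
  have c2 : ∀ u, ‖N ζ‖ * ‖N u‖ = ‖D‖ * (‖th1 t (u + conj ζ)‖ * ‖th1 t (u - conj ζ)‖) := fun u => by
    have := thetaMap_cross ht p s (conj p) (conj s) u (conj ζ)
    change N u * M (conj ζ) - N (conj ζ) * M u = _ at this
    rw [hNζ', zero_mul, sub_zero, hMN] at this
    rw [← RCLike.norm_conj (N ζ), mul_comm, ← norm_mul, this, norm_mul, norm_mul (th1 t _)]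
  have n0 : ‖N ζ‖ ≠ 0 := norm_ne_zero_iff.2 hNζ
  have nD : ‖D‖ ≠ 0 := norm_ne_zero_iff.2 hD0
  have hζζ : th1 t (ζ - conj ζ) ≠ 0 := fun h => by
    have := c2 ζ
    rw [h, norm_zero, mul_zero, mul_zero] at this
    exact (mul_ne_zero n0 n0) this
  refine ⟨hζζ, ?_⟩
  have h2ζ := th1_two_mul_ne_zero ht hζ
  obtain ⟨ψ, h1, h2, -, h4⟩ :=
    exists_local_inverse (p := p) (s := s) (p' := conj p) (s' := conj s) ht hD h2ζ
  rw [hinf] at h1 h2 h4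
  change AnalyticAt ℂ ψ 0 at h1
  change ψ 0 = ζ at h2
  change ∀ᶠ w in 𝓝 0, thetaMap t p s (conj p) (conj s) (ψ w) = chartInfty w at h4
  have h5 : ∀ᶠ w in 𝓝 0, ψ w ∈ vstrip :=
    h1.continuousAt.eventually_mem (by rw [h2]; exact isOpen_vstrip.mem_nhds hζ)
  have hlim : Tendsto (fun w => Real.log (‖th1 t (ψ w + ζ)‖ / ‖th1 t (ψ w - conj ζ)‖)) (𝓝[≠] 0)
      (𝓝 (Real.log (‖th1 t (2 * ζ)‖ / ‖th1 t (ζ - conj ζ)‖))) := by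
    have hψ : Tendsto ψ (𝓝[≠] 0) (𝓝 ζ) := by
      have := h1.continuousAt.tendsto.mono_left (nhdsWithin_le_nhds (s := {(0 : ℂ)}ᶜ))
      rwa [h2] at this
    have l1 := ((dth.continuous.tendsto (ζ + ζ)).comp (hψ.add_const ζ)).norm
    have l2 := ((dth.continuous.tendsto (ζ - conj ζ)).comp (hψ.sub_const (conj ζ))).norm
    rw [← two_mul] at l1
    exact (l1.div l2 (norm_ne_zero_iff.2 hζζ)).log
      (div_ne_zero (norm_ne_zero_iff.2 h2ζ) (norm_ne_zero_iff.2 hζζ))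
  rw [← inv_nhdsNE_zero, ← Filter.map_inv, tendsto_map'_iff]
  refine hlim.congr' ?_
  filter_upwards [h4.filter_mono nhdsWithin_le_nhds, h5.filter_mono nhdsWithin_le_nhds,
    self_mem_nhdsWithin] with w hw1 hw2 hw3
  have hw0 : w ≠ 0 := hw3
  rw [chartInfty_of_ne hw0] at hw1
  rw [Function.comp, ← hw1, stripLift_apply ht hD (stripGreen_periodic t ζ) hw2]
  have hMw : M (ψ w) ≠ 0 := fun h => by
    rw [thetaMap, show conj p * th1 t (ψ w) ^ 2 + conj s * th4 t (ψ w) ^ 2 = M (ψ w) from rfl, h,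
      toSphere_zero] at hw1
    exact OnePoint.infty_ne_coe _ hw1
  rw [thetaMap, toSphere_of_ne hMw, OnePoint.coe_eq_coe] at hw1
  change N (ψ w) / M (ψ w) = w⁻¹ at hw1
  have hNw : N (ψ w) ≠ 0 := fun h => by
    rw [h, zero_div] at hw1
    exact inv_ne_zero hw0 hw1.symm
  rw [← hw1, stripGreen, norm_div, norm_div]
  have nM := norm_ne_zero_iff.2 hMw
  have nN := norm_ne_zero_iff.2 hNw
  have d1 := c1 (ψ w)
  have d2 := c2 (ψ w)
  have m1 : ‖th1 t (ψ w + ζ)‖ * ‖th1 t (ψ w - ζ)‖ ≠ 0 :=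
    right_ne_zero_of_mul (d1 ▸ mul_ne_zero n0 nM)
  have m2 : ‖th1 t (ψ w + conj ζ)‖ * ‖th1 t (ψ w - conj ζ)‖ ≠ 0 :=
    right_ne_zero_of_mul (d2 ▸ mul_ne_zero n0 nN)
  obtain ⟨m3, m4⟩ := mul_ne_zero_iff.1 m1
  obtain ⟨m5, m6⟩ := mul_ne_zero_iff.1 m2
  rw [← Real.log_div (div_ne_zero m5 m4) (div_ne_zero nN nM)]
  congr 1
  -- In the quotient of exp g by |N/M| the factors at ψ w + `conj` ζ and at ψ w - ζ cancel. The
  -- latter is the one that tends to 0.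
  have r1 : ‖M (ψ w)‖ = ‖D‖ / ‖N ζ‖ * (‖th1 t (ψ w + ζ)‖ * ‖th1 t (ψ w - ζ)‖) := by
    field_simp; linarith
  have r2 : ‖N (ψ w)‖ = ‖D‖ / ‖N ζ‖ * (‖th1 t (ψ w + conj ζ)‖ * ‖th1 t (ψ w - conj ζ)‖) := by
    field_simp; linarith
  rw [r1, r2]
  field_simp

end

/-! ### The arcs as images of the boundary lines of the strip -/

lemma conj_circlePt (x : ℝ) : conj (circlePt x) = circlePt (-x) := by
  rw [circlePt, circlePt, ← exp_conj]; simp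

lemma circlePt_add (x y : ℝ) : circlePt (x + y) = circlePt x * circlePt y := by
  rw [circlePt, circlePt, circlePt, ← Complex.exp_add]; push_cast; ring_nf

lemma circlePt_ne_zero (x : ℝ) : circlePt x ≠ 0 := Complex.exp_ne_zero _

lemma continuous_circlePt : Continuous circlePt := by unfold circlePt; fun_prop

lemma circlePt_sub_neg (x : ℝ) : circlePt x - circlePt (-x) = 2 * I * (Real.sin x : ℂ) := by
  rw [circlePt, circlePt, ofReal_sin, Complex.sin]
  push_cast
  ring_nf; simp only [I_sq]; ring

lemma circlePt_sub_circlePt (x y : ℝ) : circlePt x - circlePt y =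
    2 * I * (Real.sin ((x - y) / 2) : ℂ) * circlePt ((x + y) / 2) := by
  rw [← circlePt_sub_neg, sub_mul, ← circlePt_add, ← circlePt_add]
  ring_nf

lemma doubleRatio_circlePt {x₁ x₂ x₃ x₄ : ℝ} (h : Real.sin ((x₄ - x₂) / 2) ≠ 0)
    (h' : Real.sin ((x₃ - x₁) / 2) ≠ 0) :
    doubleRatio (circlePt x₁) (circlePt x₂) (circlePt x₃) (circlePt x₄) =
      ((Real.sin ((x₄ - x₁) / 2) * Real.sin ((x₃ - x₂) / 2) /
        (Real.sin ((x₄ - x₂) / 2) * Real.sin ((x₃ - x₁) / 2)) : ℝ) : ℂ) := by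
  rw [doubleRatio]
  simp only [circlePt_sub_circlePt]
  have e : circlePt ((x₄ + x₁) / 2) * circlePt ((x₃ + x₂) / 2) =
      circlePt ((x₄ + x₂) / 2) * circlePt ((x₃ + x₁) / 2) := by
    rw [← circlePt_add, ← circlePt_add]; congr 1; ring
  have c := circlePt_ne_zero
  have n1 : (Real.sin ((x₄ - x₂) / 2) : ℂ) ≠ 0 := by exact_mod_cast h
  have n2 : (Real.sin ((x₃ - x₁) / 2) : ℂ) ≠ 0 := by exact_mod_cast h'
  have c1 := c ((x₄ + x₂) / 2)
  have c2 := c ((x₃ + x₁) / 2)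
  rw [div_div_div_eq, ofReal_div, ofReal_mul, ofReal_mul]
  have nI : (2 * I : ℂ) ≠ 0 := mul_ne_zero two_ne_zero I_ne_zero
  rw [div_eq_div_iff (mul_ne_zero (mul_ne_zero (mul_ne_zero nI n1) c1)
    (mul_ne_zero (mul_ne_zero nI n2) c2)) (mul_ne_zero n1 n2)]
  linear_combination (2 * I) ^ 2 * (Real.sin ((x₄ - x₁) / 2) : ℂ) * (Real.sin ((x₃ - x₂) / 2) : ℂ) *
    (Real.sin ((x₄ - x₂) / 2) : ℂ) * (Real.sin ((x₃ - x₁) / 2) : ℂ) * e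

/-- Ptolemy's identity for four points of the circle. -/
lemma sin_ptolemy (x y z w : ℝ) :
    Real.sin ((w - y) / 2) * Real.sin ((z - x) / 2) -
      Real.sin ((w - x) / 2) * Real.sin ((z - y) / 2) =
    Real.sin ((w - z) / 2) * Real.sin ((y - x) / 2) := by
  simp only [sub_div, Real.sin_sub]
  ring

/-- The condition that a point with real parameter of a Möbius transformation that maps the real
line to the unit circle is the point `e^{i x}`. -/
lemma toSphere_eq_circlePt_iff {A C x₁ x₂ : ℝ} (x : ℝ) {X Y : ℝ}
    (h : (A * circlePt (x₂ / 2) * X - C * circlePt (x₁ / 2) * Y : ℂ) ≠ 0 ∨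
      (A * circlePt (-(x₂ / 2)) * X - C * circlePt (-(x₁ / 2)) * Y : ℂ) ≠ 0) :
    toSphere (A * circlePt (x₂ / 2) * X - C * circlePt (x₁ / 2) * Y)
      (A * circlePt (-(x₂ / 2)) * X - C * circlePt (-(x₁ / 2)) * Y) = (circlePt x : OnePoint ℂ) ↔
    A * X * Real.sin ((x₂ - x) / 2) + C * Y * Real.sin ((x - x₁) / 2) = 0 := by
  have e : (circlePt x : OnePoint ℂ) = toSphere (circlePt x) 1 := by
    rw [toSphere_of_ne one_ne_zero, div_one]
  rw [e, toSphere_eq_iff h (Or.inr one_ne_zero), ← sub_eq_zero]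
  have e2 : ∀ y : ℝ, circlePt (y / 2) - circlePt x * circlePt (-(y / 2)) =
      2 * I * (Real.sin ((y - x) / 2) : ℂ) * circlePt (x / 2) := fun y => by
    rw [← circlePt_add, circlePt_sub_circlePt]; ring_nf
  have e3 : Real.sin ((x₁ - x) / 2) = -Real.sin ((x - x₁) / 2) := by
    rw [← Real.sin_neg]; ring_nf
  have key : (A * circlePt (x₂ / 2) * X - C * circlePt (x₁ / 2) * Y) * 1 -
      circlePt x * (A * circlePt (-(x₂ / 2)) * X - C * circlePt (-(x₁ / 2)) * Y) =
      2 * I * circlePt (x / 2) *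
        ((A * X * Real.sin ((x₂ - x) / 2) + C * Y * Real.sin ((x - x₁) / 2) : ℝ) : ℂ) := by
    have a2 := e2 x₂
    have a1 := e2 x₁
    rw [e3] at a1
    push_cast at a1 a2 ⊢
    linear_combination (A * X : ℂ) * a2 - (C * Y : ℂ) * a1
  rw [key, mul_eq_zero, or_iff_right, ofReal_eq_zero]
  exact mul_ne_zero (mul_ne_zero two_ne_zero I_ne_zero) (circlePt_ne_zero _)

lemma th1_imag_sq (t y : ℝ) : th1 t (y * I) ^ 2 = ((-(th1 t (y * I)).im ^ 2 : ℝ) : ℂ) := by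
  have h : th1 t (y * I) = (th1 t (y * I)).im * I := Complex.ext (by simp [th1_imag]) (by simp)
  conv_lhs => rw [h, mul_pow, I_sq]
  push_cast; ring

lemma th2_imag_sq (t y : ℝ) : th2 t (y * I) ^ 2 = (((th2 t (y * I)).re ^ 2 : ℝ) : ℂ) := by
  push_cast; rw [ofReal_re_eq (th2_imag t y)]

lemma th3_imag_sq (t y : ℝ) : th3 t (y * I) ^ 2 = (((th3 t (y * I)).re ^ 2 : ℝ) : ℂ) := by
  push_cast; rw [ofReal_re_eq (th3_imag t y)]

lemma th4_imag_sq (t y : ℝ) : th4 t (y * I) ^ 2 = (((th4 t (y * I)).re ^ 2 : ℝ) : ℂ) := by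
  push_cast; rw [ofReal_re_eq (th4_imag t y)]

lemma th_sq_sub {t : ℝ} (ht : 0 < t) (x : ℂ) :
    th3 t 0 ^ 2 * th3 t x ^ 2 - th2 t 0 ^ 2 * th2 t x ^ 2 = th4 t 0 ^ 2 * th4 t x ^ 2 := by
  rw [th2_sq ht, th2_sq ht, th3_sq ht, th3_sq ht, th4_sq ht, th4_sq ht, mul_zero]; ring

/-- On the line Re v = -1/2 the quotient (`th1`/`th4`)² is (`th2`/`th3`)² at iy. The two bounds
confine it to [k, 1/k], the interval that corresponds to the second arc. -/
lemma modulus_mul_le {t : ℝ} (ht : 0 < t) (y : ℝ) :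
    thetaModulus t * (th3 t (y * I)).re ^ 2 ≤ (th2 t (y * I)).re ^ 2 ∧
    thetaModulus t * (th2 t (y * I)).re ^ 2 ≤ (th3 t (y * I)).re ^ 2 := by
  have h3 := th3_zero_pos ht
  have h1 := th_sq_add₃ ht (y * I)
  have h2 := th_sq_sub ht (y * I)
  rw [th1_imag_sq, th2_imag_sq, th3_imag_sq, ← th2_zero_re, ← th3_zero_re, ← th4_zero_re] at h1
  rw [th2_imag_sq, th3_imag_sq, th4_imag_sq, ← th2_zero_re, ← th3_zero_re, ← th4_zero_re] at h2
  norm_cast at h1 h2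
  have h3' : 0 < (th3 t 0).re ^ 2 := by positivity
  rw [thetaModulus, div_pow]
  constructor
  · rw [div_mul_eq_mul_div, div_le_iff₀ h3']
    nlinarith [mul_nonneg (sq_nonneg (th4 t 0).re) (sq_nonneg (th1 t (y * I)).im)]
  · rw [div_mul_eq_mul_div, div_le_iff₀ h3']
    nlinarith [mul_nonneg (sq_nonneg (th4 t 0).re) (sq_nonneg (th4 t (y * I)).re)]

/-- The coefficients of the conformal map, with arcs `[x₁, x₂]` and `[x₃, x₄]` -/
structure ArcData (t A C x₁ x₂ x₃ x₄ : ℝ) : Prop where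
  t_pos : 0 < t
  A_pos : 0 < A
  C_pos : 0 < C
  h₁₂ : x₁ < x₂
  h₂₃ : x₂ < x₃
  h₃₄ : x₃ < x₄
  h₄₁ : x₄ < x₁ + 2 * Real.pi
  -- The two equations say that the values k and 1/k of (`th1`/`th4`)² are sent to the end points
  -- with parameters x₄ and x₃.
  eq₄ : A * Real.sin ((x₄ - x₂) / 2) * thetaModulus t = C * Real.sin ((x₄ - x₁) / 2)
  eq₃ : A * Real.sin ((x₃ - x₂) / 2) = C * Real.sin ((x₃ - x₁) / 2) * thetaModulus t

/-- The conformal map with the given coefficients. -/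
def arcMap (t A C x₁ x₂ : ℝ) : ℂ → OnePoint ℂ :=
  thetaMap t (A * circlePt (x₂ / 2)) (-(C * circlePt (x₁ / 2)))
    (A * circlePt (-(x₂ / 2))) (-(C * circlePt (-(x₁ / 2))))

lemma arcMap_det_ne {t A C x₁ x₂ x₃ x₄ : ℝ} (H : ArcData t A C x₁ x₂ x₃ x₄) :
    A * circlePt (x₂ / 2) * -(C * circlePt (-(x₁ / 2))) -
      A * circlePt (-(x₂ / 2)) * -(C * circlePt (x₁ / 2)) ≠ 0 := by
  have e : (A * circlePt (x₂ / 2) * -(C * circlePt (-(x₁ / 2))) -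
      A * circlePt (-(x₂ / 2)) * -(C * circlePt (x₁ / 2)) : ℂ) =
      -(A * C * (2 * I * (Real.sin ((x₂ - x₁) / 2) : ℂ))) := by
    rw [← circlePt_sub_neg, show (x₂ - x₁) / 2 = x₂ / 2 + -(x₁ / 2) by ring,
      show -(x₂ / 2 + -(x₁ / 2)) = -(x₂ / 2) + x₁ / 2 by ring, circlePt_add, circlePt_add]
    ring
  rw [e, neg_ne_zero]
  have s : 0 < Real.sin ((x₂ - x₁) / 2) := Real.sin_pos_of_pos_of_lt_pi (by linarith [H.h₁₂])
    (by linarith [H.h₂₃, H.h₃₄, H.h₄₁])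
  refine mul_ne_zero (mul_ne_zero ?_ ?_) (mul_ne_zero (mul_ne_zero two_ne_zero I_ne_zero) ?_)
  · exact_mod_cast H.A_pos.ne'
  · exact_mod_cast H.C_pos.ne'
  · exact_mod_cast s.ne'

lemma arcMap_eq_circlePt_iff {t A C x₁ x₂ x₃ x₄ : ℝ} (H : ArcData t A C x₁ x₂ x₃ x₄) (x : ℝ)
    {v : ℂ} {X Y : ℝ} (hX : th1 t v ^ 2 = X) (hY : th4 t v ^ 2 = Y) :
    arcMap t A C x₁ x₂ v = (circlePt x : OnePoint ℂ) ↔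
      A * X * Real.sin ((x₂ - x) / 2) + C * Y * Real.sin ((x - x₁) / 2) = 0 := by
  have h := thetaMap_coord_ne H.t_pos (arcMap_det_ne H) v
  rw [hX, hY] at h
  rw [← toSphere_eq_circlePt_iff, arcMap, thetaMap, hX, hY]
  · simp only [neg_mul, sub_eq_add_neg]
  · simpa only [neg_mul, sub_eq_add_neg] using h

/-- On the imaginary axis (`th1`/`th4`)² is nonpositive or infinite: 0 at v = 0, infinite at v =
it/2. A point e^{ix} is the value at iy exactly if a real function of x and y vanishes; the
intermediate value theorem is applied in y for one inclusion and in x for the other. -/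
lemma arc_left_eq {t A C x₁ x₂ x₃ x₄ : ℝ} (H : ArcData t A C x₁ x₂ x₃ x₄) :
    arc x₁ x₂ = arcMap t A C x₁ x₂ '' {v | v.re = 0} := by
  have ht := H.t_pos
  have c1 := (differentiable_th1 ht).continuous
  have c4 := (differentiable_th4 ht).continuous
  have hx12 := H.h₁₂
  have hx23 := H.h₂₃
  have hx34 := H.h₃₄
  have hx41 := H.h₄₁
  have hA := H.A_pos
  have hC := H.C_pos
  have key := fun (x y : ℝ) => arcMap_eq_circlePt_iff H x (th1_imag_sq t y) (th4_imag_sq t y)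
  apply Subset.antisymm
  · rintro _ ⟨x, ⟨hx1, hx2⟩, rfl⟩
    have s1 : 0 ≤ Real.sin ((x - x₁) / 2) :=
      Real.sin_nonneg_of_nonneg_of_le_pi (by linarith) (by linarith)
    have s2 : 0 ≤ Real.sin ((x₂ - x) / 2) :=
      Real.sin_nonneg_of_nonneg_of_le_pi (by linarith) (by linarith)
    set G : ℝ → ℝ := fun y => A * -(th1 t (y * I)).im ^ 2 * Real.sin ((x₂ - x) / 2) +
      C * (th4 t (y * I)).re ^ 2 * Real.sin ((x - x₁) / 2) with hG
    have c1' : Continuous fun y : ℝ => (th1 t (y * I)).im :=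
      continuous_im.comp (c1.comp (by fun_prop))
    have c4' : Continuous fun y : ℝ => (th4 t (y * I)).re :=
      continuous_re.comp (c4.comp (by fun_prop))
    have hGc : Continuous G := ((continuous_const.mul (c1'.pow 2).neg).mul continuous_const).add
      ((continuous_const.mul (c4'.pow 2)).mul continuous_const)
    have hG0 : 0 ≤ G 0 := by
      simp only [hG]
      rw [ofReal_zero, zero_mul, th1_zero]
      simp only [zero_im]
      norm_num
      positivity
    have hGt : G (t / 2) ≤ 0 := by
      have e : th4 t ((t / 2 : ℝ) * I) = 0 := by
        have := th4_add_half_period t 0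
        rw [th1_zero, mul_zero, zero_add] at this
        rw [← this]; congr 1; push_cast; ring
      simp only [hG]
      rw [e, zero_re]
      have := mul_nonneg (mul_nonneg hA.le (sq_nonneg (th1 t ((t / 2 : ℝ) * I)).im)) s2
      linarith
    obtain ⟨y, -, hy⟩ := intermediate_value_Icc' (half_pos ht).le hGc.continuousOn ⟨hGt, hG0⟩
    exact ⟨y * I, by simp, (key x y).2 hy⟩
  · rintro _ ⟨v, hv, rfl⟩
    have hv' : v = v.im * I := Complex.ext (by simpa using hv) (by simp)
    rw [hv']
    set y := v.im
    set G : ℝ → ℝ := fun x => A * -(th1 t (y * I)).im ^ 2 * Real.sin ((x₂ - x) / 2) +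
      C * (th4 t (y * I)).re ^ 2 * Real.sin ((x - x₁) / 2) with hG
    have hGc : Continuous G := by fun_prop
    have s : 0 ≤ Real.sin ((x₂ - x₁) / 2) :=
      Real.sin_nonneg_of_nonneg_of_le_pi (by linarith) (by linarith)
    have h1 : G x₁ ≤ 0 := by
      simp only [hG, sub_self, zero_div, Real.sin_zero, mul_zero, add_zero]
      have := mul_nonneg (mul_nonneg hA.le (sq_nonneg (th1 t (y * I)).im)) s
      linarith
    have h2 : 0 ≤ G x₂ := by
      simp only [hG, sub_self, zero_div, Real.sin_zero, mul_zero, zero_add]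
      positivity
    obtain ⟨x, hx, hx0⟩ := intermediate_value_Icc hx12.le hGc.continuousOn ⟨h1, h2⟩
    exact ⟨x, hx, ((key x y).2 hx0).symm⟩

lemma th_boundary_right (t y : ℝ) : th1 t (-(1 / 2) + y * I) ^ 2 = ((th2 t (y * I)).re ^ 2 : ℝ) ∧
    th4 t (-(1 / 2) + y * I) ^ 2 = ((th3 t (y * I)).re ^ 2 : ℝ) := by
  have e1 : th1 t (-(1 / 2) + y * I) = -th2 t (y * I) := by
    rw [th1, neg_add_cancel_comm]
  have e4 : th4 t (-(1 / 2) + y * I) = th3 t (y * I) := by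
    rw [th4, neg_add_cancel_comm]
  rw [e1, e4, neg_sq, th2_imag_sq, th3_imag_sq]
  exact ⟨rfl, rfl⟩

/-- As for the first arc, on the line where the quotient is k at height y = 0 and 1/k at y = t/2.
The signs needed for the intermediate value theorem come from `eq₃` and `eq₄`, together with
Ptolemy's identity or `modulus_mul_le`. -/
lemma arc_right_eq {t A C x₁ x₂ x₃ x₄ : ℝ} (H : ArcData t A C x₁ x₂ x₃ x₄) :
    arc x₃ x₄ = arcMap t A C x₁ x₂ '' {v | v.re = -(1 / 2)} := by
  have ht := H.t_pos
  have c2 := (differentiable_th2 ht).continuous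
  have c3 := (differentiable_th3 ht).continuous
  have hx12 := H.h₁₂
  have hx23 := H.h₂₃
  have hx34 := H.h₃₄
  have hx41 := H.h₄₁
  have hA := H.A_pos
  have hC := H.C_pos
  have eq3 := H.eq₃
  have eq4 := H.eq₄
  have hk := thetaModulus_pos ht
  set k := thetaModulus t with hkdef
  have key := fun (x y : ℝ) => arcMap_eq_circlePt_iff H x (th_boundary_right t y).1
    (th_boundary_right t y).2
  have hneg : ∀ x, Real.sin ((x₂ - x) / 2) = -Real.sin ((x - x₂) / 2) := fun x => by
    rw [← Real.sin_neg]; ring_nf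
  have s31 : 0 < Real.sin ((x₃ - x₁) / 2) :=
    Real.sin_pos_of_pos_of_lt_pi (by linarith) (by linarith)
  have s32 : 0 < Real.sin ((x₃ - x₂) / 2) :=
    Real.sin_pos_of_pos_of_lt_pi (by linarith) (by linarith)
  have s42 : 0 < Real.sin ((x₄ - x₂) / 2) :=
    Real.sin_pos_of_pos_of_lt_pi (by linarith) (by linarith)
  have s21 : 0 < Real.sin ((x₂ - x₁) / 2) :=
    Real.sin_pos_of_pos_of_lt_pi (by linarith) (by linarith)
  apply Subset.antisymm
  · rintro _ ⟨x, ⟨hx1, hx2⟩, rfl⟩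
    have sa : 0 ≤ Real.sin ((x₄ - x) / 2) :=
      Real.sin_nonneg_of_nonneg_of_le_pi (by linarith) (by linarith)
    have sb : 0 ≤ Real.sin ((x - x₃) / 2) :=
      Real.sin_nonneg_of_nonneg_of_le_pi (by linarith) (by linarith)
    set G : ℝ → ℝ := fun y => A * (th2 t (y * I)).re ^ 2 * Real.sin ((x₂ - x) / 2) +
      C * (th3 t (y * I)).re ^ 2 * Real.sin ((x - x₁) / 2) with hG
    have hGc : Continuous G := by fun_prop
    have q4 := sin_ptolemy x₁ x₂ x x₄
    have q3 := sin_ptolemy x₁ x₂ x₃ x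
    have hG0 : 0 ≤ G 0 := by
      have e : (th2 t 0).re ^ 2 = k * (th3 t 0).re ^ 2 := by
        have := (th3_zero_pos ht).ne'
        rw [hkdef, thetaModulus]; field_simp
      simp only [hG]
      rw [ofReal_zero, zero_mul, e, hneg]
      -- After multiplication by the positive sin((x₄ - x₂)/2), `eq₄` eliminates A, and Ptolemy's
      -- identity leaves a product of nonnegative sines.
      have h1 : 0 ≤ C * Real.sin ((x - x₁) / 2) - A * k * Real.sin ((x - x₂) / 2) := by
        by_contra hc
        push Not at hc
        have h2 := mul_neg_of_neg_of_pos hc s42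
        have h3 : (C * Real.sin ((x - x₁) / 2) - A * k * Real.sin ((x - x₂) / 2)) *
            Real.sin ((x₄ - x₂) / 2) = C * (Real.sin ((x₄ - x) / 2) * Real.sin ((x₂ - x₁) / 2)) := by
          rw [← q4]; linear_combination -Real.sin ((x - x₂) / 2) * eq4
        rw [h3] at h2
        have := mul_nonneg hC.le (mul_nonneg sa s21.le)
        linarith
      have := mul_nonneg (sq_nonneg (th3 t 0).re) h1
      linarith
    have hGt : G (t / 2) ≤ 0 := by
      have e : (th3 t ((t / 2 : ℝ) * I)).re ^ 2 = k * (th2 t ((t / 2 : ℝ) * I)).re ^ 2 := by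
        have a2 := th2_add_half_period t 0
        have a3 := th3_add_half_period t 0
        rw [zero_add, show (t * I / 2 : ℂ) = (t / 2 : ℝ) * I by push_cast; ring] at a2 a3
        have n3 := th3_zero_ne ht
        apply Complex.ofReal_injective
        rw [ofReal_mul, ← th2_imag_sq, ← th3_imag_sq, a2, a3, hkdef, ofReal_thetaModulus]
        field_simp
      simp only [hG]
      rw [e, hneg]
      have h1 : C * k * Real.sin ((x - x₁) / 2) - A * Real.sin ((x - x₂) / 2) ≤ 0 := by
        by_contra hc
        push Not at hc
        have h2 := mul_pos hc s31
        have h3 : (C * k * Real.sin ((x - x₁) / 2) - A * Real.sin ((x - x₂) / 2)) *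
            Real.sin ((x₃ - x₁) / 2) = -A * (Real.sin ((x - x₃) / 2) * Real.sin ((x₂ - x₁) / 2)) := by
          rw [← q3]; linear_combination -Real.sin ((x - x₁) / 2) * eq3
        rw [h3] at h2
        have := mul_nonneg hA.le (mul_nonneg sb s21.le)
        linarith
      have := mul_nonneg (sq_nonneg (th2 t ((t / 2 : ℝ) * I)).re) (neg_nonneg.2 h1)
      linarith
    obtain ⟨y, -, hy⟩ := intermediate_value_Icc' (half_pos ht).le hGc.continuousOn ⟨hGt, hG0⟩
    exact ⟨-(1 / 2) + y * I, by simp, (key x y).2 hy⟩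
  · rintro _ ⟨v, hv, rfl⟩
    have hv' : v = -(1 / 2) + v.im * I := by
      apply Complex.ext
      · simpa using hv
      · simp
    rw [hv']
    set y := v.im
    obtain ⟨m1, m2⟩ := modulus_mul_le ht y
    rw [← hkdef] at m1 m2
    set G : ℝ → ℝ := fun x => A * (th2 t (y * I)).re ^ 2 * Real.sin ((x₂ - x) / 2) +
      C * (th3 t (y * I)).re ^ 2 * Real.sin ((x - x₁) / 2) with hG
    have hGc : Continuous G := by fun_prop
    have h1 : 0 ≤ G x₃ := by
      have e : G x₃ = C * Real.sin ((x₃ - x₁) / 2) *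
          ((th3 t (y * I)).re ^ 2 - k * (th2 t (y * I)).re ^ 2) := by
        simp only [hG, hneg]; linear_combination -(th2 t (y * I)).re ^ 2 * eq3
      rw [e]
      exact mul_nonneg (mul_nonneg hC.le s31.le) (sub_nonneg.2 m2)
    have h2 : G x₄ ≤ 0 := by
      have e : G x₄ = -(A * Real.sin ((x₄ - x₂) / 2) *
          ((th2 t (y * I)).re ^ 2 - k * (th3 t (y * I)).re ^ 2)) := by
        simp only [hG, hneg]; linear_combination -(th3 t (y * I)).re ^ 2 * eq4
      rw [e, neg_nonpos]
      exact mul_nonneg (mul_nonneg hA.le s42.le) (sub_nonneg.2 m1)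
    obtain ⟨x, hx, hx0⟩ := intermediate_value_Icc' hx34.le hGc.continuousOn ⟨h2, h1⟩
    exact ⟨x, hx, ((key x y).2 hx0).symm⟩

lemma isClosed_arc (x y : ℝ) : IsClosed (arc x y) :=
  (isCompact_Icc.image (OnePoint.continuous_coe.comp continuous_circlePt)).isClosed

lemma arcs_compl_eq {t A C x₁ x₂ x₃ x₄ : ℝ} (H : ArcData t A C x₁ x₂ x₃ x₄) :
    (arc x₁ x₂ ∪ arc x₃ x₄)ᶜ = arcMap t A C x₁ x₂ '' vstrip := by
  rw [arc_left_eq H, arc_right_eq H, ← image_union, arcMap,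
    thetaMap_image_vstrip H.t_pos (arcMap_det_ne H)]
  rfl

/-! ### The rectangle and the normalized strip -/

/-- The parameter `K' / K` of the theta functions. -/
def periodRatio (k : ℝ) : ℝ := ellipticK' k / ellipticK k

lemma thetaH_eq_th1 {k : ℝ} (ht : 0 < periodRatio k) (u : ℂ) :
    thetaH k u = th1 (periodRatio k) (u / (2 * ellipticK k)) := by
  rw [thetaH, ← (hasSum_th1 ht _).tsum_eq, ← tsum_mul_left]
  congr 1; ext j
  have e : nome k ^ (((j : ℝ) + 1 / 2) ^ 2) =
      Real.exp (-Real.pi * periodRatio k * ((j : ℝ) + 1 / 2) ^ 2) := by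
    rw [nome, ← Real.exp_mul, periodRatio, mul_div_assoc]
  rw [e]
  ring_nf

lemma thetaT_eq_th4 {k : ℝ} (ht : 0 < periodRatio k) (u : ℂ) :
    thetaT k u = th4 (periodRatio k) (u / (2 * ellipticK k)) := by
  rw [← sub_add_cancel (th4 (periodRatio k) (u / (2 * ellipticK k))) 1,
    ← (hasSum_th4 ht _).tsum_eq, thetaT, add_comm, ← tsum_mul_left]
  congr 2; ext j
  have e : nome k ^ ((j + 1) ^ 2) = Real.exp (-Real.pi * periodRatio k * ((j : ℝ) + 1) ^ 2) := by
    rw [nome, ← Real.exp_nat_mul, periodRatio]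
    congr 1; push_cast; ring
  rw [e]
  congr 3
  rw [div_mul_eq_mul_div, ← mul_div_assoc, mul_comm (2 * (Real.pi : ℂ)), mul_assoc]
  ring_nf

lemma jacobiSn_sq_eq {k : ℝ} (hk : 0 < k) (ht : 0 < periodRatio k) (u : ℂ) :
    jacobiSn k u ^ 2 = (k : ℂ)⁻¹ * (th1 (periodRatio k) (u / (2 * ellipticK k)) ^ 2 /
      th4 (periodRatio k) (u / (2 * ellipticK k)) ^ 2) := by
  rw [jacobiSn, thetaH_eq_th1 ht, thetaT_eq_th4 ht, mul_pow, div_pow, inv_pow, ← ofReal_pow,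
    Real.sq_sqrt hk.le]

lemma div_two_mul_mem_iff {k : ℝ} (hK : 0 < ellipticK k) (u : ℂ) :
    u / (2 * ellipticK k) ∈
      vstrip ∩ {v | v.im ∈ Ioc (-(periodRatio k / 2)) (periodRatio k / 2)} ↔ u ∈ rect k := by
  have e : u / (2 * ellipticK k) = u / ((2 * ellipticK k : ℝ) : ℂ) := by push_cast; rfl
  have e1 : periodRatio k / 2 = ellipticK' k / (2 * ellipticK k) := by
    rw [periodRatio, div_div, mul_comm]
  have h2 : 0 < 2 * ellipticK k := by positivity
  rw [e, e1]
  simp only [vstrip, rect, mem_inter_iff, mem_ofPred_eq, div_ofReal_re, div_ofReal_im, mem_Ioc,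
    and_assoc, ← neg_div, div_lt_div_iff_of_pos_right h2, div_le_div_iff_of_pos_right h2]
  rw [div_lt_div_iff₀ two_pos h2, div_lt_iff₀ (c := 2 * ellipticK k) h2, zero_mul]
  constructor <;> rintro ⟨h, h'⟩ <;> exact ⟨by linarith, h'⟩

/-- The double ratio of the end points is the square of the modulus, which lies in `(0, 1)`. -/
lemma modulus_of_doubleRatio {x₁ x₂ x₃ x₄ k : ℝ} (h₁₂ : x₁ < x₂) (h₂₃ : x₂ < x₃) (h₃₄ : x₃ < x₄)
    (h₄₁ : x₄ < x₁ + 2 * Real.pi) (hk0 : 0 < k)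
    (hk : (k : ℂ) ^ 2 = doubleRatio (circlePt x₁) (circlePt x₂) (circlePt x₃) (circlePt x₄)) :
    k ∈ Ioo (0 : ℝ) 1 ∧ Real.sin ((x₄ - x₁) / 2) * Real.sin ((x₃ - x₂) / 2) =
      k ^ 2 * (Real.sin ((x₄ - x₂) / 2) * Real.sin ((x₃ - x₁) / 2)) := by
  have pos : ∀ x : ℝ, 0 < x → x < 2 * Real.pi → 0 < Real.sin (x / 2) := fun x h h' =>
    Real.sin_pos_of_pos_of_lt_pi (by linarith) (by linarith)
  have s42 := pos (x₄ - x₂) (by linarith) (by linarith)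
  have s31 := pos (x₃ - x₁) (by linarith) (by linarith)
  have s43 := pos (x₄ - x₃) (by linarith) (by linarith)
  have s21 := pos (x₂ - x₁) (by linarith) (by linarith)
  rw [doubleRatio_circlePt s42.ne' s31.ne'] at hk
  rw [← ofReal_pow, ofReal_inj, eq_div_iff (mul_pos s42 s31).ne'] at hk
  refine ⟨⟨hk0, ?_⟩, hk.symm⟩
  -- Ptolemy's identity exhibits 1 - k², times a positive factor, as a product of two positive
  -- sines.
  have pt := sin_ptolemy x₁ x₂ x₃ x₄
  have : 0 < (1 - k ^ 2) * (Real.sin ((x₄ - x₂) / 2) * Real.sin ((x₃ - x₁) / 2)) := by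
    have := mul_pos s43 s21
    linarith
  have := pos_of_mul_pos_left this (mul_pos s42 s31).le
  nlinarith

section

variable {x₁ x₂ k : ℝ}

lemma alphaParam_coeff (h1 : Real.cos (x₁ / 2) ≠ 0) (h2 : Real.sin (x₂ / 2) ≠ 0) :
    (alphaParam x₁ x₂ - 1) * Real.sin (x₂ / 2) =
      -(Real.sin ((x₁ + x₂) / 2) / Real.cos (x₁ / 2)) := by
  rw [alphaParam, Real.tan_eq_sin_div_cos, Real.cot_eq_cos_div_sin, add_div, Real.sin_add]
  field_simp
  ring

lemma sin_half_ne {x : ℝ} (h : Real.sin x ≠ 0) : Real.sin (x / 2) ≠ 0 ∧ Real.cos (x / 2) ≠ 0 := by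
  rw [show x = 2 * (x / 2) by ring, Real.sin_two_mul] at h
  exact ⟨right_ne_zero_of_mul (left_ne_zero_of_mul h), right_ne_zero_of_mul h⟩

/-- The conformal map has a pole where `sn²` has the prescribed value. -/
lemma conformalMap_eq_infty_iff (h1 : Real.sin x₁ ≠ 0) (h2 : Real.sin (x₂ / 2) ≠ 0) (u : ℂ) :
    conformalMap k x₁ x₂ u = OnePoint.infty ↔ jacobiSn k u ^ 2 =
      (Real.sin ((x₁ + x₂) / 2) : ℂ) * circlePt ((x₂ - x₁) / 2) / (Real.sin x₁ : ℂ) := by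
  obtain ⟨hs, hc⟩ := sin_half_ne h1
  have e : conformalMap k x₁ x₂ u = OnePoint.infty ↔ mapDen k x₁ x₂ u = 0 := by
    rw [conformalMap]
    split_ifs with h <;> simp [h]
  have hs' : (Real.sin (x₁ / 2) : ℂ) ≠ 0 := ofReal_ne_zero.2 hs
  have hc' : (Real.cos (x₁ / 2) : ℂ) ≠ 0 := ofReal_ne_zero.2 hc
  have hx : (Real.sin x₁ : ℂ) = 2 * Real.sin (x₁ / 2) * Real.cos (x₁ / 2) := by
    rw [show x₁ = 2 * (x₁ / 2) by ring, Real.sin_two_mul]; push_cast; ring_nf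
  have c2 := circlePt_ne_zero (-(x₂ / 2))
  have e1 : circlePt (-(x₁ / 2)) = circlePt ((x₂ - x₁) / 2) * circlePt (-(x₂ / 2)) := by
    rw [← circlePt_add]; ring_nf
  have e2 : mapDen k x₁ x₂ u = 2 * Real.sin (x₁ / 2) * circlePt (-(x₂ / 2)) * (jacobiSn k u ^ 2 -
      (Real.sin ((x₁ + x₂) / 2) : ℂ) * circlePt ((x₂ - x₁) / 2) / (Real.sin x₁ : ℂ)) := by
    rw [mapDen, alphaParam_coeff hc h2, hx, e1, ofReal_neg, ofReal_div]
    field_simp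
    ring
  rw [e, e2, mul_eq_zero, or_iff_right (mul_ne_zero (mul_ne_zero two_ne_zero hs') c2), sub_eq_zero]

/-- The conformal map in terms of theta functions. -/
lemma conformalMap_eq_arcMap (hk : 0 < k) (ht : 0 < periodRatio k) (h1 : Real.sin x₁ ≠ 0)
    (h2 : Real.sin (x₂ / 2) ≠ 0) {u : ℂ}
    (hu : th4 (periodRatio k) (u / (2 * ellipticK k)) ≠ 0) :
    conformalMap k x₁ x₂ u = arcMap (periodRatio k) (2 * Real.sin (x₁ / 2))
      (k * (Real.sin ((x₁ + x₂) / 2) / Real.cos (x₁ / 2))) x₁ x₂ (u / (2 * ellipticK k)) := by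
  have hc := (sin_half_ne h1).2
  have hk' : (k : ℂ) ≠ 0 := ofReal_ne_zero.2 hk.ne'
  have scale : ∀ {c : ℂ}, c ≠ 0 → ∀ a b : ℂ, toSphere a b = toSphere (c * a) (c * b) := by
    intro c hc a b
    by_cases hb : b = 0
    · rw [hb, mul_zero, toSphere_zero, toSphere_zero]
    · rw [toSphere_of_ne hb, toSphere_of_ne (mul_ne_zero hc hb), mul_div_mul_left _ _ hc]
  -- Both homogeneous coordinates are multiplied by k `th4`², which clears the denominator of sn².
  rw [show conformalMap k x₁ x₂ u = toSphere (mapNum k x₁ x₂ u) (mapDen k x₁ x₂ u) from rfl,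
    scale (mul_ne_zero hk' (pow_ne_zero 2 hu)), arcMap, thetaMap, mapNum, mapDen,
    alphaParam_coeff hc h2, jacobiSn_sq_eq hk ht]
  have hc' : (Real.cos (x₁ / 2) : ℂ) ≠ 0 := ofReal_ne_zero.2 hc
  congr 1 <;>
  · simp only [ofReal_neg, ofReal_div, ofReal_mul, ofReal_ofNat]
    field_simp

end

/-- By φ₁ + φ₄ = 2π, sin((φ₄ - φ₂)/2) = sin((φ₁ + φ₂)/2) and sin((φ₄ - φ₁)/2) = sin φ₁. Once
`thetaModulus` is replaced by k, `eq₄` holds identically and `eq₃` is the double ratio condition. -/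
lemma arcData_of_doubleRatio {φ₁ φ₂ φ₃ φ₄ k : ℝ}
    (h₁₂ : φ₁ < φ₂) (h₂₃ : φ₂ < φ₃) (h₃₄ : φ₃ < φ₄) (h₄₁ : φ₄ < φ₁ + 2 * Real.pi)
    (hsymm : φ₁ = 2 * Real.pi - φ₄) (hk_pos : 0 < k)
    (hk : (k : ℂ) ^ 2 =
      doubleRatio (circlePt φ₁) (circlePt φ₂) (circlePt φ₃) (circlePt φ₄)) :
    ArcData (periodRatio k) (2 * Real.sin (φ₁ / 2))
      (k * (Real.sin ((φ₁ + φ₂) / 2) / Real.cos (φ₁ / 2))) φ₁ φ₂ φ₃ φ₄ := by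
  obtain ⟨hk01, e⟩ := modulus_of_doubleRatio h₁₂ h₂₃ h₃₄ h₄₁ hk_pos hk
  obtain ⟨ht, hmod⟩ := thetaModulus_ratio hk01
  have hs : 0 < Real.sin (φ₁ / 2) := Real.sin_pos_of_pos_of_lt_pi (by linarith) (by linarith)
  have hc : 0 < Real.cos (φ₁ / 2) :=
    Real.cos_pos_of_mem_Ioo ⟨by linarith [Real.pi_pos], by linarith⟩
  have hσ : 0 < Real.sin ((φ₁ + φ₂) / 2) :=
    Real.sin_pos_of_pos_of_lt_pi (by linarith) (by linarith)
  have h42 : Real.sin ((φ₄ - φ₂) / 2) = Real.sin ((φ₁ + φ₂) / 2) := by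
    rw [← Real.sin_pi_sub]; congr 1; linarith
  have h41 : Real.sin ((φ₄ - φ₁) / 2) = 2 * Real.sin (φ₁ / 2) * Real.cos (φ₁ / 2) := by
    rw [← Real.sin_two_mul, ← Real.sin_pi_sub]; congr 1; linarith
  rw [h42, h41] at e
  refine ⟨ht, by positivity, by positivity, h₁₂, h₂₃, h₃₄, h₄₁, ?_, ?_⟩
  · rw [periodRatio, hmod, h42, h41]
    field_simp
  · rw [periodRatio, hmod]
    field_simp
    linear_combination e

/-! ### Transfer of the strip results to the two arcs -/

theorem lemma1 (φ₁ φ₂ φ₃ φ₄ : ℝ)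
    (h₁₂ : φ₁ < φ₂) (h₂₃ : φ₂ < φ₃) (h₃₄ : φ₃ < φ₄) (h₄₁ : φ₄ < φ₁ + 2 * Real.pi)
    (hsymm : φ₁ = 2 * Real.pi - φ₄)
    (k : ℝ) (hk_pos : 0 < k)
    (hk : (k : ℂ) ^ 2 =
      doubleRatio (circlePt φ₁) (circlePt φ₂) (circlePt φ₃) (circlePt φ₄)) :
    -- the map is a bijection of the rectangle onto the complement of the two arcs
    Set.BijOn (conformalMap k φ₁ φ₂) (rect k) (arc φ₁ φ₂ ∪ arc φ₃ φ₄)ᶜ ∧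
    -- the Green's function with an arbitrary pole
    (∀ γ ∈ rect k,
      (∃ g, IsGreenFunction (arc φ₁ φ₂ ∪ arc φ₃ φ₄)ᶜ (conformalMap k φ₁ φ₂ γ) g) ∧
      ∀ g, IsGreenFunction (arc φ₁ φ₂ ∪ arc φ₃ φ₄)ᶜ (conformalMap k φ₁ φ₂ γ) g →
        ∀ u ∈ rect k, u ≠ γ →
          g (conformalMap k φ₁ φ₂ u) =
            Real.log ‖thetaH k (u + (starRingEnd ℂ) γ) / thetaH k (u - γ)‖) ∧
    -- existence of the harmonic measures of the two arcs
    (∃ ω₁, IsHarmonicMeasure (arc φ₁ φ₂ ∪ arc φ₃ φ₄)ᶜ (arc φ₁ φ₂) ω₁) ∧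
    (∃ ω₂, IsHarmonicMeasure (arc φ₁ φ₂ ∪ arc φ₃ φ₄)ᶜ (arc φ₃ φ₄) ω₂) ∧
    (∀ ω₁ ω₂, IsHarmonicMeasure (arc φ₁ φ₂ ∪ arc φ₃ φ₄)ᶜ (arc φ₁ φ₂) ω₁ →
      IsHarmonicMeasure (arc φ₁ φ₂ ∪ arc φ₃ φ₄)ᶜ (arc φ₃ φ₄) ω₂ →
      ω₁ OnePoint.infty + ω₂ OnePoint.infty = 1) ∧
    -- the point `ζ` that corresponds to infinity
    (∃! ζ : ℂ, ζ ∈ rect k ∧ jacobiSn k ζ ^ 2 =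
      (Real.sin ((φ₁ + φ₂) / 2) : ℂ) * circlePt ((φ₂ - φ₁) / 2) / (Real.sin φ₁ : ℂ)) ∧
    ∀ ζ ∈ rect k, jacobiSn k ζ ^ 2 =
        (Real.sin ((φ₁ + φ₂) / 2) : ℂ) * circlePt ((φ₂ - φ₁) / 2) / (Real.sin φ₁ : ℂ) →
      conformalMap k φ₁ φ₂ ζ = OnePoint.infty ∧
      -- the harmonic measure of the second arc at infinity
      (∀ ω₂, IsHarmonicMeasure (arc φ₁ φ₂ ∪ arc φ₃ φ₄)ᶜ (arc φ₃ φ₄) ω₂ →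
        ω₂ OnePoint.infty = -ζ.re / ellipticK k) ∧
      -- the capacity
      HasLogCapacity (arc φ₁ φ₂ ∪ arc φ₃ φ₄)
        ‖thetaH k (2 * Complex.I * (ζ.im : ℂ)) / thetaH k (2 * ζ)‖ := by
  have H := arcData_of_doubleRatio h₁₂ h₂₃ h₃₄ h₄₁ hsymm hk_pos hk
  obtain ⟨hk01, -⟩ := modulus_of_doubleRatio h₁₂ h₂₃ h₃₄ h₄₁ hk_pos hk
  have hs1 : Real.sin φ₁ ≠ 0 := (Real.sin_pos_of_pos_of_lt_pi (by linarith) (by linarith)).ne'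
  have hs2 : Real.sin (φ₂ / 2) ≠ 0 :=
    (Real.sin_pos_of_pos_of_lt_pi (by linarith) (by linarith)).ne'
  have hK : 0 < ellipticK k := ellipticK_pos hk_pos.le hk01.2
  have ht := H.t_pos
  have hD := arcMap_det_ne H
  have hΩ := arcs_compl_eq H
  have hopen : IsOpen (arc φ₁ φ₂ ∪ arc φ₃ φ₄)ᶜ :=
    ((isClosed_arc _ _).union (isClosed_arc _ _)).isOpen_compl
  have hne : (arc φ₁ φ₂ ∪ arc φ₃ φ₄)ᶜ ≠ univ := by
    rw [Ne, compl_univ_iff]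
    exact (((nonempty_Icc.2 h₁₂.le).image _).mono subset_union_left).ne_empty
  have hopen' := hopen
  rw [hΩ] at hopen'
  have hrect := div_two_mul_mem_iff (k := k) hK
  -- The zeros of `th4` have integral real part, so sn has no pole in the rectangle.
  have hconf : ∀ u ∈ rect k, conformalMap k φ₁ φ₂ u = _ := fun u hu =>
    conformalMap_eq_arcMap hk_pos ht hs1 hs2 (th4_ne_zero_of_re ht
      (by linarith [((hrect u).2 hu).1.1]) ((hrect u).2 hu).1.2)
  have hK2 : (2 * ellipticK k : ℂ) ≠ 0 := mul_ne_zero two_ne_zero (ofReal_ne_zero.2 hK.ne')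
  have hscale : BijOn (fun u : ℂ => u / (2 * ellipticK k)) (rect k)
      (vstrip ∩ {v | v.im ∈ Ioc (-(periodRatio k / 2)) (periodRatio k / 2)}) := by
    refine ⟨fun u hu => (hrect u).2 hu, fun u _ v _ h => (div_left_inj' hK2).1 h, fun v hv => ?_⟩
    have e : v * (2 * ellipticK k) / (2 * ellipticK k) = v := mul_div_cancel_right₀ _ hK2
    exact ⟨_, (hrect _).1 (by rwa [e]), e⟩
  have hbij : BijOn (conformalMap k φ₁ φ₂) (rect k) (arc φ₁ φ₂ ∪ arc φ₃ φ₄)ᶜ := by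
    rw [hΩ]
    exact ((thetaMap_image_rect ht hD).comp hscale).congr fun u hu => (hconf u hu).symm
  have hre : ∀ u : ℂ, (u / (2 * ellipticK k)).re = u.re / (2 * ellipticK k) := fun u => by
    rw [← ofReal_ofNat, ← ofReal_mul, div_ofReal_re]
  have hconj : ∀ u : ℂ, conj (u / (2 * ellipticK k)) = conj u / (2 * ellipticK k) := fun u => by
    rw [← ofReal_ofNat, ← ofReal_mul, map_div₀, conj_ofReal]
  have green : ∀ γ ∈ rect k, IsGreenFunction (arc φ₁ φ₂ ∪ arc φ₃ φ₄)ᶜ (conformalMap k φ₁ φ₂ γ)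
      _ := fun γ hγ => by
    rw [hconf γ hγ, hΩ]
    exact isGreenFunction_stripLift ht hD hopen' ((hrect γ).2 hγ).1
  have left := isHarmonicMeasure_left ht hD hopen'
  have right := isHarmonicMeasure_right ht hD hopen'
  rw [← arcMap, ← hΩ, ← arc_left_eq H] at left
  rw [← arcMap, ← hΩ, ← arc_right_eq H] at right
  have hinf : OnePoint.infty ∈ (arc φ₁ φ₂ ∪ arc φ₃ φ₄)ᶜ := by
    rintro (⟨x, -, h⟩ | ⟨x, -, h⟩) <;> exact OnePoint.coe_ne_infty _ h
  obtain ⟨ζ₀, hζ₀, hζ₀'⟩ := hbij.surjOn hinf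
  have hval : ∀ ζ ∈ rect k, conformalMap k φ₁ φ₂ ζ = OnePoint.infty →
      ∀ a b : ℝ, stripLift _ _ _ _ _ (fun v => a + b * v.re) OnePoint.infty =
        a + b * (ζ.re / (2 * ellipticK k)) := fun ζ hζ h a b => by
    rw [← hre, ← h, hconf ζ hζ]
    exact stripLift_apply ht hD (periodic_re _ a b) ((hrect ζ).2 hζ).1
  refine ⟨hbij, fun γ hγ => ⟨⟨_, green γ hγ⟩, fun g hg u hu huγ => ?_⟩, ⟨_, left⟩, ⟨_, right⟩,
    fun ω₁ ω₂ h₁ h₂ => ?_, ⟨ζ₀, ⟨hζ₀, (conformalMap_eq_infty_iff hs1 hs2 _).1 hζ₀'⟩, ?_⟩,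
    fun ζ hζ hsn => ?_⟩
  · rw [hg.unique hopen hne (green γ hγ) (hbij.mapsTo hu) fun h => huγ (hbij.injOn hu hγ h),
      hconf u hu, arcMap, stripLift_apply ht hD (stripGreen_periodic _ _) ((hrect u).2 hu).1,
      stripGreen, thetaH_eq_th1 ht, thetaH_eq_th1 ht, add_div, sub_div, hconj]
  · rw [h₁.unique hopen hne left hinf, h₂.unique hopen hne right hinf, hval ζ₀ hζ₀ hζ₀',
      hval ζ₀ hζ₀ hζ₀']
    ring
  · rintro ζ ⟨hζ, hsn⟩
    exact hbij.injOn hζ hζ₀ (((conformalMap_eq_infty_iff hs1 hs2 _).2 hsn).trans hζ₀'.symm)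
  · have hζ' := (conformalMap_eq_infty_iff (k := k) hs1 hs2 ζ).2 hsn
    refine ⟨hζ', fun ω₂ h₂ => ?_, ?_⟩
    · rw [h₂.unique hopen hne right hinf, hval ζ hζ hζ']
      field_simp
      ring
    · have hstrip := ((hrect ζ).2 hζ).1
      have hp : ∀ a x : ℝ, conj (a * circlePt x) = a * circlePt (-x) := fun a x => by
        rw [map_mul, conj_ofReal, conj_circlePt]
      have hg := green ζ hζ
      have hpole := hζ'
      have hdet := hD
      rw [hconf ζ hζ, arcMap] at hpole
      rw [hζ'] at hg
      -- The coefficients of numerator and denominator of `arcMap` are complex conjugates, which is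
      -- the form that `tendsto_stripLift_sub_log` requires.
      simp only [← hp] at hpole hdet hg
      obtain ⟨hne1, hlim⟩ := tendsto_stripLift_sub_log ht hdet hstrip hpole
      refine ⟨_, _, hg, hlim, ?_⟩
      have hne2 := th1_two_mul_ne_zero ht hstrip
      have e1 : 2 * I * (ζ.im : ℂ) / (2 * ellipticK k) =
          ζ / (2 * ellipticK k) - conj (ζ / (2 * ellipticK k)) := by
        rw [hconj, ← sub_div, sub_conj]; push_cast; ring
      rw [thetaH_eq_th1 ht, thetaH_eq_th1 ht, e1, mul_div_assoc, ← Real.log_inv,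
        Real.exp_log (inv_pos.2 (div_pos (norm_pos_iff.2 hne2) (norm_pos_iff.2 hne1))), inv_div,
        norm_div]

end
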